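/- Work over $\mathbb C$. For a positive integer $r$ and integers $a_1,\dots,a_5$ let $\frac1r(a_1,\dots,a_5)$ denote the quotient $X=\mathbb A^5/\mu_r=\operatorname{Spec}\mathbb C[x_1,\dots,x_5]^{\mu_r}$, where $\zeta\in\mu_r$ acts by $x_i\mapsto\zeta^{a_i}x_i$, together with the closed point $x\in X$ that is the image of the origin. Let $$\operatorname{mld}(x,X)=\min\{a(E,X)\mid E\text{ a prime divisor over }X\text{ with center }\{x\}\},$$ where $a(E,X)=1+\operatorname{ord}_E(K_Y-\pi^*K_X)$ is the log discrepancy of a prime divisor $E$ on a normal variety $Y$ with a birational morphism $\pi:Y\to X$. If $x$ is an isolated singular point of $X=\frac1r(a_1,\dots,a_5)$, then this minimum exists, and if $\operatorname{mld}(x,X)<2$ then $\operatorname{mld}(x,X)\le 2-\frac1{19}$. The bound is attained: $\frac1{19}(3,4,5,7,18)$ is an isolated singularity and its minimal log discrepancy is $2-\frac1{19}$. -/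

import Mathlib

namespace MldGap

/-! ### Orders of rational functions and of rational top forms along a discrete valuation ring -/

section Orders

variable {K : Type*} [Field K]

/-- For a domain `B` with fraction field `K` and a prime `p` of `B`, the local ring `B_p`, as the
subring of `K` of all fractions `b / s` with `b, s ∈ B` and `s ∉ p`. -/
def localRing {B : Type*} [CommRing B] [Algebra B K] (p : PrimeSpectrum B) : Subring K where
  carrier := {x | ∃ b s : B, s ∉ p.asIdeal ∧ x * algebraMap B K s = algebraMap B K b}
  mul_mem' := by
    rintro x y ⟨b, s, hs, hx⟩ ⟨c, t, ht, hy⟩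
    refine ⟨b * c, s * t, fun h => (p.isPrime.mem_or_mem h).elim hs ht, ?_⟩
    rw [map_mul, map_mul, ← hx, ← hy]; ring
  one_mem' := ⟨1, 1, fun h => p.isPrime.ne_top ((Ideal.eq_top_iff_one _).2 h), by simp⟩
  add_mem' := by
    rintro x y ⟨b, s, hs, hx⟩ ⟨c, t, ht, hy⟩
    refine ⟨b * t + c * s, s * t, fun h => (p.isPrime.mem_or_mem h).elim hs ht, ?_⟩
    rw [map_add, map_mul, map_mul, map_mul, ← hx, ← hy]; ring
  zero_mem' := ⟨0, 1, fun h => p.isPrime.ne_top ((Ideal.eq_top_iff_one _).2 h), by simp⟩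
  neg_mem' := by
    rintro x ⟨b, s, hs, hx⟩
    exact ⟨-b, s, hs, by rw [map_neg, ← hx]; ring⟩

/-- `g ∈ K` has order `n` with respect to the discrete valuation ring `R` of `K`: it is a unit
of `R` times the `n`-th power of a uniformizer. -/
def HasOrder (R : Subring K) (g : K) (n : ℤ) : Prop :=
  ∃ t u : R, Irreducible t ∧ IsUnit u ∧ g = (u : K) * (t : K) ^ n

variable [Algebra ℂ K]

/-- Rational differential `d`-forms on a variety over `ℂ` with function field `K`. -/
abbrev RationalForm (K : Type*) [Field K] [Algebra ℂ K] (d : ℕ) : Type _ := ⋀[K]^d (Ω[K⁄ℂ])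

/-- The `d`-forms that are regular along `R`: the image of `⋀^d Ω_{R/ℂ}` in `⋀^d Ω_{K/ℂ}`, that is,
the `R`-span of the forms `df₁ ∧ ⋯ ∧ df_d` with `fᵢ ∈ R`. -/
noncomputable def regularForms (R : Subring K) (d : ℕ) : Submodule R (RationalForm K d) :=
  Submodule.span R (Set.range fun f : Fin d → R =>
    exteriorPower.ιMulti K d fun i => KaehlerDifferential.D ℂ K (f i : K))

/-- The rational top form `ω` has order `n` along the discrete valuation ring `R` of `K`:
for a uniformizer `t`, the form `t⁻ⁿ ω` generates the regular top forms as an `R`-module. In other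
words, the coefficient of the divisor of `ω` along the prime divisor with local ring `R` is `n`. -/
def HasFormOrder (R : Subring K) {d : ℕ} (ω : RationalForm K d) (n : ℤ) : Prop :=
  ∃ t : R, Irreducible t ∧ Submodule.span R {(t : K) ^ (-n) • ω} = regularForms R d

end Orders

/-! ### Minimal log discrepancies

`X = Spec A` is a normal affine variety over `ℂ` of dimension `d` with function field `K`, and `x` is
a closed point of `X`. -/

section Mld

variable (A K : Type*) [CommRing A] [IsDomain A] [Algebra ℂ A] [Field K] [Algebra A K]
  [IsFractionRing A K] [Algebra ℂ K] [IsScalarTower ℂ A K]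

/-- A prime divisor `E` over `X = Spec A`, that is, a prime divisor on a normal variety `Y` with a
birational morphism `Y → X`. It is given by an affine chart `Spec B` of `Y` that meets `E` (so
`A ⊆ B ⊆ K`, and `B` is of finite type and normal) together with the generic point of `E`,
a prime of height one of `B`. (Every such `Spec B → X` extends to a proper birational
morphism from a normal variety, so asking `Y → X` to be proper gives the same divisors.) -/
structure PrimeDivisorOver where
  /-- The coordinate ring of the affine chart of `Y`. -/
  chart : Subalgebra A K
  finiteType : chart.FG
  normal : IsIntegrallyClosed chart
  /-- The generic point of `E`. -/
  point : PrimeSpectrum chart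
  height_eq_one : point.asIdeal.height = 1

variable {A K}

/-- The local ring of `Y` at the generic point of `E`, the valuation ring of `ord_E`. -/
def PrimeDivisorOver.valuationRing (E : PrimeDivisorOver A K) : Subring K :=
  localRing E.point

/-- The center of `E` on `X` (its generic point): the image of the generic point of `E`. -/
def PrimeDivisorOver.center (E : PrimeDivisorOver A K) : PrimeSpectrum A :=
  PrimeSpectrum.comap (algebraMap A E.chart) E.point

/-- `m K_X = div g` in a neighbourhood of `x`, where `K_X = div ω`, `m > 0`: along every prime divisor
of `X` through `x`, the order of `g` is `m` times the order of `ω`. In particular `m K_X` is Cartier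
at `x`; `X` is `ℚ`-Gorenstein at `x` when such data exist. -/
def IsLocalEquation (x : PrimeSpectrum A) {d : ℕ} (ω : RationalForm K d) (m : ℕ) (g : K) : Prop :=
  0 < m ∧ ∀ P : PrimeSpectrum A, P.asIdeal.height = 1 → P ≤ x →
    ∃ k : ℤ, HasFormOrder (localRing P : Subring K) ω k ∧
      HasOrder (localRing P : Subring K) g (m * k)

/-- `a` is the log discrepancy `a(E, X) = 1 + ord_E (K_Y - π^* K_X)`, for `E` over `X` with center
`x`, where `π : Y → X`: if `K_X = div ω` and `m K_X = div g` near `x`, then `K_Y = div ω` on `Y` and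
`π^* K_X = (1 / m) div g` over a neighbourhood of `x`. (The value does not depend on `ω, m, g`.) -/
def IsLogDiscrepancy (d : ℕ) (x : PrimeSpectrum A) (E : PrimeDivisorOver A K) (a : ℚ) : Prop :=
  ∃ (ω : RationalForm K d) (m : ℕ) (g : K), IsLocalEquation x ω m g ∧
    ∃ k l : ℤ, HasFormOrder E.valuationRing ω k ∧ HasOrder E.valuationRing g l ∧
      a = 1 + k - (l : ℚ) / m

variable (K) in
/-- `μ` is the minimal log discrepancy of the `d`-dimensional variety `X = Spec A` at `x`: the minimum
of the log discrepancies `a(E, X)` of the prime divisors `E` over `X` with center `x`. -/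
def IsMld (d : ℕ) (x : PrimeSpectrum A) (μ : ℚ) : Prop :=
  IsLeast {a : ℚ | ∃ E : PrimeDivisorOver A K, E.center = x ∧ IsLogDiscrepancy d x E a} μ

end Mld

/-! ### Isolated cyclic quotient singularities -/

/-- `x` is an isolated singularity of `Spec A`: the local ring at `x` is not regular, but the local
ring at every proper generalization of `x` is. (If `A` is of finite type over a field and `x` is a
closed point, this says that `x` is an isolated point of the singular locus.) -/
def IsIsolatedSingularity {A : Type*} [CommRing A] (x : PrimeSpectrum A) : Prop :=
  ¬ IsRegularLocalRing (Localization.AtPrime x.asIdeal) ∧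
    ∀ p : PrimeSpectrum A, p < x → IsRegularLocalRing (Localization.AtPrime p.asIdeal)

/-- The coordinate change `xᵢ ↦ ζ ^ aᵢ xᵢ` of the polynomial ring `ℂ[x₁, …, x_d]`. -/
noncomputable def diagonalAction {d : ℕ} (a : Fin d → ℤ) (ζ : ℂ) :
    MvPolynomial (Fin d) ℂ →ₐ[ℂ] MvPolynomial (Fin d) ℂ :=
  MvPolynomial.aeval fun i => MvPolynomial.C (ζ ^ a i) * MvPolynomial.X i

/-- The coordinate ring `ℂ[x₁, …, x_d]^{μ_r}` of the cyclic quotient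
`(1 / r)(a₁, …, a_d) = 𝔸^d / μ_r`, where `ζ ∈ μ_r` acts with the weights `a₁, …, a_d`. -/
noncomputable def cyclicQuotient {d : ℕ} (r : ℕ) (a : Fin d → ℤ) :
    Subalgebra ℂ (MvPolynomial (Fin d) ℂ) where
  carrier := {f | ∀ ζ : ℂ, ζ ^ r = 1 → diagonalAction a ζ f = f}
  mul_mem' := fun hf hg ζ hζ => by rw [map_mul, hf ζ hζ, hg ζ hζ]
  add_mem' := fun hf hg ζ hζ => by rw [map_add, hf ζ hζ, hg ζ hζ]
  algebraMap_mem' := fun c ζ _ => (diagonalAction a ζ).commutes c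

/-- The image of the origin in `𝔸^d / μ_r`: the maximal ideal of the invariant polynomials without
constant term. -/
noncomputable def origin {d : ℕ} (r : ℕ) (a : Fin d → ℤ) : PrimeSpectrum (cyclicQuotient r a) :=
  ⟨RingHom.ker ((MvPolynomial.constantCoeff (σ := Fin d) (R := ℂ)).comp
    (cyclicQuotient r a).val.toRingHom), RingHom.ker_isPrime _⟩

end MldGap

/-! The quotient is toric. Let M be the lattice of exponents of invariant Laurent monomials
(`weightLattice`) and N its dual. Write c₁, …, c_d for the coordinates of w ∈ N with respect to the
primitive vectors on the rays of the cone (`cubeCoord`).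

Minimal log discrepancy. The orders of monomials along a divisor E centred at the origin form a
vector w ∈ N in the interior of the cone. The form dlog b₁ ∧ … ∧ dlog b_d, for a basis b of M, has
at most a simple pole along E. On X its divisor is minus the sum of the toric divisors. Hence a(E,
X) ≥ ∑ cᵢ(w) (`exists_toricDiscrepancy_le`), and every primitive interior w is realised by a divisor
with equality (`exists_isLogDiscrepancy`). So the mld is the minimum of ∑ cᵢ over interior lattice
vectors (`isMld_of_isLeast`). It exists because r ∑ cᵢ is a positive integer.

Isolatedness. If some lattice vector has its coordinates in (0, 1) on a set F and 0 elsewhere, the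
generic point of the face F is singular (`not_isRegularLocalRing_facePrime`). At an isolated
singularity, therefore, a vector of N with one integral coordinate has all coordinates integral.

Gap. Suppose the minimum μ, attained at c, satisfies 2 - 1/19 < μ < 2. For 1 ≤ j ≤ 18 the number jμ
lies strictly between 2j - 1 and 2j, so neither jc nor -jc has an integral coordinate. Their
fractional parts are thus interior lattice points, and minimality of μ applied to both traps ∑ ⌊j
cᵢ⌋ strictly between 2j - 4 and 2j - 2 for 2 ≤ j ≤ 18. So the sum is 2j - 3 for all these j, which a
finite search excludes (`boxes_eq_nil`, `exists_sum_floor_ne`).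

Example. Coprimality of the weights to r makes the punctured quotient regular
(`isRegularLocalRing_of_powVar_notMem`). The vector (3, 4, 5, 7, 18)/19 lies in the open cube and
has sum 37/19, and congruences modulo 19 show that no interior vector has a smaller sum. -/

namespace MldGap

/-! ### Local rings at primes, as subrings of the fraction field. -/

section LocalRing

variable {K : Type*} [Field K] {B : Type*} [CommRing B] [Algebra B K]

lemma algebraMap_mem_localRing (p : PrimeSpectrum B) (b : B) :
    algebraMap B K b ∈ (localRing p : Subring K) :=
  ⟨b, 1, fun h => p.isPrime.ne_top ((Ideal.eq_top_iff_one _).2 h), by simp⟩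

noncomputable instance localRingAlgebra (p : PrimeSpectrum B) :
    Algebra B (localRing p : Subring K) :=
  ((algebraMap B K).codRestrict (localRing p : Subring K)
    (algebraMap_mem_localRing p)).toAlgebra

@[simp] lemma coe_algebraMap_localRing (p : PrimeSpectrum B) (b : B) :
    ((algebraMap B (localRing p : Subring K) b : (localRing p : Subring K)) : K) =
      algebraMap B K b := rfl

variable [IsFractionRing B K]

lemma inv_mem_localRing {p : PrimeSpectrum B} {s : B} (hs : s ∉ p.asIdeal) :
    (algebraMap B K s)⁻¹ ∈ (localRing p : Subring K) := by
  refine ⟨1, s, hs, ?_⟩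
  rw [map_one, inv_mul_cancel₀]
  rw [Ne, FaithfulSMul.algebraMap_eq_zero_iff B K]
  rintro rfl; exact hs p.asIdeal.zero_mem

lemma inv_mem_localRing_iff {p : PrimeSpectrum B} {s : B} (h0 : s ≠ 0) :
    (algebraMap B K s)⁻¹ ∈ (localRing p : Subring K) ↔ s ∉ p.asIdeal := by
  refine ⟨?_, inv_mem_localRing⟩
  rintro ⟨b, t, ht, h⟩ hs
  have hs0 : algebraMap B K s ≠ 0 := by rwa [Ne, FaithfulSMul.algebraMap_eq_zero_iff B K]
  have : t = b * s := by
    apply IsFractionRing.injective B K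
    rw [map_mul, ← h]; field_simp
  exact ht (this ▸ p.asIdeal.mul_mem_left b hs)

lemma mem_localRing_iff {p : PrimeSpectrum B} {x : K} : x ∈ (localRing p : Subring K) ↔
    ∃ b s : B, s ∉ p.asIdeal ∧ x = algebraMap B K b * (algebraMap B K s)⁻¹ := by
  refine exists_congr fun b => exists_congr fun s => and_congr_right fun hs => ?_
  have : algebraMap B K s ≠ 0 := by
    rw [Ne, FaithfulSMul.algebraMap_eq_zero_iff B K]
    rintro rfl; exact hs p.asIdeal.zero_mem
  rw [eq_mul_inv_iff_mul_eq₀ this]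

variable [IsDomain B]

instance isLocalization_localRing (p : PrimeSpectrum B) :
    IsLocalization.AtPrime (localRing p : Subring K) p.asIdeal where
  map_units s := by
    rw [isUnit_iff_exists_inv]
    have hs : (s : B) ≠ 0 := by
      rintro h; exact s.2 (h ▸ p.asIdeal.zero_mem)
    refine ⟨⟨_, inv_mem_localRing s.2⟩, Subtype.ext ?_⟩
    simpa using mul_inv_cancel₀ (by rwa [Ne, FaithfulSMul.algebraMap_eq_zero_iff B K])
  surj := by
    rintro ⟨x, b, s, hs, h⟩
    exact ⟨(b, ⟨s, hs⟩), Subtype.ext h⟩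
  exists_of_eq := fun {x y} h => ⟨1, by
    have := congrArg Subtype.val h
    simp only [coe_algebraMap_localRing] at this
    rw [IsFractionRing.injective B K this]⟩

instance isScalarTower_localRing (p : PrimeSpectrum B) :
    IsScalarTower B (localRing p : Subring K) K := IsScalarTower.of_algebraMap_eq fun _ => rfl

instance isFractionRing_localRing (p : PrimeSpectrum B) :
    IsFractionRing (localRing p : Subring K) K :=
  IsFractionRing.isFractionRing_of_isDomain_of_isLocalization p.asIdeal.primeCompl _ _

/-- The local ring is a Noetherian normal domain of dimension one, so its maximal ideal is its only
nonzero prime. -/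
lemma isDiscreteValuationRing_localRing [IsNoetherianRing B] [IsIntegrallyClosed B]
    {p : PrimeSpectrum B} (hp : p.asIdeal.height = 1) :
    IsDiscreteValuationRing (localRing p : Subring K) := by
  have hloc : IsLocalRing (localRing p : Subring K) :=
    IsLocalization.AtPrime.isLocalRing _ p.asIdeal
  have : IsNoetherianRing (localRing p : Subring K) :=
    IsLocalization.isNoetherianRing p.asIdeal.primeCompl _ inferInstance
  have hic : IsIntegrallyClosed (localRing p : Subring K) :=
    isIntegrallyClosed_of_isLocalization _ p.asIdeal.primeCompl p.asIdeal.primeCompl_le_nonZeroDivisors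
  have hdim := IsLocalization.AtPrime.ringKrullDim_eq_height p.asIdeal (localRing p : Subring K)
  rw [hp] at hdim
  have hle : Ring.KrullDimLE 1 (localRing p : Subring K) := by
    rw [Ring.KrullDimLE, Order.krullDimLE_iff]
    exact hdim.le
  have hnf : ¬ IsField (localRing p : Subring K) := fun h => by
    rw [ringKrullDim_eq_zero_of_isField h] at hdim
    exact absurd hdim (by norm_num)
  have key : ∃! P : Ideal (localRing p : Subring K), P ≠ ⊥ ∧ P.IsPrime := by
    refine ⟨IsLocalRing.maximalIdeal _, ⟨fun h => hnf ?_, inferInstance⟩, ?_⟩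
    · exact IsLocalRing.isField_iff_maximalIdeal_eq.2 h
    · rintro P ⟨h0, hP⟩
      exact IsLocalRing.eq_maximalIdeal (Ring.krullDimLE_one_iff_of_noZeroDivisors.1 hle P h0 hP)
  have htfae := (IsDiscreteValuationRing.TFAE (localRing p : Subring K) hnf).out 0 3
  exact htfae.2 ⟨hic, key⟩

end LocalRing

/-! ### Orders along a discrete valuation ring. -/

section Order

variable {K : Type*} [Field K] {R : Subring K}

lemma coe_units_zpow (v : Rˣ) (n : ℤ) : (((v ^ n : Rˣ) : R) : K) = ((v : R) : K) ^ n :=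
  calc (((v ^ n : Rˣ) : R) : K) = ((Units.map (R.subtype : R →* K) (v ^ n) : Kˣ) : K) := rfl
    _ = (((Units.map (R.subtype : R →* K) v) ^ n : Kˣ) : K) := by rw [map_zpow]
    _ = _ := Units.val_zpow_eq_zpow_val _ _

lemma coe_units_inv (v : Rˣ) : (((v⁻¹ : Rˣ) : R) : K) = ((v : R) : K)⁻¹ := by
  simpa using coe_units_zpow v (-1)

lemma HasOrder.ne_zero {g : K} {n : ℤ} (h : HasOrder R g n) : g ≠ 0 := by
  obtain ⟨s, u, hs, hu, rfl⟩ := h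
  refine mul_ne_zero ?_ (zpow_ne_zero _ ?_)
  · simpa using hu.ne_zero
  · simpa using hs.ne_zero

lemma HasOrder.mem_iff {g : K} {n : ℤ} (h : HasOrder R g n) : g ∈ R ↔ 0 ≤ n := by
  obtain ⟨t, u, ht, ⟨u, rfl⟩, rfl⟩ := h
  constructor
  · intro hm
    by_contra! hn
    obtain ⟨k, rfl⟩ : ∃ k : ℕ, n = -(k + 1 : ℕ) := ⟨(-n - 1).toNat, by omega⟩
    apply ht.not_isUnit
    refine IsUnit.of_mul_eq_one (⟨_, hm⟩ * ((u⁻¹ : Rˣ) : R) * t ^ k) (Subtype.ext ?_)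
    have h1 : ((u : R) : K) * (((u⁻¹ : Rˣ) : R) : K) = 1 := congrArg Subtype.val u.mul_inv
    have ht0 : (t : K) ≠ 0 := by simpa using ht.ne_zero
    simp only [zpow_neg, zpow_natCast, Subring.coe_mul, Subring.coe_pow, Subring.coe_one]
    field_simp
    linear_combination (t : K) ^ (k + 1) * h1
  · intro hn
    lift n to ℕ using hn
    rw [zpow_natCast]
    exact R.mul_mem (Subtype.property _) (R.pow_mem t.2 _)

lemma hasOrder_of_irreducible {t : R} (ht : Irreducible t) : HasOrder R (t : K) 1 :=
  ⟨t, 1, ht, isUnit_one, by simp⟩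

lemma HasOrder.zpow {g : K} {m : ℤ} (hg : HasOrder R g m) (k : ℤ) :
    HasOrder R (g ^ k) (k * m) := by
  obtain ⟨t, u, ht, hu, rfl⟩ := hg
  refine ⟨t, ((hu.unit ^ k : Rˣ) : R), ht, Units.isUnit _, ?_⟩
  rw [coe_units_zpow, mul_zpow, ← zpow_mul, mul_comm m, IsUnit.unit_spec]

lemma HasOrder.pow {g : K} {m : ℤ} (hg : HasOrder R g m) (k : ℕ) :
    HasOrder R (g ^ k) (k * m) := by
  simpa using hg.zpow k

lemma HasOrder.inv {g : K} {m : ℤ} (hg : HasOrder R g m) : HasOrder R g⁻¹ (-m) := by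
  simpa using hg.zpow (-1)

variable [IsDiscreteValuationRing R]

lemma HasOrder.exists_eq {g : K} {n : ℤ} (h : HasOrder R g n) {t : R} (ht : Irreducible t) :
    ∃ u : Rˣ, g = ((u : R) : K) * (t : K) ^ n := by
  obtain ⟨s, u, hs, hu, rfl⟩ := h
  obtain ⟨v, hv⟩ := IsDiscreteValuationRing.associated_of_irreducible R ht hs
  refine ⟨hu.unit * v ^ n, ?_⟩
  rw [← hv]
  simp [mul_zpow, coe_units_zpow]
  ring

lemma exists_hasOrder [IsFractionRing R K] {g : K} (hg : g ≠ 0) : ∃ n : ℤ, HasOrder R g n := by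
  obtain ⟨t, ht⟩ := IsDiscreteValuationRing.exists_irreducible R
  obtain ⟨n, u, h⟩ := IsDiscreteValuationRing.exists_units_eq_smul_zpow_of_irreducible (K := K) ht hg
  exact ⟨n, t, u, ht, u.isUnit, by rw [h]; rfl⟩

lemma HasOrder.mul {g h : K} {m n : ℤ} (hg : HasOrder R g m) (hh : HasOrder R h n) :
    HasOrder R (g * h) (m + n) := by
  obtain ⟨t, ht⟩ := IsDiscreteValuationRing.exists_irreducible R
  obtain ⟨u, rfl⟩ := hg.exists_eq ht
  obtain ⟨v, rfl⟩ := hh.exists_eq ht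
  refine ⟨t, u * v, ht, u.isUnit.mul v.isUnit, ?_⟩
  rw [zpow_add₀ (by simpa using ht.ne_zero)]
  simp; ring

lemma hasOrder_zero_iff {g : K} :
    HasOrder R g 0 ↔ g ≠ 0 ∧ g ∈ R ∧ g⁻¹ ∈ R := by
  constructor
  · intro h
    refine ⟨h.ne_zero, ?_⟩
    obtain ⟨t, u, ht, hu, rfl⟩ := h
    obtain ⟨u, rfl⟩ := hu
    refine ⟨by simp, ?_⟩
    rw [zpow_zero, mul_one, ← coe_units_inv]
    exact Subtype.property _
  · rintro ⟨h0, h1, h2⟩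
    obtain ⟨t, ht⟩ := IsDiscreteValuationRing.exists_irreducible R
    refine ⟨t, ⟨g, h1⟩, ht, ?_, by simp⟩
    rw [isUnit_iff_exists_inv]
    exact ⟨⟨_, h2⟩, Subtype.ext (mul_inv_cancel₀ h0)⟩

lemma HasOrder.unique {g : K} {m n : ℤ} (hm : HasOrder R g m) (hn : HasOrder R g n) : m = n := by
  have h : g * g⁻¹ = 1 := mul_inv_cancel₀ hm.ne_zero
  have h1 := (hm.mul hn.inv).mem_iff
  have h2 := (hn.mul hm.inv).mem_iff
  rw [h] at h1 h2
  have := h1.1 R.one_mem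
  have := h2.1 R.one_mem
  omega

end Order
-- Multilinear algebra: spans and determinants.
section Span

/-- Expands wedge products of differentials over a subring R of K, although the exterior power
itself is formed over K. -/
lemma MultilinearMap.map_mem_span_of_mem_span {R M N ι : Type*} [CommRing R] [AddCommGroup M]
    [Module R M] [AddCommGroup N] [Module R N] [Fintype ι] [DecidableEq ι]
    (f : MultilinearMap R (fun _ : ι => M) N) (s : Set M) (v : ι → M)
    (hv : ∀ i, v i ∈ Submodule.span R s) :
    f v ∈ Submodule.span R (f '' {m | ∀ i, m i ∈ s}) := by
  -- Induct on the set I of arguments not yet known to be generators, and expand one of them at a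
  -- time.
  suffices H : ∀ I : Finset ι, ∀ v : ι → M, (∀ i ∈ I, v i ∈ Submodule.span R s) →
      (∀ i ∉ I, v i ∈ s) → f v ∈ Submodule.span R (f '' {m | ∀ i, m i ∈ s}) from
    H Finset.univ v (fun i _ => hv i) (fun i hi => absurd (Finset.mem_univ i) hi)
  intro I
  induction I using Finset.induction_on with
  | empty => exact fun v _ hv => Submodule.subset_span ⟨v, fun i => hv i (by simp), rfl⟩
  | insert a I ha ih =>
    intro v h1 h2
    have key : ∀ x ∈ Submodule.span R s,
        f (Function.update v a x) ∈ Submodule.span R (f '' {m | ∀ i, m i ∈ s}) := by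
      intro x hx
      induction hx using Submodule.span_induction with
      | mem x hx =>
        refine ih _ (fun i hi => ?_) (fun i hi => ?_)
        · rw [Function.update_of_ne (by rintro rfl; exact ha hi)]
          exact h1 i (Finset.mem_insert_of_mem hi)
        · by_cases hia : i = a
          · subst hia; simpa using hx
          · rw [Function.update_of_ne hia]
            exact h2 i (by simp [hia, hi])
      | zero => rw [f.map_update_zero]; exact Submodule.zero_mem _
      | add x y _ _ hx hy => rw [f.map_update_add]; exact Submodule.add_mem _ hx hy
      | smul c x _ hx => rw [f.map_update_smul]; exact Submodule.smul_mem _ _ hx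
    simpa using key (v a) (h1 a (Finset.mem_insert_self _ _))

/-- Used over K to compare rational top forms, and over ℤ to compare two bases of the lattice of
exponents. -/
lemma AlternatingMap.map_eq_det_smul {R M N ι : Type*} [CommRing R] [AddCommGroup M] [Module R M]
    [AddCommGroup N] [Module R N] [Fintype ι] [DecidableEq ι] (e : Module.Basis ι R M)
    (f : M [⋀^ι]→ₗ[R] N) (v : ι → M) : f v = e.det v • f e := by
  have h : f = (LinearMap.toSpanSingleton R N (f e)).compAlternatingMap e.det := by
    refine Module.Basis.ext_alternating e fun i h => ?_
    have hi : (fun j => e (i j)) = e ∘ Equiv.ofBijective i (Finite.injective_iff_bijective.1 h) :=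
      rfl
    rw [hi, AlternatingMap.map_perm, AlternatingMap.map_perm]
    simp [Module.Basis.det_self]
  conv_lhs => rw [h]
  simp

end Span

/-! ### Regular top forms in coordinates. -/

section Forms

variable {K : Type*} [Field K] [Algebra ℂ K] {d : ℕ}

/-- The wedge product of `d` differentials, as a multilinear map over a subring of `K`. -/
noncomputable def wedge (R : Subring K) (d : ℕ) :
    MultilinearMap R (fun _ : Fin d => Ω[K⁄ℂ]) (RationalForm K d) :=
  (exteriorPower.ιMulti K d (M := Ω[K⁄ℂ])).toMultilinearMap.restrictScalars R

lemma ιMulti_mem_regularForms {R : Subring K} {v : Fin d → Ω[K⁄ℂ]}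
    (hv : ∀ i, v i ∈ Submodule.span R (Set.range fun f : R => KaehlerDifferential.D ℂ K (f : K))) :
    exteriorPower.ιMulti K d v ∈ regularForms R d := by
  have h := MultilinearMap.map_mem_span_of_mem_span (wedge R d) _ v hv
  refine Submodule.span_mono ?_ h
  rintro _ ⟨m, hm, rfl⟩
  choose f hf using hm
  exact ⟨f, congrArg (exteriorPower.ιMulti K d) (funext hf)⟩

/-- `R` is the local ring of the affine space with coordinates `y` at some point. -/
structure HasCoordinates (R : Subring K) (y : Fin d → K) : Prop where
  algebraMap_mem : ∀ c : ℂ, algebraMap ℂ K c ∈ R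
  mem : ∀ j, y j ∈ R
  exists_eq : ∀ x ∈ R, ∃ p q : MvPolynomial (Fin d) ℂ, (MvPolynomial.aeval y q)⁻¹ ∈ R ∧
    x = MvPolynomial.aeval y p * (MvPolynomial.aeval y q)⁻¹

variable {R : Subring K} {y : Fin d → K}

lemma HasCoordinates.aeval_mem (h : HasCoordinates R y) (p : MvPolynomial (Fin d) ℂ) :
    MvPolynomial.aeval y p ∈ R := by
  induction p using MvPolynomial.induction_on with
  | C c => simpa using h.algebraMap_mem c
  | add p q hp hq => rw [map_add]; exact R.add_mem hp hq
  | mul_X p j hp => rw [map_mul, MvPolynomial.aeval_X]; exact R.mul_mem hp (h.mem j)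

/-- The Leibniz rule handles polynomials in y. The quotient rule needs only the inverse of the
denominator, which lies in R. -/
lemma HasCoordinates.D_mem (h : HasCoordinates R y) {x : K} (hx : x ∈ R) :
    KaehlerDifferential.D ℂ K x ∈
      Submodule.span R (Set.range fun j => KaehlerDifferential.D ℂ K (y j)) := by
  have hp : ∀ p : MvPolynomial (Fin d) ℂ, KaehlerDifferential.D ℂ K (MvPolynomial.aeval y p) ∈
      Submodule.span R (Set.range fun j => KaehlerDifferential.D ℂ K (y j)) := by
    intro p
    induction p using MvPolynomial.induction_on with
    | C c => simp
    | add p q hp hq => rw [map_add, map_add]; exact Submodule.add_mem _ hp hq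
    | mul_X p j hp =>
      rw [map_mul, MvPolynomial.aeval_X, Derivation.leibniz]
      exact Submodule.add_mem _
        (Submodule.smul_mem _ (⟨_, h.aeval_mem p⟩ : R) (Submodule.subset_span ⟨j, rfl⟩))
        (Submodule.smul_mem _ (⟨_, h.mem j⟩ : R) hp)
  obtain ⟨p, q, hq, rfl⟩ := h.exists_eq x hx
  rw [Derivation.leibniz, Derivation.leibniz_inv]
  refine Submodule.add_mem _ (Submodule.smul_mem _ (⟨_, h.aeval_mem p⟩ : R) ?_)
    (Submodule.smul_mem _ (⟨_, hq⟩ : R) (hp p))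
  exact Submodule.smul_mem _ (⟨_, R.neg_mem (R.pow_mem hq 2)⟩ : R) (hp q)

/-- Expanding in the dyⱼ, a term with a repeated index vanishes and any other is ± dy₁ ∧ ⋯ ∧ dy_d.
Orders of forms can then be read off from a single coefficient. -/
lemma HasCoordinates.regularForms_eq (h : HasCoordinates R y) :
    regularForms R d =
      Submodule.span R {exteriorPower.ιMulti K d fun j => KaehlerDifferential.D ℂ K (y j)} := by
  apply le_antisymm
  · rw [regularForms, Submodule.span_le]
    rintro _ ⟨f, rfl⟩
    have := MultilinearMap.map_mem_span_of_mem_span (wedge R d) _ _ fun i => h.D_mem (f i).2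
    refine Submodule.span_le.2 ?_ this
    rintro _ ⟨m, hm, rfl⟩
    choose σ hσ using hm
    obtain rfl : (fun i => KaehlerDifferential.D ℂ K (y (σ i))) = m := funext hσ
    by_cases hinj : Function.Injective σ
    · have hperm := (exteriorPower.ιMulti K d).map_perm
        (fun j => KaehlerDifferential.D ℂ K (y j))
        (Equiv.ofBijective σ (Finite.injective_iff_bijective.1 hinj))
      change exteriorPower.ιMulti K d (fun i => KaehlerDifferential.D ℂ K (y (σ i))) ∈ _
      have hcomp : (fun i => KaehlerDifferential.D ℂ K (y (σ i))) =
        (fun j => KaehlerDifferential.D ℂ K (y j)) ∘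
          (Equiv.ofBijective σ (Finite.injective_iff_bijective.1 hinj)) := rfl
      rw [hcomp, hperm]
      rcases Int.units_eq_one_or (Equiv.Perm.sign
        (Equiv.ofBijective σ (Finite.injective_iff_bijective.1 hinj))) with h1 | h1 <;> rw [h1]
      · rw [one_smul]; exact Submodule.subset_span rfl
      · rw [Units.neg_smul, one_smul]; exact Submodule.neg_mem _ (Submodule.subset_span rfl)
    · have : wedge R d (fun i => KaehlerDifferential.D ℂ K (y (σ i))) = 0 := by
        refine (exteriorPower.ιMulti K d).map_eq_zero_of_not_injective _ fun hi => hinj ?_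
        exact Function.Injective.of_comp (f := fun j => KaehlerDifferential.D ℂ K (y j)) hi
      rw [this]; exact Submodule.zero_mem _
  · rw [Submodule.span_le, Set.singleton_subset_iff]
    exact Submodule.subset_span ⟨fun j => ⟨y j, h.mem j⟩, rfl⟩

variable (y) in
/-- `y` is a system of coordinates of the function field `K` of an affine space. -/
structure IsCoordinateSystem : Prop where
  injective : Function.Injective (MvPolynomial.aeval (R := ℂ) y)
  exists_eq : ∀ x : K, ∃ p q : MvPolynomial (Fin d) ℂ,
    x = MvPolynomial.aeval y p * (MvPolynomial.aeval y q)⁻¹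

/-- K is the fraction field of the polynomial ring in y, and Kähler differentials commute with
localization. -/
lemma IsCoordinateSystem.exists_basis (h : IsCoordinateSystem y) :
    ∃ β : Module.Basis (Fin d) K Ω[K⁄ℂ], ∀ j, β j = KaehlerDifferential.D ℂ K (y j) := by
  let alg : Algebra (MvPolynomial (Fin d) ℂ) K := (MvPolynomial.aeval y).toAlgebra
  have hmap : ∀ p, algebraMap (MvPolynomial (Fin d) ℂ) K p = MvPolynomial.aeval y p := fun _ => rfl
  have : IsScalarTower ℂ (MvPolynomial (Fin d) ℂ) K :=
    IsScalarTower.of_algebraMap_eq fun c => by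
      rw [hmap, MvPolynomial.algebraMap_eq, MvPolynomial.aeval_C]
  have : FaithfulSMul (MvPolynomial (Fin d) ℂ) K :=
    (faithfulSMul_iff_algebraMap_injective _ _).2 h.injective
  have : IsFractionRing (MvPolynomial (Fin d) ℂ) K := by
    refine IsFractionRing.of_field _ _ fun x => ?_
    obtain ⟨p, q, hx⟩ := h.exists_eq x
    exact ⟨p, q, by rw [hx, hmap, hmap, div_eq_mul_inv]⟩
  let f := KaehlerDifferential.map ℂ ℂ (MvPolynomial (Fin d) ℂ) K
  have : IsLocalizedModule (nonZeroDivisors (MvPolynomial (Fin d) ℂ)) f :=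
    KaehlerDifferential.isLocalizedModule_map _ _ _ _
  refine ⟨(KaehlerDifferential.mvPolynomialBasis ℂ (Fin d)).ofIsLocalizedModule K
    (nonZeroDivisors (MvPolynomial (Fin d) ℂ)) f, fun j => ?_⟩
  rw [Module.Basis.ofIsLocalizedModule_apply, KaehlerDifferential.mvPolynomialBasis_apply,
    KaehlerDifferential.map_D, hmap, MvPolynomial.aeval_X]

lemma IsCoordinateSystem.ιMulti_ne_zero (h : IsCoordinateSystem y) :
    exteriorPower.ιMulti K d (fun j => KaehlerDifferential.D ℂ K (y j)) ≠ 0 := by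
  obtain ⟨β, hβ⟩ := h.exists_basis
  intro h0
  have := exteriorPower.alternatingMapLinearEquiv_apply_ιMulti β.det
    (fun j => KaehlerDifferential.D ℂ K (y j))
  rw [h0, map_zero, ← funext hβ] at this
  have h1 : β.det β = 1 := β.det_self
  exact zero_ne_one (this.trans h1)

lemma IsCoordinateSystem.exists_smul_eq (h : IsCoordinateSystem y) (ω : RationalForm K d) :
    ∃ f : K, ω = f • exteriorPower.ιMulti K d (fun j => KaehlerDifferential.D ℂ K (y j)) := by
  obtain ⟨β, hβ⟩ := h.exists_basis
  have hω : ω ∈ Submodule.span K (Set.range (exteriorPower.ιMulti K d (M := Ω[K⁄ℂ]))) := by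
    rw [exteriorPower.ιMulti_span]; trivial
  rw [← funext hβ]
  induction hω using Submodule.span_induction with
  | mem x hx =>
    obtain ⟨v, rfl⟩ := hx
    refine ⟨β.det v, ?_⟩
    exact AlternatingMap.map_eq_det_smul β _ v
  | zero => exact ⟨0, by simp⟩
  | add x y _ _ hx hy =>
    obtain ⟨a, ha⟩ := hx
    obtain ⟨b, hb⟩ := hy
    exact ⟨a + b, by rw [add_smul, ← ha, ← hb]⟩
  | smul c x _ hx =>
    obtain ⟨a, ha⟩ := hx
    exact ⟨c * a, by rw [mul_smul, ← ha]⟩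

end Forms
-- Invariant monomials and the lattice of exponents.
section Ring

variable {d : ℕ} {r : ℕ} {a : Fin d → ℤ}

variable (r a) in
/-- The lattice of the exponents of the invariant Laurent monomials. -/
def weightLattice : Submodule ℤ (Fin d → ℤ) where
  carrier := {m | (r : ℤ) ∣ ∑ i, a i * m i}
  add_mem' {m n} hm hn := by
    have : ∑ i, a i * (m + n) i = ∑ i, a i * m i + ∑ i, a i * n i := by
      simp [mul_add, Finset.sum_add_distrib]
    rw [Set.mem_ofPred_eq, this]; exact dvd_add hm hn
  zero_mem' := by simp
  smul_mem' c m hm := by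
    have : ∑ i, a i * (c • m) i = c * ∑ i, a i * m i := by
      rw [Finset.mul_sum]; exact Finset.sum_congr rfl fun i _ => by simp; ring
    rw [Set.mem_ofPred_eq, this]; exact hm.mul_left c

lemma mem_weightLattice {m : Fin d → ℤ} :
    m ∈ weightLattice r a ↔ (r : ℤ) ∣ ∑ i, a i * m i := Iff.rfl

/-- An exponent of a monomial as an integer vector. -/
def toInt (u : Fin d →₀ ℕ) : Fin d → ℤ := fun i => (u i : ℤ)

@[simp] lemma toInt_apply (u : Fin d →₀ ℕ) (i : Fin d) : toInt u i = u i := rfl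

@[simp] lemma toInt_add (u v : Fin d →₀ ℕ) : toInt (u + v) = toInt u + toInt v := by
  ext i; simp

@[simp] lemma toInt_zero : toInt (0 : Fin d →₀ ℕ) = 0 := by
  ext i; simp

lemma toInt_injective : Function.Injective (toInt (d := d)) := fun u v h => by
  ext i; simpa using congrFun h i

lemma diagonalAction_monomial {ζ : ℂ} (hζ : ζ ≠ 0) (u : Fin d →₀ ℕ) (c : ℂ) :
    diagonalAction a ζ (MvPolynomial.monomial u c) =
      MvPolynomial.monomial u (ζ ^ (∑ i, a i * toInt u i) * c) := by
  rw [diagonalAction, MvPolynomial.aeval_monomial, Finsupp.prod_fintype _ _ (by simp)]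
  simp only [mul_pow, Finset.prod_mul_distrib]
  rw [MvPolynomial.monomial_eq (s := u), Finsupp.prod_fintype _ _ (by simp)]
  simp only [← map_pow, ← map_prod, MvPolynomial.algebraMap_eq]
  rw [← mul_assoc, ← map_mul]
  congr 2
  rw [mul_comm]
  congr 1
  have : ∀ s : Finset (Fin d), ∏ i ∈ s, (ζ ^ a i) ^ u i = ζ ^ ∑ i ∈ s, a i * toInt u i := by
    intro s
    induction s using Finset.induction_on with
    | empty => simp
    | insert j s hj ih =>
      rw [Finset.prod_insert hj, Finset.sum_insert hj, zpow_add₀ hζ, ih, toInt_apply, zpow_mul,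
        zpow_natCast]
  exact this _

lemma coeff_diagonalAction {ζ : ℂ} (hζ : ζ ≠ 0) (f : MvPolynomial (Fin d) ℂ) (u : Fin d →₀ ℕ) :
    (diagonalAction a ζ f).coeff u = ζ ^ (∑ i, a i * toInt u i) * f.coeff u := by
  induction f using MvPolynomial.induction_on' with
  | monomial v c =>
    rw [diagonalAction_monomial hζ, MvPolynomial.coeff_monomial, MvPolynomial.coeff_monomial]
    split_ifs with h
    · rw [h]
    · simp
  | add p q hp hq => rw [map_add, MvPolynomial.coeff_add, hp, hq, MvPolynomial.coeff_add, mul_add]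

/-- The action is diagonal on monomials, and a primitive r-th root of unity detects divisibility of
the weight by r. -/
lemma mem_cyclicQuotient_iff [NeZero r] {f : MvPolynomial (Fin d) ℂ} :
    f ∈ cyclicQuotient r a ↔ ∀ u, f.coeff u ≠ 0 → toInt u ∈ weightLattice r a := by
  constructor
  · intro hf u hu
    have hprim := Complex.isPrimitiveRoot_exp r (NeZero.ne r)
    have h := congrArg (MvPolynomial.coeff u) (hf _ hprim.pow_eq_one)
    rw [coeff_diagonalAction (hprim.ne_zero (NeZero.ne r))] at h
    rw [mem_weightLattice, ← hprim.zpow_eq_one_iff_dvd]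
    exact mul_right_cancel₀ hu (by rw [h, one_mul])
  · intro h ζ hζ
    have h0 : ζ ≠ 0 := by rintro rfl; rw [zero_pow (NeZero.ne r)] at hζ; exact zero_ne_one hζ
    ext u
    rw [coeff_diagonalAction h0]
    by_cases hu : f.coeff u = 0
    · rw [hu, mul_zero]
    · obtain ⟨k, hk⟩ := h u hu
      rw [hk, zpow_mul, zpow_natCast, hζ, one_zpow, one_mul]

lemma mul_mem_weightLattice (m : Fin d → ℤ) : (fun i => r * m i) ∈ weightLattice r a := by
  rw [mem_weightLattice]
  exact Finset.dvd_sum fun i _ => ⟨a i * m i, by ring⟩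

lemma single_mem_weightLattice (i : Fin d) : toInt (Finsupp.single i r) ∈ weightLattice r a := by
  convert! mul_mem_weightLattice (r := r) (a := a) (toInt (Finsupp.single i 1)) using 1
  ext j
  by_cases h : j = i
  · subst h; simp
  · simp [Finsupp.single_eq_of_ne h]

variable [NeZero r]

lemma monomial_mem_cyclicQuotient {u : Fin d →₀ ℕ} (hu : toInt u ∈ weightLattice r a) (c : ℂ) :
    MvPolynomial.monomial u c ∈ cyclicQuotient r a := by
  rw [mem_cyclicQuotient_iff]
  intro v hv
  rw [MvPolynomial.coeff_monomial] at hv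
  split_ifs at hv with h
  · rwa [← h]
  · exact absurd rfl hv

/-- An invariant monomial. -/
noncomputable def invMonomial (u : Fin d →₀ ℕ) (hu : toInt u ∈ weightLattice r a) :
    cyclicQuotient r a := ⟨MvPolynomial.monomial u 1, monomial_mem_cyclicQuotient hu 1⟩

@[simp] lemma coe_invMonomial (u : Fin d →₀ ℕ) (hu : toInt u ∈ weightLattice r a) :
    (invMonomial u hu : MvPolynomial (Fin d) ℂ) = MvPolynomial.monomial u 1 := rfl

lemma invMonomial_ne_zero (u : Fin d →₀ ℕ) (hu : toInt u ∈ weightLattice r a) :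
    invMonomial u hu ≠ 0 := fun h => by
  simpa [coe_invMonomial] using congrArg Subtype.val h

lemma invMonomial_mul {u v : Fin d →₀ ℕ} (hu : toInt u ∈ weightLattice r a)
    (hv : toInt v ∈ weightLattice r a) (huv : toInt (u + v) ∈ weightLattice r a) :
    invMonomial u hu * invMonomial v hv = invMonomial (u + v) huv :=
  Subtype.ext (by simp [coe_invMonomial, MvPolynomial.monomial_mul])

lemma invMonomial_congr {u v : Fin d →₀ ℕ} (h : u = v) (hu : toInt u ∈ weightLattice r a) :
    invMonomial u hu = invMonomial v (h ▸ hu) := by subst h; rfl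

lemma eq_sum_invMonomial (f : cyclicQuotient r a) :
    f = ∑ u ∈ f.1.support.attach, f.1.coeff u.1 • invMonomial u.1
      (mem_cyclicQuotient_iff.1 f.2 u.1 (MvPolynomial.mem_support_iff.1 u.2)) := by
  apply Subtype.ext
  rw [AddSubmonoidClass.coe_finsetSum]
  simp only [SetLike.val_smul, coe_invMonomial, MvPolynomial.smul_monomial, smul_eq_mul, mul_one]
  rw [Finset.sum_attach f.1.support (fun u => MvPolynomial.monomial u (f.1.coeff u))]
  exact (MvPolynomial.support_sum_monomial_coeff f.1).symm

lemma cyclicQuotient_induction {P : cyclicQuotient r a → Prop} (f : cyclicQuotient r a)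
    (hmon : ∀ u hu (c : ℂ), P (c • invMonomial u hu)) (hadd : ∀ f g, P f → P g → P (f + g)) :
    P f := by
  rw [eq_sum_invMonomial f]
  refine Finset.sum_induction _ P hadd ?_ fun u _ => hmon _ _ _
  simpa using hmon 0 (by rw [toInt_zero]; exact Submodule.zero_mem _) 0

lemma mem_of_forall_invMonomial_mem (I : Ideal (cyclicQuotient r a)) (f : cyclicQuotient r a)
    (h : ∀ u hu, f.1.coeff u ≠ 0 → invMonomial u hu ∈ I) : f ∈ I := by
  rw [eq_sum_invMonomial f]
  refine Ideal.sum_mem _ fun u _ => ?_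
  rw [Algebra.smul_def]
  exact I.mul_mem_left _ (h _ _ (MvPolynomial.mem_support_iff.1 u.2))

variable (r a) in
/-- The invariant `xᵢ ^ r`. -/
noncomputable def powVar (i : Fin d) : cyclicQuotient r a :=
  invMonomial (Finsupp.single i r) (single_mem_weightLattice i)

lemma coe_powVar (i : Fin d) :
    (powVar r a i : MvPolynomial (Fin d) ℂ) = MvPolynomial.X i ^ r := by
  rw [powVar, coe_invMonomial, MvPolynomial.X_pow_eq_monomial]

/-- The denominator is the product of the powers xᵢ ^ (r · (-mᵢ)) over the negative mᵢ. The last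
clause records that it avoids all other variables, which decides in which local rings the fraction
lies. -/
lemma exists_decomposition (m : weightLattice r a) :
    ∃ u v : Fin d →₀ ℕ, toInt u ∈ weightLattice r a ∧ toInt v ∈ weightLattice r a ∧
      (m : Fin d → ℤ) + toInt v = toInt u ∧ ∀ i, 0 ≤ m.1 i → v i = 0 := by
  have hr : (1 : ℤ) ≤ r := by have := NeZero.pos r; omega
  let v : Fin d →₀ ℕ := Finsupp.equivFunOnFinite.symm fun i => r * (-(m.1 i)).toNat
  have hv : toInt v = fun i => (r : ℤ) * ((-(m.1 i)).toNat : ℤ) := by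
    ext i; simp [v]
  let u : Fin d →₀ ℕ := Finsupp.equivFunOnFinite.symm fun i => (m.1 i + v i).toNat
  have huv : (m : Fin d → ℤ) + toInt v = toInt u := by
    ext i
    have h1 : (0 : ℤ) ≤ m.1 i + v i := by
      have h2 := congrFun hv i
      rw [toInt_apply] at h2
      rw [h2]
      have h3 : -(m.1 i) ≤ ((-(m.1 i)).toNat : ℤ) := Int.self_le_toNat _
      nlinarith [Int.natCast_nonneg (-(m.1 i)).toNat]
    simp only [Pi.add_apply, toInt_apply, u, Finsupp.equivFunOnFinite_symm_apply_apply,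
      Int.toNat_of_nonneg h1]
  have hvm : toInt v ∈ weightLattice r a := hv ▸ mul_mem_weightLattice _
  refine ⟨u, v, huv ▸ Submodule.add_mem _ m.2 hvm, hvm, huv, fun i hi => ?_⟩
  simp [v, hi]

end Ring

/-! ### Laurent monomials as rational functions and as coordinates. -/

section Laurent

variable {d : ℕ} {r : ℕ} {a : Fin d → ℤ} [NeZero r]

variable {K : Type*} [Field K] [Algebra (cyclicQuotient r a) K]
  [IsFractionRing (cyclicQuotient r a) K]

variable (K) in
/-- The Laurent monomial with exponent `m`, as a rational function. -/
noncomputable def laurent (m : weightLattice r a) : K :=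
  algebraMap _ K (invMonomial _ (exists_decomposition m).choose_spec.choose_spec.1) /
    algebraMap _ K (invMonomial _ (exists_decomposition m).choose_spec.choose_spec.2.1)

omit [NeZero r] in
lemma algebraMap_ne_zero {f : cyclicQuotient r a} (hf : f ≠ 0) : algebraMap _ K f ≠ 0 :=
  (map_ne_zero_iff _ (IsFractionRing.injective (cyclicQuotient r a) K)).2 hf

lemma algebraMap_invMonomial_ne_zero (u : Fin d →₀ ℕ) (hu : toInt u ∈ weightLattice r a) :
    algebraMap _ K (invMonomial u hu) ≠ 0 := by
  exact algebraMap_ne_zero (invMonomial_ne_zero u hu)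

lemma laurent_eq {m : weightLattice r a} {u v : Fin d →₀ ℕ} (hu : toInt u ∈ weightLattice r a)
    (hv : toInt v ∈ weightLattice r a) (h : (m : Fin d → ℤ) + toInt v = toInt u) :
    laurent K m = algebraMap _ K (invMonomial u hu) / algebraMap _ K (invMonomial v hv) := by
  obtain ⟨h1, h2, h3, -⟩ := (exists_decomposition m).choose_spec.choose_spec
  rw [laurent, div_eq_div_iff (algebraMap_invMonomial_ne_zero _ _)
    (algebraMap_invMonomial_ne_zero _ _), ← map_mul, ← map_mul]
  congr 1
  have key : (exists_decomposition m).choose + v =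
      u + (exists_decomposition m).choose_spec.choose := by
    apply toInt_injective
    rw [toInt_add, toInt_add]
    linear_combination h - h3
  rw [invMonomial_mul _ _ (by rw [toInt_add]; exact Submodule.add_mem _ h1 hv),
    invMonomial_mul _ _ (by rw [toInt_add]; exact Submodule.add_mem _ hu h2),
    invMonomial_congr key]

lemma laurent_toInt {u : Fin d →₀ ℕ} (hu : toInt u ∈ weightLattice r a) :
    laurent K ⟨toInt u, hu⟩ = algebraMap _ K (invMonomial u hu) := by
  have h0 : toInt (0 : Fin d →₀ ℕ) ∈ weightLattice r a := by
    rw [toInt_zero]; exact Submodule.zero_mem _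
  rw [laurent_eq (u := u) (v := 0) hu h0 (by simp)]
  have : invMonomial 0 h0 = 1 := Subtype.ext (by simp [coe_invMonomial])
  rw [this, map_one, div_one]

lemma laurent_ne_zero (m : weightLattice r a) : laurent K m ≠ 0 :=
  div_ne_zero (algebraMap_invMonomial_ne_zero _ _) (algebraMap_invMonomial_ne_zero _ _)

lemma laurent_zero : laurent K (0 : weightLattice r a) = 1 := by
  have h0 : toInt (0 : Fin d →₀ ℕ) ∈ weightLattice r a := by
    rw [toInt_zero]; exact Submodule.zero_mem _
  rw [laurent_eq (u := 0) (v := 0) h0 h0 (by simp)]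
  exact div_self (algebraMap_invMonomial_ne_zero _ _)

lemma laurent_add (m n : weightLattice r a) : laurent K (m + n) = laurent K m * laurent K n := by
  obtain ⟨u, v, hu, hv, h, -⟩ := exists_decomposition m
  obtain ⟨u', v', hu', hv', h', -⟩ := exists_decomposition n
  have h1 : toInt (u + u') ∈ weightLattice r a := by
    rw [toInt_add]; exact Submodule.add_mem _ hu hu'
  have h2 : toInt (v + v') ∈ weightLattice r a := by
    rw [toInt_add]; exact Submodule.add_mem _ hv hv'
  rw [laurent_eq hu hv h, laurent_eq hu' hv' h', laurent_eq h1 h2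
    (by rw [toInt_add, toInt_add, ← h, ← h', Submodule.coe_add]; abel),
    ← invMonomial_mul hu hu', ← invMonomial_mul hv hv', map_mul, map_mul, div_mul_div_comm]

lemma laurent_neg (m : weightLattice r a) : laurent K (-m) = (laurent K m)⁻¹ := by
  apply eq_inv_of_mul_eq_one_left
  rw [← laurent_add, neg_add_cancel, laurent_zero]

lemma laurent_nsmul (n : ℕ) (m : weightLattice r a) : laurent K (n • m) = laurent K m ^ n := by
  induction n with
  | zero => simp [laurent_zero]
  | succ n ih => rw [succ_nsmul, laurent_add, ih, pow_succ]

lemma laurent_sum {ι : Type*} (s : Finset ι) (m : ι → weightLattice r a) :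
    laurent K (∑ i ∈ s, m i) = ∏ i ∈ s, laurent K (m i) := by
  classical
  induction s using Finset.induction_on with
  | empty => simp [laurent_zero]
  | insert j s hj ih => rw [Finset.sum_insert hj, Finset.prod_insert hj, laurent_add, ih]

variable [Algebra ℂ K]

lemma aeval_laurent_monomial (b : Fin d → weightLattice r a) (α : Fin d →₀ ℕ) (c : ℂ) :
    MvPolynomial.aeval (fun j => laurent K (b j)) (MvPolynomial.monomial α c) =
      algebraMap ℂ K c * laurent K (∑ j, α j • b j) := by
  rw [MvPolynomial.aeval_monomial, Finsupp.prod_fintype _ _ (by simp), laurent_sum]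
  simp only [laurent_nsmul]

variable [IsScalarTower ℂ (cyclicQuotient r a) K]

lemma algebraMap_smul_invMonomial (c : ℂ) {u : Fin d →₀ ℕ} (hu : toInt u ∈ weightLattice r a) :
    algebraMap (cyclicQuotient r a) K (c • invMonomial u hu) =
      algebraMap ℂ K c * laurent K ⟨toInt u, hu⟩ := by
  rw [laurent_toInt, Algebra.smul_def, map_mul, ← IsScalarTower.algebraMap_apply]

/-- J is the set of coordinates that may occur in denominators. J = ∅ describes an affine space over
X, J = univ the torus, and the complement of one index a neighbourhood of the generic point of a
divisor. -/
lemma exists_aeval_laurent_eq (b : Module.Basis (Fin d) ℤ (weightLattice r a)) (J : Set (Fin d))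
    (hJ : ∀ u (hu : toInt u ∈ weightLattice r a), ∀ j ∉ J, 0 ≤ b.repr ⟨toInt u, hu⟩ j)
    (f : cyclicQuotient r a) :
    ∃ (p : MvPolynomial (Fin d) ℂ) (α : Fin d →₀ ℕ), (∀ j ∉ J, α j = 0) ∧
      algebraMap _ K f * laurent K (∑ j, α j • b j) =
        MvPolynomial.aeval (fun j => laurent K (b j)) p := by
  induction f using cyclicQuotient_induction with
  | hmon u hu c =>
    let α : Fin d →₀ ℕ :=
      Finsupp.equivFunOnFinite.symm fun j => (-(b.repr ⟨toInt u, hu⟩ j)).toNat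
    let β : Fin d →₀ ℕ := Finsupp.equivFunOnFinite.symm fun j => (b.repr ⟨toInt u, hu⟩ j).toNat
    refine ⟨MvPolynomial.monomial β c, α, fun j hj => by simp [α, hJ u hu j hj], ?_⟩
    rw [aeval_laurent_monomial, algebraMap_smul_invMonomial, mul_assoc, ← laurent_add]
    congr 2
    conv_lhs => rw [← b.sum_repr ⟨toInt u, hu⟩]
    rw [← Finset.sum_add_distrib]
    refine Finset.sum_congr rfl fun j _ => ?_
    rw [← natCast_zsmul, ← natCast_zsmul, ← add_smul]
    congr 1
    simp only [α, β, Finsupp.equivFunOnFinite_symm_apply_apply]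
    omega
  | hadd f g hf hg =>
    obtain ⟨p, α, hα, hp⟩ := hf
    obtain ⟨q, β, hβ, hq⟩ := hg
    refine ⟨p * MvPolynomial.monomial β 1 + q * MvPolynomial.monomial α 1, α + β,
      fun j hj => by simp [hα j hj, hβ j hj], ?_⟩
    simp only [map_add, map_mul]
    rw [aeval_laurent_monomial, aeval_laurent_monomial, ← hp,
      ← hq]
    simp only [Finsupp.add_apply, add_smul, Finset.sum_add_distrib, laurent_add, map_one]
    ring

lemma laurent_isCoordinateSystem (b : Module.Basis (Fin d) ℤ (weightLattice r a)) :
    IsCoordinateSystem (fun j => laurent K (b j)) where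
  exists_eq x := by
    obtain ⟨f, g, hg, rfl⟩ := IsFractionRing.div_surjective (A := cyclicQuotient r a) x
    obtain ⟨p, α, -, hp⟩ := exists_aeval_laurent_eq (K := K) b Set.univ (by simp) f
    obtain ⟨q, β, -, hq⟩ := exists_aeval_laurent_eq (K := K) b Set.univ (by simp) g
    refine ⟨p * MvPolynomial.monomial β 1, q * MvPolynomial.monomial α 1, ?_⟩
    rw [map_mul, map_mul, aeval_laurent_monomial, aeval_laurent_monomial, ← hp, ← hq, map_one,
      one_mul, one_mul]
    have h1 := laurent_ne_zero (K := K) (∑ j, α j • b j)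
    have h2 := laurent_ne_zero (K := K) (∑ j, β j • b j)
    have h3 : algebraMap _ K g ≠ 0 := algebraMap_ne_zero (nonZeroDivisors.ne_zero hg)
    field_simp
  injective := by
    rw [injective_iff_map_eq_zero]
    intro p hp
    let e : (Fin d →₀ ℕ) → weightLattice r a := fun α => ∑ j, α j • b j
    have he : Function.Injective e := fun α β h => by
      ext j
      have := congrArg (fun m => b.repr m j) h
      simpa [e, ← natCast_zsmul, Finsupp.single_apply] using this
    -- Multiplying by the monomial s with all exponents r * n makes every term an honest invariant
    -- monomial. These are distinct, so each coefficient of p can be read off from g.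
    let n : ℕ := ∑ α ∈ p.support, ∑ i, ((e α).1 i).natAbs
    let s : weightLattice r a := ⟨_, mul_mem_weightLattice fun _ => (n : ℤ)⟩
    let u : (Fin d →₀ ℕ) → Fin d →₀ ℕ := fun α =>
      Finsupp.equivFunOnFinite.symm fun i => ((e α).1 i + r * n).toNat
    have hu : ∀ α ∈ p.support, toInt (u α) = (e α + s : weightLattice r a).1 := by
      intro α hα
      ext i
      have h1 : ((e α).1 i).natAbs ≤ n :=
        (Finset.single_le_sum (f := fun i => ((e α).1 i).natAbs) (fun _ _ => Nat.zero_le _)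
          (Finset.mem_univ i)).trans
        (Finset.single_le_sum (f := fun α => ∑ i, ((e α).1 i).natAbs)
          (fun _ _ => Nat.zero_le _) hα)
      have h2 : n ≤ r * n := Nat.le_mul_of_pos_left n (NeZero.pos r)
      have h3 : (0 : ℤ) ≤ (e α).1 i + r * n := by
        have : (n : ℤ) ≤ r * n := by exact_mod_cast h2
        omega
      simp only [u, toInt_apply, Finsupp.equivFunOnFinite_symm_apply_apply, Int.toNat_of_nonneg h3]
      rfl
    have hmem : ∀ α : p.support, toInt (u α) ∈ weightLattice r a := fun α =>
      hu α.1 α.2 ▸ (e α + s).2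
    let g : cyclicQuotient r a := ∑ α : p.support, p.coeff α.1 • invMonomial (u α) (hmem α)
    have hg : algebraMap _ K g = 0 := by
      rw [← zero_mul (laurent K s), ← hp]
      conv_rhs => rw [p.as_sum]
      rw [map_sum, map_sum, Finset.sum_mul, ← Finset.sum_coe_sort p.support]
      refine Finset.sum_congr rfl fun α _ => ?_
      rw [algebraMap_smul_invMonomial, aeval_laurent_monomial, mul_assoc, ← laurent_add]
      congr 2
      exact Subtype.ext (hu α.1 α.2)
    have hg0 : g = 0 := by
      by_contra h
      exact algebraMap_ne_zero h hg
    ext α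
    by_contra hα
    have hα' : α ∈ p.support := MvPolynomial.mem_support_iff.2 hα
    have h0 := congrArg (fun f : cyclicQuotient r a => f.1.coeff (u α)) hg0
    simp only [g, AddSubmonoidClass.coe_finsetSum, MvPolynomial.coeff_sum, SetLike.val_smul,
      coe_invMonomial, MvPolynomial.coeff_smul, MvPolynomial.coeff_monomial] at h0
    rw [Finset.sum_eq_single ⟨α, hα'⟩] at h0
    · exact hα (by simpa using h0)
    · intro β _ hβ
      rw [if_neg, smul_zero]
      intro h
      apply hβ
      apply Subtype.ext
      apply he
      have := congrArg toInt h
      rw [hu _ β.2, hu _ hα'] at this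
      exact add_right_cancel (Subtype.ext this)
    · exact fun h => absurd (Finset.mem_univ _) h

end Laurent
-- The ring of invariants: norms, normality and height-one primes.
section Invariants

variable {d : ℕ} {r : ℕ} {a : Fin d → ℤ}

lemma diagonalAction_one (f : MvPolynomial (Fin d) ℂ) : diagonalAction a 1 f = f := by
  ext u
  rw [coeff_diagonalAction one_ne_zero, one_zpow, one_mul]

lemma diagonalAction_mul {ζ ξ : ℂ} (hζ : ζ ≠ 0) (hξ : ξ ≠ 0) (f : MvPolynomial (Fin d) ℂ) :
    diagonalAction a ζ (diagonalAction a ξ f) = diagonalAction a (ζ * ξ) f := by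
  ext u
  rw [coeff_diagonalAction hζ, coeff_diagonalAction hξ, coeff_diagonalAction (mul_ne_zero hζ hξ),
    mul_zpow, mul_assoc]

/-- The contraction of a prime ideal of the polynomial ring. -/
noncomputable def contract (Q : Ideal (MvPolynomial (Fin d) ℂ)) [hQ : Q.IsPrime] :
    PrimeSpectrum (cyclicQuotient r a) :=
  ⟨Q.comap (cyclicQuotient r a).val.toRingHom, inferInstance⟩

lemma mem_contract {Q : Ideal (MvPolynomial (Fin d) ℂ)} [Q.IsPrime] {f : cyclicQuotient r a} :
    f ∈ (contract Q : PrimeSpectrum (cyclicQuotient r a)).asIdeal ↔ (f : MvPolynomial (Fin d) ℂ) ∈ Q :=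
  Iff.rfl

variable [NeZero r]

lemma mem_nthRootsFinset_ne_zero {ζ : ℂ} (h : ζ ∈ Polynomial.nthRootsFinset r (1 : ℂ)) :
    ζ ^ r = 1 ∧ ζ ≠ 0 := by
  have h1 := (Polynomial.mem_nthRootsFinset (NeZero.pos r) _).1 h
  refine ⟨h1, ?_⟩
  rintro rfl
  rw [zero_pow (NeZero.ne r)] at h1
  exact zero_ne_one h1

variable (r a) in
/-- The product of the conjugates of a polynomial. -/
noncomputable def norm : MvPolynomial (Fin d) ℂ →* cyclicQuotient r a where
  toFun f := ⟨∏ ζ ∈ Polynomial.nthRootsFinset r (1 : ℂ), diagonalAction a ζ f, fun ξ hξ => by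
    have hξ0 : ξ ≠ 0 := by
      rintro rfl
      rw [zero_pow (NeZero.ne r)] at hξ
      exact zero_ne_one hξ
    rw [map_prod]
    refine Finset.prod_bij' (fun ζ _ => ξ * ζ) (fun ζ _ => ξ⁻¹ * ζ) ?_ ?_ ?_ ?_ ?_
    · intro ζ hζ
      rw [Polynomial.mem_nthRootsFinset (NeZero.pos r)] at hζ ⊢
      rw [mul_pow, hξ, hζ, one_mul]
    · intro ζ hζ
      rw [Polynomial.mem_nthRootsFinset (NeZero.pos r)] at hζ ⊢
      rw [mul_pow, inv_pow, hξ, hζ, inv_one, one_mul]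
    · intro ζ _; exact inv_mul_cancel_left₀ hξ0 ζ
    · intro ζ _; exact mul_inv_cancel_left₀ hξ0 ζ
    · intro ζ hζ; exact diagonalAction_mul hξ0 (mem_nthRootsFinset_ne_zero hζ).2 f⟩
  map_one' := Subtype.ext (by simp)
  map_mul' f g := Subtype.ext (by simp [Finset.prod_mul_distrib])

lemma coe_norm (f : MvPolynomial (Fin d) ℂ) : (norm r a f : MvPolynomial (Fin d) ℂ) =
    ∏ ζ ∈ Polynomial.nthRootsFinset r (1 : ℂ), diagonalAction a ζ f := rfl

lemma norm_coe (f : cyclicQuotient r a) : norm r a f = f ^ r := by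
  apply Subtype.ext
  rw [coe_norm, Finset.prod_congr rfl fun ζ hζ => f.2 ζ (mem_nthRootsFinset_ne_zero hζ).1,
    Finset.prod_const, (Complex.isPrimitiveRoot_exp r (NeZero.ne r)).card_nthRootsFinset]
  rfl

lemma exists_coe_norm_eq (f : MvPolynomial (Fin d) ℂ) :
    ∃ g, (norm r a f : MvPolynomial (Fin d) ℂ) = f * g := by
  classical
  refine ⟨∏ ζ ∈ (Polynomial.nthRootsFinset r (1 : ℂ)).erase 1, diagonalAction a ζ f, ?_⟩
  rw [coe_norm, ← Finset.mul_prod_erase _ _ (a := 1), diagonalAction_one]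
  rw [Polynomial.mem_nthRootsFinset (NeZero.pos r), one_pow]

lemma constantCoeff_norm (f : MvPolynomial (Fin d) ℂ) :
    MvPolynomial.constantCoeff (norm r a f : MvPolynomial (Fin d) ℂ) =
      MvPolynomial.constantCoeff f ^ r := by
  rw [coe_norm, map_prod]
  have h : ∀ ζ ∈ Polynomial.nthRootsFinset r (1 : ℂ),
      MvPolynomial.constantCoeff (diagonalAction a ζ f) = MvPolynomial.constantCoeff f := by
    intro ζ hζ
    rw [MvPolynomial.constantCoeff_eq, coeff_diagonalAction (mem_nthRootsFinset_ne_zero hζ).2]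
    simp
  rw [Finset.prod_congr rfl h, Finset.prod_const,
    (Complex.isPrimitiveRoot_exp r (NeZero.ne r)).card_nthRootsFinset]

lemma norm_ne_zero {f : MvPolynomial (Fin d) ℂ} (hf : f ≠ 0) : norm r a f ≠ 0 := by
  intro h
  have h1 := congrArg Subtype.val h
  rw [coe_norm] at h1
  obtain ⟨ζ, hζ, h2⟩ := Finset.prod_eq_zero_iff.1 h1
  apply hf
  ext u
  have h3 := congrArg (MvPolynomial.coeff u) h2
  rw [coeff_diagonalAction (mem_nthRootsFinset_ne_zero hζ).2, MvPolynomial.coeff_zero] at h3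
  exact (mul_eq_zero.1 h3).resolve_left (zpow_ne_zero _ (mem_nthRootsFinset_ne_zero hζ).2)

instance isIntegral_cyclicQuotient :
    Algebra.IsIntegral (cyclicQuotient r a) (MvPolynomial (Fin d) ℂ) where
  isIntegral f := by
    induction f using MvPolynomial.induction_on with
    | C c =>
      exact isIntegral_algebraMap (R := cyclicQuotient r a) (x := algebraMap ℂ _ c)
    | add p q hp hq => exact hp.add hq
    | mul_X p j hp =>
      refine hp.mul (IsIntegral.of_pow (NeZero.pos r) ?_)
      rw [← coe_powVar (a := a)]
      exact isIntegral_algebraMap (R := cyclicQuotient r a) (x := powVar r a j)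

/-- The Artin–Tate lemma: the polynomial ring is finite over the invariants, so these are a finitely
generated algebra. -/
instance isNoetherianRing_cyclicQuotient : IsNoetherianRing (cyclicQuotient r a) := by
  have hft : Algebra.FiniteType (cyclicQuotient r a) (MvPolynomial (Fin d) ℂ) :=
    Algebra.FiniteType.of_restrictScalars_finiteType ℂ _ _
  have hfin : Module.Finite (cyclicQuotient r a) (MvPolynomial (Fin d) ℂ) :=
    Algebra.IsIntegral.finite
  have hfg := fg_of_fg_of_fg ℂ (cyclicQuotient r a) (MvPolynomial (Fin d) ℂ)
    Algebra.FiniteType.out hfin.fg_top Subtype.val_injective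
  have : Algebra.FiniteType ℂ (cyclicQuotient r a) := ⟨hfg⟩
  exact Algebra.FiniteType.isNoetherianRing ℂ _

/-- An integral fraction f / g of invariants is a polynomial because polynomial rings are normal,
and that polynomial is invariant because f and g are. -/
instance isIntegrallyClosed_cyclicQuotient : IsIntegrallyClosed (cyclicQuotient r a) := by
  rw [isIntegrallyClosed_iff (FractionRing (cyclicQuotient r a))]
  intro x hx
  obtain ⟨f, g, hg, rfl⟩ := IsFractionRing.div_surjective (A := cyclicQuotient r a) x
  have hg0 : g ≠ 0 := nonZeroDivisors.ne_zero hg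
  have hinj : Function.Injective (Algebra.ofId (cyclicQuotient r a)
      (FractionRing (MvPolynomial (Fin d) ℂ))) := fun x y h => Subtype.ext
    (IsFractionRing.injective (MvPolynomial (Fin d) ℂ) (FractionRing (MvPolynomial (Fin d) ℂ)) h)
  let ι : FractionRing (cyclicQuotient r a) →ₐ[cyclicQuotient r a]
      FractionRing (MvPolynomial (Fin d) ℂ) :=
    IsFractionRing.liftAlgHom hinj
  have h1 : IsIntegral (MvPolynomial (Fin d) ℂ) (ι (algebraMap _ _ f / algebraMap _ _ g)) :=
    (hx.map ι).tower_top
  obtain ⟨t, ht⟩ := IsIntegrallyClosed.isIntegral_iff.1 h1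
  have h2 : (f : MvPolynomial (Fin d) ℂ) = g * t := by
    apply IsFractionRing.injective (MvPolynomial (Fin d) ℂ) (FractionRing (MvPolynomial (Fin d) ℂ))
    rw [map_mul, ht, map_div₀, AlgHom.commutes, AlgHom.commutes]
    refine (mul_div_cancel₀ _ fun h => hg0 (hinj ?_)).symm
    rw [map_zero]
    exact h
  have ht : t ∈ cyclicQuotient r a := fun ζ hζ => by
    have h3 := congrArg (diagonalAction a ζ) h2
    rw [map_mul, f.2 ζ hζ, g.2 ζ hζ, h2] at h3
    exact (mul_left_cancel₀ (fun h => hg0 (Subtype.ext h)) h3).symm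
  refine ⟨⟨t, ht⟩, ?_⟩
  have h4 : f = g * ⟨t, ht⟩ := Subtype.ext h2
  have h5 : algebraMap _ (FractionRing (cyclicQuotient r a)) g ≠ 0 :=
    (map_ne_zero_iff _ (IsFractionRing.injective _ _)).2 hg0
  rw [h4, map_mul, mul_div_cancel_left₀ _ h5]

lemma norm_diagonalAction {ξ : ℂ} (hξ : ξ ^ r = 1) (f : MvPolynomial (Fin d) ℂ) :
    norm r a (diagonalAction a ξ f) = norm r a f := by
  have hξ0 : ξ ≠ 0 := by
    rintro rfl
    rw [zero_pow (NeZero.ne r)] at hξ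
    exact zero_ne_one hξ
  apply Subtype.ext
  rw [← (norm r a f).2 ξ hξ, coe_norm, coe_norm, map_prod]
  refine Finset.prod_congr rfl fun ζ hζ => ?_
  rw [diagonalAction_mul (mem_nthRootsFinset_ne_zero hζ).2 hξ0,
    diagonalAction_mul hξ0 (mem_nthRootsFinset_ne_zero hζ).2, mul_comm]

lemma exists_prime_norm_mem {P : Ideal (cyclicQuotient r a)} [hP : P.IsPrime]
    (s : MvPolynomial (Fin d) ℂ) (hs : s ≠ 0) (h : norm r a s ∈ P) :
    ∃ q, Prime q ∧ norm r a q ∈ P := by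
  induction s using UniqueFactorizationMonoid.induction_on_prime with
  | h₁ => exact absurd rfl hs
  | h₂ u hu => exact absurd (Ideal.eq_top_of_isUnit_mem _ h (hu.map (norm r a))) hP.ne_top
  | h₃ t q ht hq ih =>
    rw [map_mul] at h
    rcases hP.mem_or_mem h with h | h
    · exact ⟨q, hq, h⟩
    · exact ih ht h

/-- P is minimal over any of its nonzero elements, so Krull's principal ideal theorem bounds its
height. -/
lemma height_eq_one_of_forall {R : Type*} [CommRing R] [IsDomain R] [IsNoetherianRing R]
    {P : Ideal R} [P.IsPrime] (h0 : P ≠ ⊥)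
    (h : ∀ P' : Ideal R, P'.IsPrime → P' ≠ ⊥ → P' ≤ P → P ≤ P') : P.height = 1 := by
  obtain ⟨x, hx, hx0⟩ := Submodule.exists_mem_ne_zero_of_ne_bot h0
  obtain ⟨P', hP', hle⟩ := Ideal.exists_minimalPrimes_le
    ((Ideal.span_singleton_le_iff_mem _).2 hx)
  have hprime := hP'.1.1
  have hx' : x ∈ P' := hP'.1.2 (Ideal.mem_span_singleton_self x)
  have hP'0 : P' ≠ ⊥ := by
    rintro rfl
    exact hx0 hx'
  obtain rfl := le_antisymm hle (h P' hprime hP'0 hle)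
  apply le_antisymm
  · exact Ideal.height_le_one_of_isPrincipal_of_mem_minimalPrimes (Ideal.span {x}) P' hP'
  · rw [Order.one_le_iff_ne_zero, Ne, Ideal.height_eq_zero_iff_eq_bot]
    exact h0

/-- A nonzero prime P' inside the contraction contains the norm of some prime q. Then f divides a
conjugate of q, so f and q are conjugate up to a unit and the norm of f lies in P'. Every element of
the contraction has its r-th power, which is its norm, divisible by that of f. -/
lemma height_contract_span_singleton {f : MvPolynomial (Fin d) ℂ} (hf : Prime f)
    [(Ideal.span {f}).IsPrime] :
    (contract (Ideal.span {f}) : PrimeSpectrum (cyclicQuotient r a)).asIdeal.height = 1 := by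
  apply height_eq_one_of_forall
  · intro h
    have h1 : norm r a f ∈ (contract (Ideal.span {f}) : PrimeSpectrum (cyclicQuotient r a)).asIdeal := by
      rw [mem_contract, Ideal.mem_span_singleton]
      obtain ⟨g, hg⟩ := exists_coe_norm_eq (r := r) (a := a) f
      exact ⟨g, hg⟩
    rw [h] at h1
    exact norm_ne_zero hf.ne_zero h1
  · intro P' hP' h0 hle
    obtain ⟨b, hb, hb0⟩ := Submodule.exists_mem_ne_zero_of_ne_bot h0
    obtain ⟨q, hq, hqP⟩ := exists_prime_norm_mem (P := P') (b : MvPolynomial (Fin d) ℂ)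
      (fun h => hb0 (Subtype.ext h)) (by rw [norm_coe]; exact Ideal.pow_mem_of_mem _ hb _ (NeZero.pos r))
    have h1 := hle hqP
    rw [mem_contract, Ideal.mem_span_singleton, coe_norm, hf.dvd_finsetProd_iff] at h1
    obtain ⟨ζ, hζ, e, he⟩ := h1
    obtain ⟨hζ1, hζ0⟩ := mem_nthRootsFinset_ne_zero hζ
    have hinv : ∀ s, diagonalAction a ζ⁻¹ (diagonalAction a ζ s) = s := fun s => by
      rw [diagonalAction_mul (inv_ne_zero hζ0) hζ0, inv_mul_cancel₀ hζ0, diagonalAction_one]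
    have hinv' : ∀ s, diagonalAction a ζ (diagonalAction a ζ⁻¹ s) = s := fun s => by
      rw [diagonalAction_mul hζ0 (inv_ne_zero hζ0), mul_inv_cancel₀ hζ0, diagonalAction_one]
    have h2 : q = diagonalAction a ζ⁻¹ f * diagonalAction a ζ⁻¹ e := by
      rw [← map_mul, ← he, hinv]
    have h3 : ¬ IsUnit (diagonalAction a ζ⁻¹ f) := fun h => by
      have := h.map (diagonalAction a ζ)
      rw [hinv'] at this
      exact hf.not_isUnit this
    have h4 := (hq.irreducible.isUnit_or_isUnit h2).resolve_left h3
    have h5 : norm r a f ∈ P' := by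
      have h6 : norm r a q = norm r a f * norm r a (diagonalAction a ζ⁻¹ e) := by
        rw [h2, map_mul, norm_diagonalAction (by rw [inv_pow, hζ1, inv_one])]
      rw [h6] at hqP
      exact (Ideal.mul_unit_mem_iff_mem _ (h4.map _)).1 hqP
    intro c hc
    rw [mem_contract, Ideal.mem_span_singleton] at hc
    obtain ⟨e', he'⟩ := hc
    refine hP'.mem_of_pow_mem r ?_
    rw [← norm_coe, he', map_mul]
    exact Ideal.mul_mem_right _ _ h5

end Invariants
-- Rank, adapted bases and primitive vectors.
section Lattice

variable {d : ℕ} {r : ℕ} {a : Fin d → ℤ} [NeZero r]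

variable (r a) in
/-- The exponent of `xᵢ ^ r`. -/
noncomputable def ray (i : Fin d) : weightLattice r a :=
  ⟨toInt (Finsupp.single i r), single_mem_weightLattice i⟩

omit [NeZero r] in
lemma ray_apply (i j : Fin d) : (ray r a i).1 j = if i = j then (r : ℤ) else 0 := by
  simp [ray, Finsupp.single_apply]

omit [NeZero r] in
lemma smul_eq_sum_ray (m : weightLattice r a) : (r : ℤ) • m = ∑ i, m.1 i • ray r a i := by
  apply Subtype.ext
  ext j
  rw [AddSubmonoidClass.coe_finsetSum, Finset.sum_apply]
  simp [ray_apply, mul_comm]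

omit [NeZero r] in
lemma mul_apply_eq_sum (w : weightLattice r a →ₗ[ℤ] ℤ) (m : weightLattice r a) :
    r * w m = ∑ i, m.1 i * w (ray r a i) := by
  have := congrArg w (smul_eq_sum_ray m)
  simpa using this

/-- The lattice lies between r ℤ^d and ℤ^d. -/
lemma finrank_weightLattice : Module.finrank ℤ (weightLattice r a) = d := by
  apply le_antisymm
  · have := Submodule.finrank_le (weightLattice r a)
    simpa using this
  · let f : (Fin d → ℤ) →ₗ[ℤ] weightLattice r a :=
      ((r : ℤ) • LinearMap.id).codRestrict (weightLattice r a)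
        (fun m => mul_mem_weightLattice m)
    have hf : Function.Injective f := fun m n h => by
      have h1 : (r : ℤ) • m = (r : ℤ) • n := congrArg Subtype.val h
      exact smul_right_injective _ (by exact_mod_cast NeZero.ne r) h1
    have := LinearMap.finrank_le_finrank_of_injective hf
    simpa using this

/-- A surjection onto ℤ splits, so a vector of value 1 completes a basis of the kernel. -/
lemma exists_adapted_basis (w : weightLattice r a →ₗ[ℤ] ℤ) (hw : Function.Surjective w) :
    ∃ (b : Module.Basis (Fin d) ℤ (weightLattice r a)) (i₀ : Fin d),
      w (b i₀) = 1 ∧ ∀ j ≠ i₀, w (b j) = 0 := by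
  obtain ⟨m, hm⟩ := hw 1
  let c := Module.finBasis ℤ (LinearMap.ker w)
  let b := Module.Basis.mkFinCons (N := LinearMap.ker w) m c
    (fun k x hx h => by
      have := congrArg w h
      rw [map_add, map_smul, hm, LinearMap.mem_ker.1 hx] at this
      simpa using this)
    (fun z => ⟨-w z, by rw [LinearMap.mem_ker, map_add, map_smul, hm]; simp⟩)
  have hcard : Module.finrank ℤ (LinearMap.ker w) + 1 = d := by
    have h := Module.finrank_eq_card_basis b
    rw [finrank_weightLattice, Fintype.card_fin] at h
    exact h.symm
  refine ⟨b.reindex (finCongr hcard), finCongr hcard 0, ?_, fun j hj => ?_⟩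
  · rw [Module.Basis.reindex_apply, Equiv.symm_apply_apply, Module.Basis.coe_mkFinCons]
    simpa using hm
  · rw [Module.Basis.reindex_apply]
    obtain ⟨k, rfl⟩ := (finCongr hcard).surjective j
    obtain ⟨k, rfl⟩ := Fin.exists_succ_eq.2 fun h : k = 0 => hj (h ▸ rfl)
    rw [Equiv.symm_apply_apply, Module.Basis.coe_mkFinCons, Fin.cons_succ]
    exact LinearMap.mem_ker.1 (c k).2

lemma exists_eq_smul_surjective {M : Type*} [AddCommGroup M] (w : M →ₗ[ℤ] ℤ) (hw : w ≠ 0) :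
    ∃ k : ℤ, 0 < k ∧ ∃ w' : M →ₗ[ℤ] ℤ, Function.Surjective w' ∧ w = k • w' := by
  obtain ⟨k, hk, hr⟩ : ∃ k : ℤ, 0 < k ∧ LinearMap.range w = Ideal.span {k} := by
    obtain ⟨k, hk⟩ := (IsPrincipalIdealRing.principal (LinearMap.range w)).principal
    have hk0 : k ≠ 0 := by
      rintro rfl
      apply hw
      rw [← LinearMap.range_eq_bot, hk]
      simp
    refine ⟨|k|, abs_pos.2 hk0, hk.trans ?_⟩
    rcases abs_choice k with h | h <;> rw [h]
    exact (Ideal.span_singleton_neg k).symm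
  have hdvd : ∀ m, k ∣ w m := fun m =>
    Ideal.mem_span_singleton.1 (hr ▸ LinearMap.mem_range_self w m)
  have hmul : ∀ m, k * (w m / k) = w m := fun m => Int.mul_ediv_cancel' (hdvd m)
  refine ⟨k, hk, ⟨⟨fun m => w m / k, fun m n => ?_⟩, fun c m => ?_⟩, fun c => ?_, ?_⟩
  · apply mul_left_cancel₀ hk.ne'
    rw [mul_add, hmul, hmul, hmul, map_add]
  · apply mul_left_cancel₀ hk.ne'
    rw [hmul, map_smul, smul_eq_mul, smul_eq_mul, RingHom.id_apply, mul_left_comm, hmul]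
  · have : k * c ∈ LinearMap.range w := by
      rw [hr]; exact Ideal.mem_span_singleton.2 (dvd_mul_right _ _)
    obtain ⟨m, hm⟩ := this
    exact ⟨m, by simp [hm, hk.ne']⟩
  · ext m
    simp [hmul]

variable (r a) in
/-- The `i`-th coordinate of an exponent. -/
def coord (i : Fin d) : weightLattice r a →ₗ[ℤ] ℤ := LinearMap.proj i ∘ₗ (weightLattice r a).subtype

omit [NeZero r] in
@[simp] lemma coord_apply (i : Fin d) (m : weightLattice r a) : coord r a i m = m.1 i := rfl

lemma coord_ne_zero (i : Fin d) : coord r a i ≠ 0 := fun h => by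
  have := congrArg (fun f => f (ray r a i)) h
  simp [ray_apply, NeZero.ne r] at this

variable (r a) in
/-- The positive generator of the group of the `i`-th coordinates of exponents. -/
noncomputable def coordGen (i : Fin d) : ℤ :=
  (exists_eq_smul_surjective _ (coord_ne_zero (r := r) (a := a) i)).choose

variable (r a) in
/-- The primitive vector on the `i`-th ray of the cone. -/
noncomputable def primCoord (i : Fin d) : weightLattice r a →ₗ[ℤ] ℤ :=
  (exists_eq_smul_surjective _ (coord_ne_zero (r := r) (a := a) i)).choose_spec.2.choose

lemma coordGen_pos (i : Fin d) : 0 < coordGen r a i :=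
  (exists_eq_smul_surjective _ (coord_ne_zero (r := r) (a := a) i)).choose_spec.1

lemma primCoord_surjective (i : Fin d) : Function.Surjective (primCoord r a i) :=
  (exists_eq_smul_surjective _ (coord_ne_zero (r := r) (a := a) i)).choose_spec.2.choose_spec.1

lemma coordGen_mul_primCoord (i : Fin d) (m : weightLattice r a) :
    coordGen r a i * primCoord r a i m = m.1 i := by
  have := (exists_eq_smul_surjective _ (coord_ne_zero (r := r) (a := a) i)).choose_spec.2.choose_spec.2
  exact (congrArg (fun f => f m) this).symm

variable (r a) in
/-- `r` times minus the exponent of a local equation of the canonical divisor. -/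
noncomputable def canonicalExponent : weightLattice r a := ∑ i, coordGen r a i • ray r a i

end Lattice

/-! ### Laurent monomials in the local rings of the quotient. -/

section LocalStructure

variable {d : ℕ} {r : ℕ} {a : Fin d → ℤ} [NeZero r]

variable {K : Type*} [Field K] [Algebra (cyclicQuotient r a) K]
  [IsFractionRing (cyclicQuotient r a) K]

/-- The r-th power of an invariant monomial is a product of the invariants xᵢ ^ r. Which monomials
vanish at a point is thus decided by these alone. -/
lemma exists_powVar_mem {p : PrimeSpectrum (cyclicQuotient r a)} {u : Fin d →₀ ℕ}
    {hu : toInt u ∈ weightLattice r a} (h : invMonomial u hu ∈ p.asIdeal) :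
    ∃ i, u i ≠ 0 ∧ powVar r a i ∈ p.asIdeal := by
  have h1 : invMonomial u hu ^ r = ∏ i, powVar r a i ^ u i := by
    apply Subtype.ext
    rw [SubmonoidClass.coe_pow, coe_invMonomial]
    have : ((∏ i, powVar r a i ^ u i : cyclicQuotient r a) : MvPolynomial (Fin d) ℂ) =
        ∏ i, (MvPolynomial.X i ^ r) ^ u i := by
      rw [SubmonoidClass.coe_finsetProd]
      exact Finset.prod_congr rfl fun i _ => by rw [SubmonoidClass.coe_pow, coe_powVar]
    rw [this, MvPolynomial.monomial_eq, Finsupp.prod_fintype _ _ (by simp), map_one, one_mul,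
      ← Finset.prod_pow]
    exact Finset.prod_congr rfl fun i _ => pow_right_comm _ _ _
  have h2 := Ideal.pow_mem_of_mem _ h r (NeZero.pos r)
  rw [h1, p.isPrime.prod_mem_iff] at h2
  obtain ⟨i, -, hi⟩ := h2
  refine ⟨i, fun h0 => ?_, p.isPrime.mem_of_pow_mem _ hi⟩
  rw [h0, pow_zero] at hi
  exact p.isPrime.ne_top ((Ideal.eq_top_iff_one _).2 hi)

lemma laurent_mem_localRing {p : PrimeSpectrum (cyclicQuotient r a)} {m : weightLattice r a}
    (h : ∀ i, powVar r a i ∈ p.asIdeal → 0 ≤ m.1 i) :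
    laurent K m ∈ (localRing p : Subring K) := by
  obtain ⟨u, v, hu, hv, huv, h0⟩ := exists_decomposition m
  rw [laurent_eq hu hv huv, div_eq_mul_inv]
  refine Subring.mul_mem _ (algebraMap_mem_localRing p _) (inv_mem_localRing fun hmem => ?_)
  obtain ⟨i, hi, hp⟩ := exists_powVar_mem hmem
  exact hi (h0 i (h i hp))

variable [Algebra ℂ K] [IsScalarTower ℂ (cyclicQuotient r a) K]

lemma hasCoordinates_localRing (p : PrimeSpectrum (cyclicQuotient r a))
    (b : Module.Basis (Fin d) ℤ (weightLattice r a)) (J : Set (Fin d))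
    (hJ : ∀ u (hu : toInt u ∈ weightLattice r a), ∀ j ∉ J, 0 ≤ b.repr ⟨toInt u, hu⟩ j)
    (hmem : ∀ j, laurent K (b j) ∈ (localRing p : Subring K))
    (hinv : ∀ j ∈ J, laurent K (-b j) ∈ (localRing p : Subring K)) :
    HasCoordinates (localRing p : Subring K) (fun j => laurent K (b j)) where
  algebraMap_mem c := by
    rw [IsScalarTower.algebraMap_apply ℂ (cyclicQuotient r a) K]
    exact algebraMap_mem_localRing p _
  mem := hmem
  exists_eq x hx := by
    have hα : ∀ α : Fin d →₀ ℕ, (∀ j ∉ J, α j = 0) →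
        (laurent K (∑ j, α j • b j))⁻¹ ∈ (localRing p : Subring K) := by
      intro α hα
      rw [laurent_sum, ← Finset.prod_inv_distrib]
      refine Subring.prod_mem _ fun j _ => ?_
      rw [laurent_nsmul, ← inv_pow, ← laurent_neg]
      by_cases hj : j ∈ J
      · exact Subring.pow_mem _ (hinv j hj) _
      · rw [hα j hj, pow_zero]; exact Subring.one_mem _
    obtain ⟨f, s, hs, rfl⟩ := mem_localRing_iff.1 hx
    obtain ⟨p', α, hα', hp⟩ := exists_aeval_laurent_eq (K := K) b J hJ f
    obtain ⟨q, β, hβ', hq⟩ := exists_aeval_laurent_eq (K := K) b J hJ s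
    have h1 := laurent_ne_zero (K := K) (∑ j, α j • b j)
    have h2 := laurent_ne_zero (K := K) (∑ j, β j • b j)
    have h3 : algebraMap _ K s ≠ 0 :=
      algebraMap_ne_zero fun h => hs (h ▸ p.asIdeal.zero_mem)
    refine ⟨p' * MvPolynomial.monomial β 1, q * MvPolynomial.monomial α 1, ?_, ?_⟩
    · rw [map_mul, aeval_laurent_monomial, ← hq, map_one, one_mul, mul_inv, mul_inv]
      exact Subring.mul_mem _ (Subring.mul_mem _ (inv_mem_localRing hs) (hα β hβ')) (hα α hα')
    · rw [map_mul, map_mul, aeval_laurent_monomial, aeval_laurent_monomial, ← hp, ← hq, map_one,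
        one_mul, one_mul]
      field_simp

end LocalStructure
-- Orders of forms.
section FormOrder

variable {K : Type*} [Field K] [Algebra ℂ K] {d : ℕ} {R : Subring K}

lemma hasFormOrder_smul {η : RationalForm K d} (h : regularForms R d = Submodule.span R {η})
    {c : K} {k : ℤ} (hc : HasOrder R c k) : HasFormOrder R (c • η) k := by
  obtain ⟨t, u, ht, hu, rfl⟩ := hc
  refine ⟨t, ht, ?_⟩
  have ht0 : (t : K) ≠ 0 := by simpa using ht.ne_zero
  have : (t : K) ^ (-k) • ((u : K) * (t : K) ^ k) • η = u • η := by
    rw [smul_smul, mul_left_comm, ← zpow_add₀ ht0, neg_add_cancel, zpow_zero, mul_one]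
    rfl
  rw [this, h]
  exact Submodule.span_singleton_smul_eq hu η

/-- After scaling by powers of uniformizers both forms generate the same module, so their ratio is a
unit. -/
lemma HasFormOrder.hasOrder_smul [IsDiscreteValuationRing R] {ω : RationalForm K d} (hω : ω ≠ 0)
    {f : K} {k l : ℤ} (h1 : HasFormOrder R ω k) (h2 : HasFormOrder R (f • ω) l) :
    HasOrder R f (l - k) := by
  obtain ⟨s, hs, h1⟩ := h1
  obtain ⟨t, ht, h2⟩ := h2
  have hinj : ∀ x y : K, x • ω = y • ω → x = y := fun x y h => smul_left_injective K hω h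
  obtain ⟨u, hu⟩ := Submodule.mem_span_singleton.1
    ((h1.trans h2.symm).le (Submodule.mem_span_singleton_self _))
  obtain ⟨v, hv⟩ := Submodule.mem_span_singleton.1
    ((h2.trans h1.symm).le (Submodule.mem_span_singleton_self _))
  have hu : (u : K) * ((t : K) ^ (-l) * f) = (s : K) ^ (-k) := hinj _ _ (by
    rw [← hu, smul_smul]; exact mul_smul _ _ _)
  have hv : (v : K) * (s : K) ^ (-k) = (t : K) ^ (-l) * f := hinj _ _ (by
    rw [← smul_smul _ f, ← hv]; exact mul_smul _ _ _)
  have hs0 : (s : K) ≠ 0 := by simpa using hs.ne_zero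
  have ht0 : (t : K) ≠ 0 := by simpa using ht.ne_zero
  have huv : u * v = 1 := Subtype.ext (by
    have : (u : K) * v * (s : K) ^ (-k) = (s : K) ^ (-k) := by rw [mul_assoc, hv, hu]
    exact mul_right_cancel₀ (zpow_ne_zero (-k) hs0) (by rw [Subring.coe_one, one_mul]; exact this))
  have hvu : IsUnit v := IsUnit.of_mul_eq_one u (by rw [mul_comm, huv])
  have hf : f = ((v : K) * (s : K) ^ (-k)) * (t : K) ^ l := by
    rw [hv, mul_right_comm, ← zpow_add₀ ht0, neg_add_cancel, zpow_zero, one_mul]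
  rw [hf]
  have := (HasOrder.mul (R := R) (m := -k) ⟨s, v, hs, hvu, rfl⟩ ((hasOrder_of_irreducible ht).zpow l))
  convert this using 1
  ring

end FormOrder

/-! ### The invariant logarithmic form of the torus. -/

section LogForm

variable {d : ℕ} {r : ℕ} {a : Fin d → ℤ} [NeZero r]

variable {K : Type*} [Field K] [Algebra (cyclicQuotient r a) K]
  [IsFractionRing (cyclicQuotient r a) K] [Algebra ℂ K]

variable (K) in
/-- The logarithmic differential of a Laurent monomial. -/
noncomputable def dlog : weightLattice r a →ₗ[ℤ] Ω[K⁄ℂ] :=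
  AddMonoidHom.toIntLinearMap
    { toFun := fun m => (laurent K m)⁻¹ • KaehlerDifferential.D ℂ K (laurent K m)
      map_zero' := by simp [laurent_zero]
      map_add' := fun m n => by
        rw [laurent_add, Derivation.leibniz, smul_add, smul_smul, smul_smul, mul_inv, add_comm]
        congr 2
        · field_simp [laurent_ne_zero (K := K) n]
        · field_simp [laurent_ne_zero (K := K) m] }

lemma dlog_apply (m : weightLattice r a) :
    dlog K m = (laurent K m)⁻¹ • KaehlerDifferential.D ℂ K (laurent K m) := rfl

variable (K) in
/-- The invariant logarithmic top form of the torus. -/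
noncomputable def logForm (b : Module.Basis (Fin d) ℤ (weightLattice r a)) : RationalForm K d :=
  exteriorPower.ιMulti K d fun j => dlog K (b j)

/-- A change of basis has determinant ±1. The basis may therefore be adapted to each divisor
separately without affecting the order of the form. -/
lemma logForm_eq_or_eq_neg (b b' : Module.Basis (Fin d) ℤ (weightLattice r a)) :
    logForm K b' = logForm K b ∨ logForm K b' = -logForm K b := by
  let f : (weightLattice r a) [⋀^Fin d]→ₗ[ℤ] RationalForm K d :=
    { ((exteriorPower.ιMulti K d (M := Ω[K⁄ℂ])).toMultilinearMap.restrictScalars ℤ).compLinearMap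
        fun _ => dlog K with
      map_eq_zero_of_eq' := fun v i j h hij =>
        (exteriorPower.ιMulti K d (M := Ω[K⁄ℂ])).map_eq_zero_of_eq (fun i => dlog K (v i))
          (congrArg (dlog K) h) hij }
  have h : logForm K b' = b.det b' • logForm K b := AlternatingMap.map_eq_det_smul b f b'
  rcases Int.isUnit_iff.1 (b.isUnit_det b') with h1 | h1
  · left; rw [h, h1, one_smul]
  · right; rw [h, h1, neg_smul, one_smul]

lemma logForm_eq_smul (b : Module.Basis (Fin d) ℤ (weightLattice r a)) :
    logForm K b = laurent K (-∑ j, b j) •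
      exteriorPower.ιMulti K d (fun j => KaehlerDifferential.D ℂ K (laurent K (b j))) := by
  have : logForm K b = (∏ j, (laurent K (b j))⁻¹) •
      exteriorPower.ιMulti K d (fun j => KaehlerDifferential.D ℂ K (laurent K (b j))) :=
    (exteriorPower.ιMulti K d (M := Ω[K⁄ℂ])).toMultilinearMap.map_smul_univ
      (fun j => (laurent K (b j))⁻¹) (fun j => KaehlerDifferential.D ℂ K (laurent K (b j)))
  rw [this, laurent_neg, laurent_sum, Finset.prod_inv_distrib]

lemma hasFormOrder_logForm_of_basis {R : Subring K} {k : ℤ}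
    (b b' : Module.Basis (Fin d) ℤ (weightLattice r a))
    (h : HasFormOrder R (logForm K b') k) : HasFormOrder R (logForm K b) k := by
  rcases logForm_eq_or_eq_neg (K := K) b' b with h1 | h1
  · rwa [h1]
  · obtain ⟨t, ht, hspan⟩ := h
    refine ⟨t, ht, ?_⟩
    rw [h1, smul_neg, ← hspan]
    have := Submodule.span_singleton_smul_eq (R := R) isUnit_one.neg ((t : K) ^ (-k) • logForm K b')
    rwa [neg_smul, one_smul] at this

lemma hasFormOrder_logForm {R : Subring K} {k : ℤ}
    (b b' : Module.Basis (Fin d) ℤ (weightLattice r a))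
    (hR : HasCoordinates R fun j => laurent K (b' j))
    (h : HasOrder R (laurent K (∑ j, b' j)) k) : HasFormOrder R (logForm K b) (-k) := by
  apply hasFormOrder_logForm_of_basis b b'
  rw [logForm_eq_smul]
  apply hasFormOrder_smul hR.regularForms_eq
  rw [laurent_neg]
  exact h.inv

variable [IsScalarTower ℂ (cyclicQuotient r a) K]

lemma logForm_ne_zero (b : Module.Basis (Fin d) ℤ (weightLattice r a)) : logForm K b ≠ 0 := by
  rw [logForm_eq_smul]
  exact smul_ne_zero (laurent_ne_zero _) (laurent_isCoordinateSystem b).ιMulti_ne_zero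

lemma exists_eq_smul_logForm (b : Module.Basis (Fin d) ℤ (weightLattice r a))
    (ω : RationalForm K d) : ∃ f : K, ω = f • logForm K b := by
  obtain ⟨f, hf⟩ := (laurent_isCoordinateSystem (K := K) b).exists_smul_eq ω
  refine ⟨f * laurent K (∑ j, b j), ?_⟩
  rw [logForm_eq_smul, smul_smul, mul_assoc, ← laurent_add, add_neg_cancel, laurent_zero, mul_one, hf]

end LogForm

/-! ### Prime ideals of coordinate faces. -/

section LocalEquation

variable {d : ℕ} {r : ℕ} {a : Fin d → ℤ} [NeZero r]

/-- Restriction of polynomials to the coordinate subspace where the variables in `F` vanish. -/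
noncomputable def faceRestriction (F : Set (Fin d)) [DecidablePred (· ∈ F)] :
    MvPolynomial (Fin d) ℂ →ₐ[ℂ] MvPolynomial (Fin d) ℂ :=
  MvPolynomial.aeval fun i => if i ∈ F then 0 else MvPolynomial.X i

omit [NeZero r] in
lemma coeff_faceRestriction (F : Set (Fin d)) [DecidablePred (· ∈ F)]
    (f : MvPolynomial (Fin d) ℂ) (u : Fin d →₀ ℕ) :
    (faceRestriction F f).coeff u = if ∀ i ∈ F, u i = 0 then f.coeff u else 0 := by
  induction f using MvPolynomial.induction_on' with
  | monomial v c =>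
    have h : faceRestriction F (MvPolynomial.monomial v c) =
        if ∀ i ∈ F, v i = 0 then MvPolynomial.monomial v c else 0 := by
      rw [faceRestriction, MvPolynomial.aeval_monomial, Finsupp.prod_fintype _ _ (by simp)]
      split_ifs with hv
      · rw [MvPolynomial.monomial_eq, Finsupp.prod_fintype _ _ (by simp)]
        congr 1
        refine Finset.prod_congr rfl fun i _ => ?_
        split_ifs with hi
        · rw [hv i hi, pow_zero, pow_zero]
        · rfl
      · push Not at hv
        obtain ⟨i, hi, hvi⟩ := hv
        rw [Finset.prod_eq_zero (Finset.mem_univ i), mul_zero]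
        rw [if_pos hi, zero_pow hvi]
    rw [h]
    by_cases huv : v = u
    · subst huv; split_ifs <;> simp
    · split_ifs <;> simp [MvPolynomial.coeff_monomial, huv]
  | add p q hp hq =>
    rw [map_add, MvPolynomial.coeff_add, hp, hq, MvPolynomial.coeff_add]
    split_ifs <;> simp

open Classical in
variable (r a) in
/-- The prime ideal of the image of the coordinate subspace where the variables in `F` vanish. -/
noncomputable def facePrime (F : Set (Fin d)) : PrimeSpectrum (cyclicQuotient r a) :=
  ⟨RingHom.ker ((faceRestriction F).toRingHom.comp (cyclicQuotient r a).val.toRingHom),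
    RingHom.ker_isPrime _⟩

omit [NeZero r] in
lemma mem_facePrime_iff {F : Set (Fin d)} {f : cyclicQuotient r a} :
    f ∈ (facePrime r a F).asIdeal ↔ ∀ u, f.1.coeff u ≠ 0 → ∃ i ∈ F, u i ≠ 0 := by
  classical
  have : f ∈ (facePrime r a F).asIdeal ↔ faceRestriction F f.1 = 0 := by
    rw [facePrime, RingHom.mem_ker]; rfl
  rw [this, MvPolynomial.ext_iff]
  refine forall_congr' fun u => ?_
  rw [coeff_faceRestriction, MvPolynomial.coeff_zero, ite_eq_right_iff]
  constructor
  · intro h h0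
    by_contra! h1
    exact h0 (h h1)
  · intro h h0
    by_contra h1
    obtain ⟨i, hi, hu⟩ := h h1
    exact hu (h0 i hi)

lemma invMonomial_mem_facePrime_iff {F : Set (Fin d)} {u : Fin d →₀ ℕ}
    {hu : toInt u ∈ weightLattice r a} :
    invMonomial u hu ∈ (facePrime r a F).asIdeal ↔ ∃ i ∈ F, u i ≠ 0 := by
  rw [mem_facePrime_iff]
  refine ⟨fun h => h u (by simp), fun h v hv => ?_⟩
  rw [coe_invMonomial, MvPolynomial.coeff_monomial] at hv
  split_ifs at hv with huv
  · rwa [← huv]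
  · exact absurd rfl hv

lemma powVar_mem_facePrime_iff {F : Set (Fin d)} {i : Fin d} :
    powVar r a i ∈ (facePrime r a F).asIdeal ↔ i ∈ F := by
  rw [powVar, invMonomial_mem_facePrime_iff]
  constructor
  · rintro ⟨j, hj, h⟩
    rw [Finsupp.single_apply, ne_eq, ite_eq_right_iff, not_forall] at h
    obtain ⟨rfl, -⟩ := h
    exact hj
  · exact fun h => ⟨i, h, by simp [NeZero.ne r]⟩

omit [NeZero r] in
lemma facePrime_univ : facePrime r a Set.univ = origin r a := by
  ext f
  rw [mem_facePrime_iff, origin, RingHom.mem_ker]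
  change _ ↔ MvPolynomial.constantCoeff f.1 = 0
  rw [MvPolynomial.constantCoeff_eq]
  constructor
  · intro h
    by_contra h0
    obtain ⟨i, -, hi⟩ := h 0 h0
    exact hi rfl
  · intro h u hu
    by_contra! h0
    obtain rfl : u = 0 := by ext i; exact h0 i trivial
    exact hu h

lemma invMonomial_mem_of_powVar_mem {p : PrimeSpectrum (cyclicQuotient r a)} {i : Fin d}
    (hi : powVar r a i ∈ p.asIdeal) {u : Fin d →₀ ℕ} {hu : toInt u ∈ weightLattice r a}
    (h0 : u i ≠ 0) : invMonomial u hu ∈ p.asIdeal := by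
  apply p.isPrime.mem_of_pow_mem r
  have hru : toInt (r • u) ∈ weightLattice r a := by
    convert! mul_mem_weightLattice (r := r) (a := a) (toInt u) using 1
  have h1 : invMonomial u hu ^ r = invMonomial (r • u) hru := by
    apply Subtype.ext
    rw [SubmonoidClass.coe_pow, coe_invMonomial, coe_invMonomial, MvPolynomial.monomial_pow, one_pow]
  have h2 : r • u = Finsupp.single i r + (r • u - Finsupp.single i r) := by
    rw [add_tsub_cancel_of_le]
    intro j
    rw [Finsupp.single_apply]
    split_ifs with h
    · subst h
      rw [Finsupp.smul_apply, smul_eq_mul]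
      exact Nat.le_mul_of_pos_right _ (Nat.pos_of_ne_zero h0)
    · exact Nat.zero_le _
  have h3 : toInt (r • u - Finsupp.single i r) ∈ weightLattice r a := by
    have h4 : toInt (r • u - Finsupp.single i r) = toInt (r • u) - toInt (Finsupp.single i r) := by
      rw [eq_sub_iff_add_eq', ← toInt_add, ← h2]
    rw [h4]
    exact Submodule.sub_mem _ hru (single_mem_weightLattice i)
  rw [h1, invMonomial_congr h2, ← invMonomial_mul (single_mem_weightLattice i) h3]
  exact Ideal.mul_mem_right _ _ hi

lemma facePrime_le {p : PrimeSpectrum (cyclicQuotient r a)} {F : Set (Fin d)}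
    (h : ∀ i ∈ F, powVar r a i ∈ p.asIdeal) : facePrime r a F ≤ p := by
  intro f hf
  refine mem_of_forall_invMonomial_mem _ f fun u hu h0 => ?_
  obtain ⟨i, hi, hui⟩ := mem_facePrime_iff.1 hf u h0
  exact invMonomial_mem_of_powVar_mem (h i hi) hui

/-- The prime of the face {i} is nonzero and lies in p, which has height one. -/
lemma eq_facePrime_of_powVar_mem {p : PrimeSpectrum (cyclicQuotient r a)}
    (hp : p.asIdeal.height = 1) {i : Fin d} (hi : powVar r a i ∈ p.asIdeal) :
    p = facePrime r a {i} := by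
  have hle : facePrime r a {i} ≤ p := facePrime_le (by rintro _ rfl; exact hi)
  rcases hle.eq_or_lt with h | h
  · exact h.symm
  · exfalso
    have h1 := Ideal.height_add_one_le_of_lt_of_isPrime (I := (facePrime r a {i}).asIdeal) h
    rw [hp] at h1
    have h2 : (facePrime r a {i}).asIdeal.height = 0 := by
      have h3 : (facePrime r a {i}).asIdeal.height < 1 :=
        lt_of_lt_of_le (ENat.lt_add_one_iff (by
          intro htop
          rw [htop] at h1
          exact absurd h1 (by simp)) |>.2 le_rfl) h1
      exact Order.lt_one_iff.1 h3
    rw [Ideal.height_eq_zero_iff_eq_bot] at h2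
    have h3 : powVar r a i ∈ (facePrime r a {i}).asIdeal := powVar_mem_facePrime_iff.2 rfl
    rw [h2] at h3
    exact invMonomial_ne_zero _ _ h3

variable {K : Type*} [Field K] [Algebra (cyclicQuotient r a) K]
  [IsFractionRing (cyclicQuotient r a) K]

/-- Order of Laurent monomials along a discrete valuation ring. -/
lemma exists_order_laurent (R : Subring K) [IsDiscreteValuationRing R] [IsFractionRing R K] :
    ∃ w : weightLattice r a →ₗ[ℤ] ℤ, ∀ m, HasOrder R (laurent K m) (w m) := by
  choose w hw using fun m : weightLattice r a => exists_hasOrder (R := R) (laurent_ne_zero (K := K) m)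
  refine ⟨AddMonoidHom.toIntLinearMap (AddMonoidHom.mk' w fun m n => ?_), hw⟩
  refine (hw (m + n)).unique ?_
  rw [laurent_add]
  exact (hw m).mul (hw n)

end LocalEquation
-- The canonical divisor of the quotient.
section Canonical

/-- A nonunit y dividing every element of p in the local ring generates the maximal ideal. -/
lemma hasOrder_one_of_dvd {K : Type*} [Field K] {B : Type*} [CommRing B] [IsDomain B] [Algebra B K]
    [IsFractionRing B K] {p : PrimeSpectrum B} [IsDiscreteValuationRing (localRing p : Subring K)]
    {y : K} (h0 : y ≠ 0) (hy : y ∈ (localRing p : Subring K)) (hy' : y⁻¹ ∉ (localRing p : Subring K))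
    (h : ∀ b ∈ p.asIdeal, y⁻¹ * algebraMap B K b ∈ (localRing p : Subring K)) :
    HasOrder (localRing p : Subring K) y 1 := by
  obtain ⟨n, hn⟩ := exists_hasOrder (R := (localRing p : Subring K)) h0
  have h1 := hn.mem_iff.1 hy
  have h2 : ¬ 0 ≤ -n := fun hle => hy' (hn.inv.mem_iff.2 hle)
  obtain ⟨t, ht⟩ := IsDiscreteValuationRing.exists_irreducible (localRing p : Subring K)
  obtain ⟨b, s, hs, hbs⟩ := mem_localRing_iff.1 t.2
  have hb : b ∈ p.asIdeal := by
    by_contra hb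
    have hb0 : algebraMap B K b ≠ 0 := by
      intro h
      rw [h, zero_mul] at hbs
      exact ht.ne_zero (Subtype.ext hbs)
    apply ht.not_isUnit
    refine IsUnit.of_mul_eq_one ⟨_, Subring.mul_mem _ (algebraMap_mem_localRing p s)
      (inv_mem_localRing hb)⟩ (Subtype.ext ?_)
    have hs0 : algebraMap B K s ≠ 0 := by
      rw [Ne, FaithfulSMul.algebraMap_eq_zero_iff B K]
      rintro rfl; exact hs p.asIdeal.zero_mem
    change (t : K) * _ = 1
    rw [hbs]
    field_simp
  have h3 : y⁻¹ * t ∈ (localRing p : Subring K) := by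
    rw [hbs, ← mul_assoc]
    exact Subring.mul_mem _ (h b hb) (inv_mem_localRing hs)
  have h4 := (hn.inv.mul (hasOrder_of_irreducible ht)).mem_iff.1 h3
  have : n = 1 := by omega
  exact this ▸ hn

variable {d : ℕ} {r : ℕ} {a : Fin d → ℤ} [NeZero r]

/-- The factors `coordGen` absorb quasi-reflections: along every toric divisor the canonical
exponent has the same order r. -/
lemma primCoord_canonicalExponent (i : Fin d) :
    primCoord r a i (canonicalExponent r a) = r := by
  apply mul_left_cancel₀ (coordGen_pos (r := r) (a := a) i).ne'
  rw [coordGen_mul_primCoord, canonicalExponent, AddSubmonoidClass.coe_finsetSum, Finset.sum_apply]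
  simp [ray_apply]

lemma primCoord_nonneg {i : Fin d} {m : weightLattice r a} (h : 0 ≤ m.1 i) :
    0 ≤ primCoord r a i m := by
  rw [← coordGen_mul_primCoord] at h
  exact nonneg_of_mul_nonneg_right h (coordGen_pos i)

variable {K : Type*} [Field K] [Algebra (cyclicQuotient r a) K]
  [IsFractionRing (cyclicQuotient r a) K] [Algebra ℂ K] [IsScalarTower ℂ (cyclicQuotient r a) K]

/-- If some xᵢ ^ r lies in p, then p is the i-th toric divisor, orders of monomials are given by
`primCoord`, and the form has a simple pole. Otherwise all Laurent monomials are units at p and both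
orders vanish. -/
lemma exists_hasFormOrder_of_height_eq_one (b : Module.Basis (Fin d) ℤ (weightLattice r a))
    {p : PrimeSpectrum (cyclicQuotient r a)} (hp : p.asIdeal.height = 1) :
    ∃ k : ℤ, HasFormOrder (localRing p : Subring K) (logForm K b) k ∧
      HasOrder (localRing p : Subring K) (laurent K (-canonicalExponent r a)) (r * k) := by
  have : IsDiscreteValuationRing (localRing p : Subring K) := isDiscreteValuationRing_localRing hp
  obtain ⟨w, hw⟩ := exists_order_laurent (r := r) (a := a) (localRing p : Subring K)
  by_cases hi : ∃ i, powVar r a i ∈ p.asIdeal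
  · obtain ⟨i, hi⟩ := hi
    obtain rfl := eq_facePrime_of_powVar_mem hp hi
    have hmem : ∀ m : weightLattice r a, 0 ≤ m.1 i →
        laurent K m ∈ (localRing (facePrime r a {i}) : Subring K) := fun m hm =>
      laurent_mem_localRing fun j hj => by
        rw [powVar_mem_facePrime_iff, Set.mem_singleton_iff] at hj
        rwa [hj]
    obtain ⟨b', i₀, h1, h2⟩ := exists_adapted_basis _ (primCoord_surjective (r := r) (a := a) i)
    have hi₀ : 0 ≤ (b' i₀).1 i := by
      rw [← coordGen_mul_primCoord, h1, mul_one]; exact (coordGen_pos i).le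
    have hj : ∀ j ≠ i₀, (b' j).1 i = 0 := fun j hj => by
      rw [← coordGen_mul_primCoord, h2 j hj, mul_zero]
    have hwj : ∀ j ≠ i₀, w (b' j) = 0 := fun j hj' => by
      have h3 := (hw (b' j)).mem_iff.1 (hmem _ (hj j hj').ge)
      have h4 := (hw (-b' j)).mem_iff.1 (hmem _ (by simp [hj j hj']))
      rw [map_neg] at h4
      omega
    have hrepr : ∀ m, b'.repr m i₀ = primCoord r a i m := fun m => by
      conv_rhs => rw [← b'.sum_repr m]
      rw [map_sum, Finset.sum_eq_single i₀]
      · simp [h1]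
      · intro j _ hj; simp [h2 j hj]
      · simp
    -- The basis vectors other than b' i₀ have i-th exponent zero and so are units; only the value
    -- on b' i₀ remains to be found.
    have hw' : w = w (b' i₀) • primCoord r a i := b'.ext fun j => by
      by_cases hj' : j = i₀
      · subst hj'; simp [h1]
      · simp [hwj j hj', h2 j hj']
    have hone : HasOrder (localRing (facePrime r a {i}) : Subring K) (laurent K (b' i₀)) 1 := by
      refine hasOrder_one_of_dvd (laurent_ne_zero _) (hmem _ hi₀) ?_ ?_
      · intro hinv
        have h3 := (hw _).inv.mem_iff.1 hinv
        have h4 := (hw _).mem_iff.1 (hmem _ hi₀)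
        have h5 : w = 0 := by
          rw [hw', show w (b' i₀) = 0 by omega, zero_smul]
        have h6 := hasOrder_zero_iff.1 (by simpa [h5] using hw (ray r a i))
        rw [ray, laurent_toInt] at h6
        exact (inv_mem_localRing_iff (invMonomial_ne_zero _ _)).1 h6.2.2 hi
      · intro f hf
        -- The elements divisible by the monomial b' i₀ in the local ring form an ideal, so
        -- divisibility needs checking only on monomials.
        let I : Ideal (cyclicQuotient r a) :=
          { carrier := {f | (laurent K (b' i₀))⁻¹ * algebraMap _ K f ∈
              (localRing (facePrime r a {i}) : Subring K)}
            add_mem' := fun {f g} hf hg => by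
              rw [Set.mem_ofPred_eq] at hf hg ⊢
              rw [map_add, mul_add]; exact Subring.add_mem _ hf hg
            zero_mem' := by
              rw [Set.mem_ofPred_eq, map_zero, mul_zero]; exact Subring.zero_mem _
            smul_mem' := fun c f hf => by
              rw [Set.mem_ofPred_eq] at hf ⊢
              rw [smul_eq_mul, map_mul, mul_left_comm]
              exact Subring.mul_mem _ (algebraMap_mem_localRing _ _) hf }
        refine mem_of_forall_invMonomial_mem I f fun u hu hfu => ?_
        change (laurent K (b' i₀))⁻¹ * algebraMap _ K (invMonomial u hu) ∈
          (localRing (facePrime r a {i}) : Subring K)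
        rw [← laurent_toInt, ← laurent_neg, ← laurent_add]
        apply hmem
        rw [← coordGen_mul_primCoord, map_add, map_neg, h1]
        apply mul_nonneg (coordGen_pos i).le
        obtain ⟨i', hi', hui⟩ := mem_facePrime_iff.1 hf u hfu
        rw [Set.mem_singleton_iff.1 hi'] at hui
        have h3 : 0 < primCoord r a i ⟨toInt u, hu⟩ := by
          have h4 := coordGen_mul_primCoord i ⟨toInt u, hu⟩
          have h5 : (0 : ℤ) < toInt u i := by
            rw [toInt_apply]; exact_mod_cast Nat.pos_of_ne_zero hui
          change 0 < (⟨toInt u, hu⟩ : weightLattice r a).1 i at h5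
          rw [← h4] at h5
          exact pos_of_mul_pos_right h5 (coordGen_pos i).le
        omega
    have hw1 : w (b' i₀) = 1 := (hw _).unique hone
    rw [hw1, one_smul] at hw'
    have hcoord := hasCoordinates_localRing (K := K) (facePrime r a {i}) b' {j | j ≠ i₀}
      (fun u hu j hj => by
        rw [Set.mem_ofPred_eq, not_not] at hj
        rw [hj, hrepr]
        exact primCoord_nonneg (by simp))
      (fun j => by
        by_cases h : j = i₀
        · exact h ▸ hmem _ hi₀
        · exact hmem _ (hj j h).ge)
      (fun j h => hmem _ (by simp [hj j h]))
    refine ⟨-1, hasFormOrder_logForm b b' hcoord ?_, ?_⟩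
    · convert hw (∑ j, b' j)
      rw [map_sum, Finset.sum_eq_single i₀ (fun j _ hj => hwj j hj) (by simp), hw1]
    · convert hw (-canonicalExponent r a)
      rw [map_neg, hw', primCoord_canonicalExponent]; ring
  · push Not at hi
    have hmem : ∀ m : weightLattice r a, laurent K m ∈ (localRing p : Subring K) := fun m =>
      laurent_mem_localRing fun i h => absurd h (hi i)
    have hw0 : ∀ m, w m = 0 := fun m => by
      have h1 := (hw m).mem_iff.1 (hmem m)
      have h2 := (hw (-m)).mem_iff.1 (hmem _)
      rw [map_neg] at h2
      omega
    have hcoord := hasCoordinates_localRing (K := K) p b Set.univ (by simp)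
      (fun j => hmem _) (fun j _ => hmem _)
    refine ⟨-0, hasFormOrder_logForm b b hcoord ?_, ?_⟩
    · convert hw (∑ j, b j)
      rw [hw0]
    · convert hw (-canonicalExponent r a)
      rw [hw0, neg_zero, mul_zero]

lemma isLocalEquation_logForm (b : Module.Basis (Fin d) ℤ (weightLattice r a))
    (x : PrimeSpectrum (cyclicQuotient r a)) :
    IsLocalEquation x (logForm K b) r (laurent K (-canonicalExponent r a)) :=
  ⟨NeZero.pos r, fun _ hP _ => exists_hasFormOrder_of_height_eq_one b hP⟩

end Canonical

/-! ### Coordinate hyperplanes of affine-space charts as divisors over X. -/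

section PrimeDivisors

lemma ne_zero_of_injective_aeval {K : Type*} [Field K] [Algebra ℂ K] {d : ℕ} {y : Fin d → K}
    (hy : Function.Injective (MvPolynomial.aeval (R := ℂ) y)) (j : Fin d) : y j ≠ 0 := fun h => by
  have := hy (a₁ := MvPolynomial.X j) (a₂ := 0) (by rw [MvPolynomial.aeval_X, h, map_zero])
  exact MvPolynomial.X_ne_zero j this

variable {A K : Type*} [CommRing A] [Field K] [Algebra A K]

lemma PrimeDivisorOver.localRing_le (E : PrimeDivisorOver A K) :
    (localRing E.center : Subring K) ≤ E.valuationRing := by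
  intro x hx
  obtain ⟨f, s, hs, hx⟩ := hx
  exact ⟨algebraMap A E.chart f, algebraMap A E.chart s, hs, hx⟩

section ValuationRing

variable [IsFractionRing A K]

instance isFractionRing_subalgebra (B : Subalgebra A K) : IsFractionRing B K := by
  refine IsFractionRing.of_field _ _ fun x => ?_
  obtain ⟨f, g, -, rfl⟩ := IsFractionRing.div_surjective (A := A) x
  exact ⟨algebraMap A B f, algebraMap A B g, rfl⟩

lemma PrimeDivisorOver.isDiscreteValuationRing [IsNoetherianRing A] (E : PrimeDivisorOver A K) :
    IsDiscreteValuationRing E.valuationRing := by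
  have := E.normal
  have : IsNoetherianRing E.chart := isNoetherianRing_of_fg E.finiteType
  exact isDiscreteValuationRing_localRing E.height_eq_one

instance PrimeDivisorOver.isFractionRing_valuationRing (E : PrimeDivisorOver A K) :
    IsFractionRing E.valuationRing K :=
  isFractionRing_localRing E.point

lemma PrimeDivisorOver.inv_notMem (E : PrimeDivisorOver A K) {f : A} (hf : f ≠ 0)
    (h : f ∈ E.center.asIdeal) : (algebraMap A K f)⁻¹ ∉ E.valuationRing := by
  have h0 : algebraMap A E.chart f ≠ 0 := by
    intro h0
    have := congrArg (Subtype.val) h0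
    exact hf (IsFractionRing.injective A K (this.trans (map_zero (algebraMap A K)).symm))
  intro hinv
  exact (inv_mem_localRing_iff (K := K) (p := E.point) h0).1 hinv h

end ValuationRing

/-- The prime ideal of a coordinate hyperplane. -/
noncomputable def coordinatePrime {d : ℕ} (i : Fin d) : PrimeSpectrum (MvPolynomial (Fin d) ℂ) :=
  ⟨Ideal.span {MvPolynomial.X i},
    (Ideal.span_singleton_prime (MvPolynomial.X_ne_zero i)).2 MvPolynomial.X_prime⟩

lemma height_comap_coordinatePrime {d : ℕ} {B : Type*} [CommRing B]
    (e : MvPolynomial (Fin d) ℂ ≃+* B) (i : Fin d) :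
    (PrimeSpectrum.comap e.symm.toRingHom (coordinatePrime i)).asIdeal.height = 1 := by
  refine (e.symm.height_comap (coordinatePrime i).asIdeal).trans ?_
  have := (coordinatePrime i).isPrime
  apply le_antisymm
  · apply Ideal.height_le_one_of_isPrincipal_of_mem_minimalPrimes
      (Ideal.span {(MvPolynomial.X i : MvPolynomial (Fin d) ℂ)})
    rw [coordinatePrime] at this ⊢
    rw [Ideal.minimalPrimes_eq_subsingleton_self]
    rfl
  · rw [Order.one_le_iff_ne_zero, Ne, Ideal.height_eq_zero_iff_eq_bot, coordinatePrime,
      Ideal.span_singleton_eq_bot]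
    exact MvPolynomial.X_ne_zero i

section Chart

variable [Algebra ℂ K] {d : ℕ} {y : Fin d → K}
  (hy : Function.Injective (MvPolynomial.aeval (R := ℂ) y))
  (hA : ∀ f : A, algebraMap A K f ∈ (MvPolynomial.aeval (R := ℂ) y).range)

/-- The affine space with coordinates `y`, as a chart over `Spec A`. -/
noncomputable def coordinateChart : Subalgebra A K where
  toSubsemiring := (MvPolynomial.aeval (R := ℂ) y).range.toSubsemiring
  algebraMap_mem' := hA

/-- The chart is a polynomial ring. -/
noncomputable def coordinateChartEquiv : MvPolynomial (Fin d) ℂ ≃+* coordinateChart hA :=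
  RingEquiv.ofBijective
    ((MvPolynomial.aeval (R := ℂ) y).toRingHom.codRestrict (coordinateChart hA) fun p => ⟨p, rfl⟩)
    ⟨fun p q h => hy (congrArg Subtype.val h), by
      rintro ⟨_, p, rfl⟩
      exact ⟨p, rfl⟩⟩

lemma coe_coordinateChartEquiv (p : MvPolynomial (Fin d) ℂ) :
    (coordinateChartEquiv hy hA p : K) = MvPolynomial.aeval y p := rfl

lemma coordinateChart_fg [Algebra ℂ A] [IsScalarTower ℂ A K] : (coordinateChart hA).FG := by
  classical
  refine ⟨Finset.univ.image y, le_antisymm ?_ ?_⟩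
  · rw [Algebra.adjoin_le_iff]
    intro x hx
    obtain ⟨j, -, rfl⟩ := Finset.mem_image.1 hx
    exact ⟨MvPolynomial.X j, MvPolynomial.aeval_X _ _⟩
  · rintro _ ⟨p, rfl⟩
    change MvPolynomial.aeval y p ∈ _
    induction p using MvPolynomial.induction_on with
    | C c =>
      rw [MvPolynomial.aeval_C, IsScalarTower.algebraMap_apply ℂ A K]
      exact Subalgebra.algebraMap_mem _ _
    | add p q hp hq => rw [map_add]; exact Subalgebra.add_mem _ hp hq
    | mul_X p j hp =>
      rw [map_mul, MvPolynomial.aeval_X]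
      exact Subalgebra.mul_mem _ hp (Algebra.subset_adjoin (by simp))

end Chart

variable [Algebra ℂ A] [Algebra ℂ K] [IsScalarTower ℂ A K] {d : ℕ} {y : Fin d → K}
  (hy : Function.Injective (MvPolynomial.aeval (R := ℂ) y))
  (hA : ∀ f : A, algebraMap A K f ∈ (MvPolynomial.aeval (R := ℂ) y).range)

/-- The prime divisor cut out by a coordinate. -/
noncomputable def coordinateDivisor (i₀ : Fin d) : PrimeDivisorOver A K where
  chart := coordinateChart hA
  finiteType := coordinateChart_fg hA
  normal := IsIntegrallyClosed.of_equiv (coordinateChartEquiv hy hA)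
  point := PrimeSpectrum.comap (coordinateChartEquiv hy hA).symm.toRingHom (coordinatePrime i₀)
  height_eq_one := height_comap_coordinatePrime (coordinateChartEquiv hy hA) i₀

lemma mem_point_coordinateDivisor_iff {i₀ : Fin d} {p : MvPolynomial (Fin d) ℂ} :
    coordinateChartEquiv hy hA p ∈ (coordinateDivisor hy hA i₀).point.asIdeal ↔
      (MvPolynomial.X i₀ : MvPolynomial (Fin d) ℂ) ∣ p := by
  rw [← Ideal.mem_span_singleton]
  change (coordinateChartEquiv hy hA).symm (coordinateChartEquiv hy hA p) ∈
    Ideal.span {(MvPolynomial.X i₀ : MvPolynomial (Fin d) ℂ)} ↔ _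
  rw [RingEquiv.symm_apply_apply]

variable [IsFractionRing A K]

lemma hasCoordinates_coordinateDivisor (i₀ : Fin d) :
    HasCoordinates (coordinateDivisor hy hA i₀).valuationRing y := by
  have hmem : ∀ p, MvPolynomial.aeval y p ∈ (coordinateDivisor hy hA i₀).valuationRing := fun p =>
    algebraMap_mem_localRing (K := K) (coordinateDivisor hy hA i₀).point
      (coordinateChartEquiv hy hA p)
  refine ⟨fun c => ?_, fun j => ?_, fun x hx => ?_⟩
  · simpa using hmem (MvPolynomial.C c)
  · simpa using hmem (MvPolynomial.X j)
  · obtain ⟨f, s, hs, rfl⟩ := mem_localRing_iff.1 hx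
    obtain ⟨p, rfl⟩ := (coordinateChartEquiv hy hA).surjective f
    obtain ⟨q, rfl⟩ := (coordinateChartEquiv hy hA).surjective s
    exact ⟨p, q, inv_mem_localRing (K := K) hs, rfl⟩

lemma inv_mem_coordinateDivisor_iff {i₀ j : Fin d} :
    (y j)⁻¹ ∈ (coordinateDivisor hy hA i₀).valuationRing ↔ j ≠ i₀ := by
  have hX : algebraMap (coordinateChart hA) K (coordinateChartEquiv hy hA (MvPolynomial.X j)) =
      y j := (coe_coordinateChartEquiv hy hA _).trans (MvPolynomial.aeval_X _ _)
  have h := inv_mem_localRing_iff (K := K) (p := (coordinateDivisor hy hA i₀).point)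
    (s := coordinateChartEquiv hy hA (MvPolynomial.X j))
    (fun h => ne_zero_of_injective_aeval hy j (hX.symm.trans (congrArg Subtype.val h)))
  have h1 := h.trans (not_congr (mem_point_coordinateDivisor_iff hy hA))
  rw [MvPolynomial.X_dvd_X, eq_comm] at h1
  rw [← hX]
  exact h1

variable [IsNoetherianRing A]

lemma hasOrder_one_coordinateDivisor (j : Fin d) :
    HasOrder (coordinateDivisor hy hA j).valuationRing (y j) 1 := by
  have : IsDiscreteValuationRing (localRing (coordinateDivisor hy hA j).point : Subring K) :=
    (coordinateDivisor hy hA j).isDiscreteValuationRing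
  have hcoord := hasCoordinates_coordinateDivisor hy hA j
  refine hasOrder_one_of_dvd (p := (coordinateDivisor hy hA j).point) (ne_zero_of_injective_aeval hy j)
    (hcoord.mem j) (fun h => (inv_mem_coordinateDivisor_iff hy hA).1 h rfl) fun f hf => ?_
  obtain ⟨p, rfl⟩ := (coordinateChartEquiv hy hA).surjective f
  obtain ⟨q, rfl⟩ := (mem_point_coordinateDivisor_iff hy hA).1 hf
  have h3 : algebraMap _ K (coordinateChartEquiv hy hA (MvPolynomial.X j * q)) =
      y j * MvPolynomial.aeval y q := by
    refine (coe_coordinateChartEquiv hy hA _).trans ?_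
    rw [map_mul, MvPolynomial.aeval_X]
  have h4 := hcoord.aeval_mem q
  rw [← inv_mul_cancel_left₀ (ne_zero_of_injective_aeval hy j) (MvPolynomial.aeval y q), ← h3] at h4
  exact h4

lemma hasOrder_zero_coordinateDivisor {i₀ j : Fin d} (h : j ≠ i₀) :
    HasOrder (coordinateDivisor hy hA i₀).valuationRing (y j) 0 := by
  have := (coordinateDivisor hy hA i₀).isDiscreteValuationRing
  exact hasOrder_zero_iff.2 ⟨ne_zero_of_injective_aeval hy j,
    (hasCoordinates_coordinateDivisor hy hA i₀).mem j, (inv_mem_coordinateDivisor_iff hy hA).2 h⟩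

end PrimeDivisors

/-! ### Toric divisors and their log discrepancies. -/

section Toric

variable {d : ℕ} {r : ℕ} {a : Fin d → ℤ} [NeZero r]

/-- Since w is positive on all rays, shearing an adapted basis far enough makes every invariant
monomial a true monomial in the new coordinates. These then give an affine-space chart over X in
which coordinate i₀ cuts out the divisor of w. -/
lemma exists_nonneg_adapted_basis (w : weightLattice r a →ₗ[ℤ] ℤ) (hw : Function.Surjective w)
    (hpos : ∀ i, 0 < w (ray r a i)) :
    ∃ (b : Module.Basis (Fin d) ℤ (weightLattice r a)) (i₀ : Fin d),
      w (b i₀) = 1 ∧ (∀ j ≠ i₀, w (b j) = 0) ∧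
      ∀ u (hu : toInt u ∈ weightLattice r a), ∀ j, 0 ≤ b.repr ⟨toInt u, hu⟩ j := by
  obtain ⟨b, i₀, h1, h2⟩ := exists_adapted_basis w hw
  let s : weightLattice r a := ∑ j ∈ Finset.univ.erase i₀, b j
  have hs : w s = 0 := by
    rw [map_sum]
    exact Finset.sum_eq_zero fun j hj => h2 j (Finset.ne_of_mem_erase hj)
  have hsrepr : ∀ j, b.repr s j = if j = i₀ then 0 else 1 := fun j => by
    rw [map_sum, Finsupp.finsetSum_apply]
    simp only [Module.Basis.repr_self, Finsupp.single_apply]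
    rw [Finset.sum_ite_eq']
    by_cases h : j = i₀ <;> simp [h]
  have hrepr : ∀ m, b.repr m i₀ = w m := fun m => by
    conv_rhs => rw [← b.sum_repr m]
    rw [map_sum, Finset.sum_eq_single i₀]
    · simp [h1]
    · intro j _ hj; simp [h2 j hj]
    · simp
  let k : ℤ := ∑ i, ∑ j, |b.repr (ray r a i) j|
  have hk : ∀ i j, -k ≤ b.repr (ray r a i) j := fun i j => by
    have h3 : |b.repr (ray r a i) j| ≤ k :=
      (Finset.single_le_sum (f := fun j => |b.repr (ray r a i) j|) (fun _ _ => abs_nonneg _)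
        (Finset.mem_univ j)).trans
      (Finset.single_le_sum (f := fun i => ∑ j, |b.repr (ray r a i) j|)
        (fun _ _ => Finset.sum_nonneg fun _ _ => abs_nonneg _) (Finset.mem_univ i))
    exact (neg_le_neg h3).trans (neg_abs_le _)
  have hk0 : 0 ≤ k := Finset.sum_nonneg fun _ _ => Finset.sum_nonneg fun _ _ => abs_nonneg _
  -- As w s = 0, the map f squares to zero and 1 - f has inverse 1 + f. The shear adds k w(m) to
  -- every coordinate of m except the i₀-th, and k was chosen to outweigh the coordinates of the
  -- rays.
  let f : weightLattice r a →ₗ[ℤ] weightLattice r a := w.smulRight (k • s)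
  have hff : ∀ m, f (f m) = 0 := fun m => by simp [f, hs]
  let φ : weightLattice r a ≃ₗ[ℤ] weightLattice r a :=
    LinearEquiv.ofLinearMap (LinearMap.id - f) (LinearMap.id + f)
      (LinearMap.ext fun m => by simp [hff]) (LinearMap.ext fun m => by simp [hff])
  have hwφ : ∀ m, w (φ m) = w m := fun m => by
    change w (m - w m • k • s) = w m
    simp [hs]
  refine ⟨b.map φ, i₀, ?_, fun j hj => ?_, fun u hu j => ?_⟩
  · rw [Module.Basis.map_apply, hwφ, h1]
  · rw [Module.Basis.map_apply, hwφ, h2 j hj]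
  · have hw0 : ∀ m : weightLattice r a, (b.map φ).repr m j =
        b.repr m j + w m * (k * if j = i₀ then 0 else 1) := fun m => by
      rw [Module.Basis.map_repr, LinearEquiv.trans_apply]
      change b.repr (m + w m • k • s) j = _
      rw [map_add, map_smul, map_smul, Finsupp.add_apply, Finsupp.smul_apply, Finsupp.smul_apply,
        hsrepr, smul_eq_mul, smul_eq_mul]
    have hr : (0 : ℤ) < r := by exact_mod_cast NeZero.pos r
    -- After multiplication by r the exponent u is a nonnegative combination of rays, so only the
    -- rays need checking.
    refine nonneg_of_mul_nonneg_right (a := (r : ℤ)) ?_ hr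
    have := mul_apply_eq_sum (((Finsupp.lapply j : (Fin d →₀ ℤ) →ₗ[ℤ] ℤ) ∘ₗ
      (b.map φ).repr.toLinearMap)) ⟨toInt u, hu⟩
    change (r : ℤ) * (b.map φ).repr ⟨toInt u, hu⟩ j =
      ∑ i, toInt u i * (b.map φ).repr (ray r a i) j at this
    rw [this]
    refine Finset.sum_nonneg fun i _ => mul_nonneg (by simp) ?_
    rw [hw0]
    by_cases h : j = i₀
    · rw [if_pos h, h, hrepr]
      simpa using (hpos i).le
    · rw [if_neg h]
      have h3 := hk i j
      have h4 := hpos i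
      nlinarith

variable {K : Type*} [Field K] [Algebra (cyclicQuotient r a) K]
  [IsFractionRing (cyclicQuotient r a) K] [Algebra ℂ K] [IsScalarTower ℂ (cyclicQuotient r a) K]

variable {b : Module.Basis (Fin d) ℤ (weightLattice r a)}

lemma algebraMap_mem_range
    (hb : ∀ u (hu : toInt u ∈ weightLattice r a), ∀ j, 0 ≤ b.repr ⟨toInt u, hu⟩ j)
    (f : cyclicQuotient r a) :
    algebraMap _ K f ∈ (MvPolynomial.aeval (R := ℂ) fun j => laurent K (b j)).range := by
  obtain ⟨p, α, hα, hp⟩ := exists_aeval_laurent_eq (K := K) b ∅ (fun u hu j _ => hb u hu j) f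
  refine ⟨p, hp.symm.trans ?_⟩
  have : ∑ j, α j • b j = 0 := Finset.sum_eq_zero fun j _ => by rw [hα j (by simp), zero_smul]
  rw [this, laurent_zero, mul_one]

lemma hasOrder_laurent_coordinateDivisor
    (hA : ∀ f : cyclicQuotient r a,
      algebraMap _ K f ∈ (MvPolynomial.aeval (R := ℂ) fun j => laurent K (b j)).range)
    {w : weightLattice r a →ₗ[ℤ] ℤ} {i₀ : Fin d} (h1 : w (b i₀) = 1)
    (h2 : ∀ j ≠ i₀, w (b j) = 0) (m : weightLattice r a) :
    HasOrder (coordinateDivisor (laurent_isCoordinateSystem b).injective hA i₀).valuationRing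
      (laurent K m) (w m) := by
  have := (coordinateDivisor (laurent_isCoordinateSystem b).injective hA i₀).isDiscreteValuationRing
  obtain ⟨v, hv⟩ := exists_order_laurent (r := r) (a := a)
    (coordinateDivisor (laurent_isCoordinateSystem b).injective hA i₀).valuationRing
  suffices h : w = v by rw [h]; exact hv m
  refine b.ext fun j => ?_
  by_cases hj : j = i₀
  · subst hj
    rw [h1]
    exact (hasOrder_one_coordinateDivisor _ hA j).unique (hv (b j))
  · rw [h2 j hj]
    exact (hasOrder_zero_coordinateDivisor (laurent_isCoordinateSystem b).injective hA hj).unique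
      (hv (b j))

-- Positive orders put every xᵢ ^ r, hence the whole ideal of the origin, into the center, and that
-- ideal is maximal.
omit [Algebra ℂ K] [IsScalarTower ℂ (cyclicQuotient r a) K] in
lemma center_eq_origin {E : PrimeDivisorOver (cyclicQuotient r a) K}
    {w : weightLattice r a →ₗ[ℤ] ℤ} (hE : ∀ m, HasOrder E.valuationRing (laurent K m) (w m))
    (hpos : ∀ i, 0 < w (ray r a i)) : E.center = origin r a := by
  have := E.isDiscreteValuationRing
  have hle : origin r a ≤ E.center := by
    rw [← facePrime_univ]
    refine facePrime_le fun i _ => ?_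
    by_contra hmem
    have h3 : (algebraMap _ K (powVar r a i))⁻¹ ∈ E.valuationRing :=
      E.localRing_le (inv_mem_localRing hmem)
    have h4 := hE (ray r a i)
    rw [ray, laurent_toInt] at h4
    have h5 := h4.inv.mem_iff.1 h3
    have h6 := hpos i
    rw [ray] at h6
    omega
  apply le_antisymm _ hle
  intro f hf
  by_contra h0
  have h3 : MvPolynomial.constantCoeff f.1 ≠ 0 := h0
  have h4 : f - algebraMap ℂ _ (MvPolynomial.constantCoeff f.1) ∈ (origin r a).asIdeal := by
    rw [origin, RingHom.mem_ker]
    change MvPolynomial.constantCoeff (f.1 - MvPolynomial.C (MvPolynomial.constantCoeff f.1)) = 0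
    simp
  have h5 := Ideal.sub_mem _ hf (hle h4)
  rw [sub_sub_cancel] at h5
  exact E.center.isPrime.ne_top
    (Ideal.eq_top_of_isUnit_mem _ h5 ((Ne.isUnit h3).map (algebraMap ℂ (cyclicQuotient r a))))

variable (r a) in
/-- The log discrepancy of the toric divisor with primitive vector `w`. -/
noncomputable def toricDiscrepancy (w : weightLattice r a →ₗ[ℤ] ℤ) : ℚ :=
  (w (canonicalExponent r a) : ℚ) / r

-- On the chart of a nonnegative adapted basis the logarithmic form has order -1 along the divisor.
-- This cancels the 1 in the log discrepancy and leaves the order of the local equation.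
variable (K) in
lemma exists_isLogDiscrepancy (w : weightLattice r a →ₗ[ℤ] ℤ) (hw : Function.Surjective w)
    (hpos : ∀ i, 0 < w (ray r a i)) :
    ∃ E : PrimeDivisorOver (cyclicQuotient r a) K, E.center = origin r a ∧
      IsLogDiscrepancy d (origin r a) E (toricDiscrepancy r a w) := by
  obtain ⟨b, i₀, h1, h2, hb⟩ := exists_nonneg_adapted_basis w hw hpos
  have hA := algebraMap_mem_range (K := K) hb
  have hord := hasOrder_laurent_coordinateDivisor hA h1 h2
  refine ⟨_, center_eq_origin hord hpos, logForm K b, r,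
    laurent K (-canonicalExponent r a), isLocalEquation_logForm b _, -1,
    w (-canonicalExponent r a), ?_, hord _, ?_⟩
  · apply hasFormOrder_logForm b b (hasCoordinates_coordinateDivisor _ hA i₀)
    convert hord (∑ j, b j)
    rw [map_sum, Finset.sum_eq_single i₀ (fun j _ hj => h2 j hj) (by simp), h1]
  · rw [toricDiscrepancy, map_neg]
    push_cast
    ring

end Toric
-- Lower bound for arbitrary divisors; reduction to lattice vectors.
section LowerBound

variable {d : ℕ} {r : ℕ} {a : Fin d → ℤ} [NeZero r]

variable {K : Type*} [Field K] [Algebra (cyclicQuotient r a) K]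
  [IsFractionRing (cyclicQuotient r a) K]

-- The reduced fraction h = p / q uses unique factorization of polynomials; p and q need not be
-- invariant.
omit [NeZero r] in
lemma exists_coprime_eq (h : K) (h0 : h ≠ 0) : ∃ p q : MvPolynomial (Fin d) ℂ, p ≠ 0 ∧ q ≠ 0 ∧
    (∀ f, Prime f → f ∣ p → ¬ f ∣ q) ∧
    ∀ s t : cyclicQuotient r a, h * algebraMap _ K s = algebraMap _ K t ↔
      p * (s : MvPolynomial (Fin d) ℂ) = q * t := by
  obtain ⟨f, g, hg, rfl⟩ := IsFractionRing.div_surjective (A := cyclicQuotient r a) h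
  have hg0 : g ≠ 0 := nonZeroDivisors.ne_zero hg
  have hf0 : f ≠ 0 := by rintro rfl; simp at h0
  have hg1 : (g : MvPolynomial (Fin d) ℂ) ≠ 0 := fun h => hg0 (Subtype.ext h)
  have hf1 : (f : MvPolynomial (Fin d) ℂ) ≠ 0 := fun h => hf0 (Subtype.ext h)
  obtain ⟨p, q, c, hpq, hp, hq⟩ := UniqueFactorizationMonoid.exists_reduced_factors
    (f : MvPolynomial (Fin d) ℂ) hf1 g
  refine ⟨p, q, ?_, ?_, fun e he h1 h2 => he.not_isUnit (hpq h1 h2), fun s t => ?_⟩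
  · rintro rfl; exact hf1 (by rw [← hp, mul_zero])
  · rintro rfl; exact hg1 (by rw [← hq, mul_zero])
  · have hc : c ≠ 0 := by rintro rfl; exact hf1 (by rw [← hp, zero_mul])
    rw [div_mul_eq_mul_div, div_eq_iff (algebraMap_ne_zero hg0), ← map_mul, ← map_mul,
      (IsFractionRing.injective (cyclicQuotient r a) K).eq_iff, ← Subtype.coe_inj]
    rw [MulMemClass.coe_mul, MulMemClass.coe_mul, ← hp, ← hq]
    constructor
    · intro h
      apply mul_left_cancel₀ hc
      linear_combination h
    · intro h
      linear_combination c * h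

/-- If p vanished at the origin, so would one of its prime factors f. The contraction of (f) would
be a height-one prime through the origin at which h is not a unit. -/
lemma constantCoeff_ne_zero_of_hasOrder {h : K} (h0 : h ≠ 0)
    (hord : ∀ P : PrimeSpectrum (cyclicQuotient r a), P.asIdeal.height = 1 → P ≤ origin r a →
      HasOrder (localRing P : Subring K) h 0)
    {p q : MvPolynomial (Fin d) ℂ} (hp : p ≠ 0) (hpq : ∀ f, Prime f → f ∣ p → ¬ f ∣ q)
    (hiff : ∀ s t : cyclicQuotient r a, h * algebraMap _ K s = algebraMap _ K t →
      p * (s : MvPolynomial (Fin d) ℂ) = q * t) :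
    MvPolynomial.constantCoeff p ≠ 0 := by
  intro hc
  obtain ⟨f, hf, hfp, hf0⟩ : ∃ f, Prime f ∧ f ∣ p ∧ MvPolynomial.constantCoeff f = 0 := by
    clear hpq hiff
    induction p using UniqueFactorizationMonoid.induction_on_prime with
    | h₁ => exact absurd rfl hp
    | h₂ u hu => exact absurd hc (hu.map (MvPolynomial.constantCoeff)).ne_zero
    | h₃ t q ht hq ih =>
      rw [map_mul] at hc
      rcases mul_eq_zero.1 hc with h | h
      · exact ⟨q, hq, dvd_mul_right _ _, h⟩
      · obtain ⟨f, hf, hft, hf0⟩ := ih ht h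
        exact ⟨f, hf, hft.mul_left _, hf0⟩
  have hprime : (Ideal.span {f}).IsPrime := (Ideal.span_singleton_prime hf.ne_zero).2 hf
  have hle : (contract (Ideal.span {f}) : PrimeSpectrum (cyclicQuotient r a)) ≤ origin r a := by
    intro g hg
    rw [mem_contract, Ideal.mem_span_singleton] at hg
    obtain ⟨e, he⟩ := hg
    rw [origin, RingHom.mem_ker]
    change MvPolynomial.constantCoeff g.1 = 0
    rw [he, map_mul, hf0, zero_mul]
  have hht := height_contract_span_singleton (r := r) (a := a) hf
  have : IsDiscreteValuationRing
      (localRing (contract (Ideal.span {f}) : PrimeSpectrum (cyclicQuotient r a)) : Subring K) :=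
    isDiscreteValuationRing_localRing hht
  have h1 := hasOrder_zero_iff.1 (hord _ hht hle)
  obtain ⟨t, s, hs, hst⟩ := h1.2.2
  have hs0 : s ≠ 0 := fun h => hs (h ▸ Ideal.zero_mem _)
  have h2 : h * algebraMap _ K t = algebraMap _ K s := by
    rw [← hst, mul_inv_cancel_left₀ h0]
  have h3 := hiff _ _ h2
  apply hs
  rw [mem_contract, Ideal.mem_span_singleton]
  have h4 : f ∣ q * s := h3 ▸ hfp.mul_right _
  exact (hf.dvd_or_dvd h4).resolve_left (hpq f hf hfp)

/-- The reduced denominator q does not vanish at the origin. Multiplying numerator and denominator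
by the other conjugates of q makes both invariant. -/
lemma mem_localRing_origin_of_hasOrder {h : K} (h0 : h ≠ 0)
    (hord : ∀ P : PrimeSpectrum (cyclicQuotient r a), P.asIdeal.height = 1 → P ≤ origin r a →
      HasOrder (localRing P : Subring K) h 0) :
    h ∈ (localRing (origin r a) : Subring K) := by
  obtain ⟨p, q, hp, hq, hpq, hiff⟩ := exists_coprime_eq (r := r) (a := a) h h0
  have hc : MvPolynomial.constantCoeff q ≠ 0 := by
    refine constantCoeff_ne_zero_of_hasOrder (h := h⁻¹) (inv_ne_zero h0)
      (fun P h1 h2 => by simpa using (hord P h1 h2).inv) hq (p := q) (q := p)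
      (fun f hf h1 h2 => hpq f hf h2 h1) fun s t hst => ?_
    refine ((hiff t s).1 ?_).symm
    rw [← hst, mul_inv_cancel_left₀ h0]
  obtain ⟨g, hg⟩ := exists_coe_norm_eq (r := r) (a := a) q
  have hN : norm r a q ∉ (origin r a).asIdeal := by
    rw [origin, RingHom.mem_ker]
    change ¬ MvPolynomial.constantCoeff (norm r a q).1 = 0
    rw [constantCoeff_norm]
    exact pow_ne_zero _ hc
  have hN0 : norm r a q ≠ 0 := norm_ne_zero hq
  obtain ⟨s, t, hs, ht⟩ : ∃ s t : cyclicQuotient r a, s ≠ 0 ∧ h * algebraMap _ K s = algebraMap _ K t := by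
    obtain ⟨f, g, hg, rfl⟩ := IsFractionRing.div_surjective (A := cyclicQuotient r a) h
    refine ⟨g, f, nonZeroDivisors.ne_zero hg, ?_⟩
    rw [div_mul_cancel₀ _ (algebraMap_ne_zero (nonZeroDivisors.ne_zero hg))]
  have h1 := (hiff s t).1 ht
  have h2 : (p * g) * (s : MvPolynomial (Fin d) ℂ) = (norm r a q : MvPolynomial (Fin d) ℂ) * t := by
    rw [hg]; linear_combination g * h1
  have hinv : p * g ∈ cyclicQuotient r a := fun ζ hζ => by
    have h3 := congrArg (diagonalAction a ζ) h2
    rw [map_mul, s.2 ζ hζ, map_mul (diagonalAction a ζ) (norm r a q).1, (norm r a q).2 ζ hζ,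
      t.2 ζ hζ, ← h2] at h3
    exact mul_right_cancel₀ (fun h => hs (Subtype.ext h)) h3
  refine ⟨⟨p * g, hinv⟩, norm r a q, hN, (hiff _ _).2 ?_⟩
  rw [hg]; ring

lemma hasOrder_zero_of_center_eq_origin {h : K} (h0 : h ≠ 0)
    (hord : ∀ P : PrimeSpectrum (cyclicQuotient r a), P.asIdeal.height = 1 → P ≤ origin r a →
      HasOrder (localRing P : Subring K) h 0)
    {E : PrimeDivisorOver (cyclicQuotient r a) K} (hE : E.center = origin r a) :
    HasOrder E.valuationRing h 0 := by
  have := E.isDiscreteValuationRing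
  refine hasOrder_zero_iff.2 ⟨h0, E.localRing_le ?_, E.localRing_le ?_⟩
  · rw [hE]; exact mem_localRing_origin_of_hasOrder h0 hord
  · rw [hE]
    exact mem_localRing_origin_of_hasOrder (inv_ne_zero h0) fun P h1 h2 => by
      simpa using (hord P h1 h2).inv

variable [Algebra ℂ K]

/-- The invariant form has at most a simple pole along a divisor. -/
lemma exists_smul_logForm_mem (R : Subring K) [IsDiscreteValuationRing R]
    {w : weightLattice r a →ₗ[ℤ] ℤ} (hw : ∀ m, HasOrder R (laurent K m) (w m)) (hw0 : w ≠ 0) :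
    ∃ (b : Module.Basis (Fin d) ℤ (weightLattice r a)) (t : R), Irreducible t ∧
      (t : K) • logForm K b ∈ regularForms R d := by
  obtain ⟨k, hk, w', hsurj, rfl⟩ := exists_eq_smul_surjective w hw0
  obtain ⟨b, i₀, h1, h2⟩ := exists_adapted_basis w' hsurj
  obtain ⟨t, ht⟩ := IsDiscreteValuationRing.exists_irreducible R
  refine ⟨b, t, ht, ?_⟩
  have ht0 : (t : K) ≠ 0 := by simpa using ht.ne_zero
  have hD : ∀ f ∈ R, KaehlerDifferential.D ℂ K f ∈
      Submodule.span R (Set.range fun f : R => KaehlerDifferential.D ℂ K (f : K)) :=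
    fun f hf => Submodule.subset_span ⟨⟨f, hf⟩, rfl⟩
  have hsmul : (t : K) • logForm K b = exteriorPower.ιMulti K d
      (Function.update (fun j => dlog K (b j)) i₀ ((t : K) • dlog K (b i₀))) := by
    rw [AlternatingMap.map_update_smul, Function.update_eq_self]; rfl
  rw [hsmul]
  refine ιMulti_mem_regularForms fun j => ?_
  by_cases hj : j = i₀
  · subst hj
    rw [Function.update_self, dlog_apply]
    obtain ⟨u, hu⟩ := (hw (b j)).exists_eq ht
    have hk' : (k • w') (b j) = k := by simp [h1]
    rw [hk'] at hu
    obtain ⟨n, rfl⟩ := Int.eq_ofNat_of_zero_le hk.le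
    rw [zpow_natCast] at hu
    have hu0 : ((u : R) : K) ≠ 0 := by simp
    -- For a monomial u tⁿ one has t dlog(u tⁿ) = n dt + u⁻¹ t du, which is regular. The logarithmic
    -- differentials of the other basis monomials are regular because these are units.
    have : (t : K) • (laurent K (b j))⁻¹ • KaehlerDifferential.D ℂ K (laurent K (b j)) =
        (n : K) • (KaehlerDifferential.D ℂ K (t : K)) +
        ((((u⁻¹ : Rˣ) : R) * t : R) : K) • (KaehlerDifferential.D ℂ K ((u : R) : K)) := by
      rw [hu, Derivation.leibniz, Derivation.leibniz_pow, smul_add, smul_add]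
      congr 1
      · rw [← Nat.cast_smul_eq_nsmul K, smul_smul, smul_smul, smul_smul, smul_smul]
        congr 1
        have hn : (t : K) ^ n = t * t ^ (n - 1) := by
          rw [← pow_succ']; congr 1; omega
        rw [hn]
        have ht1 : (t : K) ^ (n - 1) ≠ 0 := pow_ne_zero _ ht0
        field_simp
      · rw [smul_smul, smul_smul, Subring.coe_mul, coe_units_inv]
        congr 1
        have ht1 : (t : K) ^ n ≠ 0 := pow_ne_zero _ ht0
        field_simp
    rw [this]
    refine Submodule.add_mem _ ?_
      (Submodule.smul_mem _ (((u⁻¹ : Rˣ) : R) * t) (hD _ (Subtype.property _)))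
    exact Submodule.smul_mem _ (n : R) (hD _ t.2)
  · rw [Function.update_of_ne hj, dlog_apply]
    have h3 : (k • w') (b j) = 0 := by simp [h2 j hj]
    have h4 := hasOrder_zero_iff.1 (h3 ▸ hw (b j))
    exact Submodule.smul_mem _ (⟨_, h4.2.2⟩ : R) (hD _ h4.2.1)

variable [IsScalarTower ℂ (cyclicQuotient r a) K]

/-- The given canonical data ω, g are compared with the toric ones. Writing ω = f · (log form), the
simple-pole bound gives ord f ≤ 1 + ord ω, and the two local equations differ by the corresponding
power of f and a unit near the origin. -/
lemma exists_toricDiscrepancy_le (i : Fin d) {E : PrimeDivisorOver (cyclicQuotient r a) K}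
    (hE : E.center = origin r a) {μ : ℚ} (hμ : IsLogDiscrepancy d (origin r a) E μ) :
    ∃ w : weightLattice r a →ₗ[ℤ] ℤ, (∀ i, 0 < w (ray r a i)) ∧ toricDiscrepancy r a w ≤ μ := by
  have := E.isDiscreteValuationRing
  obtain ⟨w, hw⟩ := exists_order_laurent (r := r) (a := a) E.valuationRing
  have hpos : ∀ i, 0 < w (ray r a i) := fun i => by
    have h1 : powVar r a i ∈ E.center.asIdeal := by
      rw [hE, ← facePrime_univ, powVar_mem_facePrime_iff]; trivial
    have h2 := hw (ray r a i)
    rw [ray, laurent_toInt] at h2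
    have h3 := h2.mem_iff.1 (E.localRing_le (algebraMap_mem_localRing _ _))
    have h4 := mt h2.inv.mem_iff.2 (E.inv_notMem (invMonomial_ne_zero _ _) h1)
    rw [ray]
    omega
  refine ⟨w, hpos, ?_⟩
  have hw0 : w ≠ 0 := by
    rintro rfl
    exact (hpos i).ne rfl
  obtain ⟨b, t, ht, hreg⟩ := exists_smul_logForm_mem E.valuationRing hw hw0
  obtain ⟨ω, m, g, ⟨hm, hloc⟩, k, l, hk, hl, rfl⟩ := hμ
  obtain ⟨f, rfl⟩ := exists_eq_smul_logForm (K := K) b ω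
  have hb0 := logForm_ne_zero (K := K) b
  obtain ⟨s, hs, hspan⟩ := hk
  rw [← hspan] at hreg
  obtain ⟨c, hc⟩ := Submodule.mem_span_singleton.1 hreg
  have hc' : (c : K) * ((s : K) ^ (-k) * f) = t := by
    refine smul_left_injective K hb0 ?_
    change ((c : K) * ((s : K) ^ (-k) * f)) • logForm K b = (t : K) • logForm K b
    rw [← hc, mul_smul, mul_smul]
    rfl
  have ht0 : (t : K) ≠ 0 := by simpa using ht.ne_zero
  have hf0 : f ≠ 0 := by rintro rfl; simp at hc'; exact ht0 hc'.symm
  have hc0 : (c : K) ≠ 0 := by intro h; rw [h, zero_mul] at hc'; exact ht0 hc'.symm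
  obtain ⟨n, hn⟩ := exists_hasOrder (R := E.valuationRing) hf0
  obtain ⟨e, he⟩ := exists_hasOrder (R := E.valuationRing) hc0
  have he0 := he.mem_iff.1 c.2
  have hsum := he.mul (((hasOrder_of_irreducible hs).zpow (-k)).mul hn)
  rw [hc'] at hsum
  have h1 := hsum.unique (hasOrder_of_irreducible ht)
  set g₀ : K := laurent K (-canonicalExponent r a) with hg₀
  have hg0 : g ≠ 0 := hl.ne_zero
  have hg₀0 : g₀ ≠ 0 := laurent_ne_zero _
  -- g and g₀ are equations of m K and r K for the divisors of ω and of the logarithmic form. The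
  -- powers r and m bring both to r m K, so this function has order zero at every height-one prime
  -- through the origin.
  have hunit : HasOrder E.valuationRing (g ^ r * ((f ^ (r * m))⁻¹ * (g₀ ^ m)⁻¹)) 0 := by
    refine hasOrder_zero_of_center_eq_origin ?_ (fun P hP hPx => ?_) hE
    · positivity
    · have : IsDiscreteValuationRing (localRing P : Subring K) := isDiscreteValuationRing_localRing hP
      obtain ⟨k', hk', hg'⟩ := hloc P hP hPx
      obtain ⟨k₀, hk₀, hg₀'⟩ := exists_hasFormOrder_of_height_eq_one (K := K) b hP
      have hf' := hk₀.hasOrder_smul hb0 hk'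
      convert (hg'.pow r).mul ((hf'.pow (r * m)).inv.mul (hg₀'.pow m).inv) using 1
      push_cast
      ring
  have hunit' := (hl.pow r).mul ((hn.pow (r * m)).inv.mul ((hw (-canonicalExponent r a)).pow m).inv)
  have h2 := hunit'.unique hunit
  rw [map_neg] at h2
  rw [toricDiscrepancy]
  have hr : (0 : ℚ) < r := by exact_mod_cast NeZero.pos r
  have hm' : (0 : ℚ) < m := by exact_mod_cast hm
  have h3 : (n : ℚ) ≤ 1 + k := by exact_mod_cast (by linarith : n ≤ 1 + k)
  have h4 : (r : ℚ) * l = r * m * n - m * w (canonicalExponent r a) := by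
    have h5 : (r : ℤ) * l = r * m * n - m * w (canonicalExponent r a) := by
      push_cast at h2; linarith
    exact_mod_cast h5
  have h5 : (l : ℚ) / m = n - w (canonicalExponent r a) / r := by
    field_simp
    linarith
  rw [h5]
  linarith

-- The lower bound holds for every divisor. For attainment, the minimizing vector must be primitive,
-- since a proper divisor of it would have smaller discrepancy.
variable (K) in
theorem isMld_of_isLeast (i : Fin d) {μ : ℚ}
    (h : IsLeast {q : ℚ | ∃ w : weightLattice r a →ₗ[ℤ] ℤ, (∀ i, 0 < w (ray r a i)) ∧
      toricDiscrepancy r a w = q} μ) :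
    IsMld K d (origin r a) μ := by
  obtain ⟨⟨w, hw, rfl⟩, hmin⟩ := h
  constructor
  · have hw0 : w ≠ 0 := by
      rintro rfl
      exact (hw i).ne rfl
    obtain ⟨k, hk, w', hsurj, rfl⟩ := exists_eq_smul_surjective w hw0
    have hw' : ∀ i, 0 < w' (ray r a i) := fun i => by
      have := hw i
      rw [LinearMap.smul_apply, smul_eq_mul] at this
      exact pos_of_mul_pos_right this hk.le
    have h1 : toricDiscrepancy r a (k • w') ≤ toricDiscrepancy r a w' := hmin ⟨w', hw', rfl⟩
    have h2 : toricDiscrepancy r a (k • w') = k * toricDiscrepancy r a w' := by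
      rw [toricDiscrepancy, toricDiscrepancy, LinearMap.smul_apply, smul_eq_mul]
      push_cast; ring
    have h3 : 0 < toricDiscrepancy r a w' := by
      refine div_pos ?_ (by exact_mod_cast NeZero.pos r)
      have : 0 < w' (canonicalExponent r a) := by
        rw [canonicalExponent, map_sum]
        refine Finset.sum_pos (fun i _ => ?_) ⟨i, Finset.mem_univ i⟩
        rw [map_smul, smul_eq_mul]
        exact mul_pos (coordGen_pos i) (hw' i)
      exact_mod_cast this
    have h4 : k = 1 := by
      rw [h2] at h1
      have : (k : ℚ) ≤ 1 := by
        by_contra! h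
        nlinarith
      have : k ≤ 1 := by exact_mod_cast this
      omega
    subst h4
    rw [one_smul]
    exact exists_isLogDiscrepancy K w' hsurj hw'
  · rintro q ⟨E, hE, hq⟩
    obtain ⟨w', hw', hle⟩ := exists_toricDiscrepancy_le i hE hq
    exact (hmin ⟨w', hw', rfl⟩).trans hle

end LowerBound
-- Few generators for the maximal ideal of a regular local ring.
section Generators

universe u

open IsLocalRing in
/-- The maximal ideal of a regular local ring of dimension at most `n` is generated by at most `n`
elements of any given set of generators. -/
lemma exists_generators_of_isRegularLocalRing {B : Type*} [CommRing B] [IsRegularLocalRing B]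
    {n : ℕ} (hn : ringKrullDim B ≤ n) {ι : Type u} (v : ι → B)
    (hv : Ideal.span (Set.range v) = maximalIdeal B) :
    ∃ (κ : Type u) (_ : Fintype κ) (e : κ → ι), Fintype.card κ ≤ n ∧
      Ideal.span (Set.range (v ∘ e)) = maximalIdeal B := by
  have hmem (i : ι) : v i ∈ maximalIdeal B := hv ▸ Ideal.subset_span ⟨i, rfl⟩
  let v' : ι → maximalIdeal B := fun i => ⟨v i, hmem i⟩
  have key (κ : Type u) (e : κ → ι) : Ideal.span (Set.range (v ∘ e)) = maximalIdeal B ↔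
      Submodule.span B (Set.range (v' ∘ e)) = ⊤ := by
    rw [← (Submodule.map_injective_of_injective (maximalIdeal B).injective_subtype).eq_iff,
      Submodule.map_span, ← Set.range_comp, Submodule.map_top, Submodule.range_subtype]
    rfl
  -- Select generators whose classes form a basis of the cotangent space; Nakayama's lemma lifts
  -- them back to generators.
  obtain ⟨κ, e, -, hspan, hind⟩ := exists_linearIndependent' (ResidueField B)
    fun i => (maximalIdeal B).toCotangent (v' i)
  have htop : Submodule.span (ResidueField B)
      (Set.range fun i => (maximalIdeal B).toCotangent (v' i)) = ⊤ := by
    have := (key ι id).1 hv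
    rwa [Function.comp_id, ← CotangentSpace.span_image_eq_top_iff, ← Set.range_comp] at this
  have hfin : Finite κ := hind.finite_of_isNoetherian
  have := Fintype.ofFinite κ
  refine ⟨κ, this, e, ?_, (key κ e).2 ?_⟩
  · have h1 := hind.fintype_card_le_finrank
    have h2 := (IsRegularLocalRing.iff_finrank_cotangentSpace B).1 inferInstance
    rw [← h2] at hn
    exact h1.trans (by exact_mod_cast hn)
  · rw [← CotangentSpace.span_image_eq_top_iff, ← Set.range_comp]
    rw [htop] at hspan
    exact hspan

lemma exists_generators_of_isRegularLocalRing_atPrime {A : Type*} [CommRing A] [IsDomain A]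
    (p : Ideal A) [p.IsPrime] [IsRegularLocalRing (Localization.AtPrime p)] {n : ℕ}
    (hn : p.height ≤ n) {ι : Type u} (v : ι → A) (hv : Ideal.span (Set.range v) = p) :
    ∃ (κ : Type u) (_ : Fintype κ) (e : κ → ι), Fintype.card κ ≤ n ∧
      ∀ x ∈ p, ∃ s ∉ p, x * s ∈ Ideal.span (Set.range (v ∘ e)) := by
  have hdim : ringKrullDim (Localization.AtPrime p) ≤ n := by
    rw [IsLocalization.AtPrime.ringKrullDim_eq_height p]
    exact_mod_cast hn
  obtain ⟨κ, hκ, e, hcard, hspan⟩ := exists_generators_of_isRegularLocalRing hdim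
    (fun i => algebraMap A (Localization.AtPrime p) (v i)) (by
      rw [← Localization.AtPrime.map_eq_maximalIdeal]
      refine Eq.trans ?_ (congrArg (Ideal.map (algebraMap A (Localization.AtPrime p))) hv)
      rw [Ideal.map_span, ← Set.range_comp]
      rfl)
  refine ⟨κ, hκ, e, hcard, fun x hx => ?_⟩
  have h1 : algebraMap A (Localization.AtPrime p) x ∈
      Ideal.map (algebraMap A (Localization.AtPrime p)) (Ideal.span (Set.range (v ∘ e))) := by
    rw [Ideal.map_span, ← Set.range_comp]
    change _ ∈ Ideal.span (Set.range ((fun i => algebraMap A (Localization.AtPrime p) (v i)) ∘ e))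
    rw [hspan, ← Localization.AtPrime.map_eq_maximalIdeal]
    exact Ideal.mem_map_of_mem _ hx
  obtain ⟨⟨y, s⟩, hys⟩ := (IsLocalization.mem_map_algebraMap_iff p.primeCompl _).1 h1
  rw [← map_mul] at hys
  refine ⟨s, s.2, ?_⟩
  rw [IsLocalization.injective (Localization.AtPrime p) p.primeCompl_le_nonZeroDivisors hys]
  exact y.2

end Generators

/-! ### Singular generic points of faces. -/

section Nonregular

variable {d : ℕ} {r : ℕ} {a : Fin d → ℤ} [NeZero r]

/-- The prime of the face is minimal over the powers xᵢ ^ r with i ∈ F, so Krull's height theorem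
applies. -/
lemma height_facePrime_le (F : Finset (Fin d)) :
    (facePrime r a F).asIdeal.height ≤ F.card := by
  classical
  have h := Ideal.height_le_card_of_mem_minimalPrimes_span_finset
    (p := (facePrime r a F).asIdeal) (s := F.image (powVar r a)) ?_
  · exact h.trans (by exact_mod_cast Finset.card_image_le)
  · refine ⟨⟨(facePrime r a F).isPrime, Ideal.span_le.2 ?_⟩, fun q hq _ => ?_⟩
    · intro x hx
      obtain ⟨i, hi, rfl⟩ := Finset.mem_image.1 (Finset.mem_coe.1 hx)
      exact powVar_mem_facePrime_iff.2 hi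
    · exact facePrime_le (p := ⟨q, hq.1⟩) fun i hi => hq.2
        (Ideal.subset_span (Finset.mem_coe.2 (Finset.mem_image_of_mem _ hi)))

/-- The exponents of the invariant monomials that vanish on the face `F`. -/
def faceExponents (r : ℕ) (a : Fin d → ℤ) (F : Finset (Fin d)) : Type :=
  {u : Fin d →₀ ℕ // toInt u ∈ weightLattice r a ∧ ∃ i ∈ F, u i ≠ 0}

lemma span_faceExponents (F : Finset (Fin d)) :
    Ideal.span (Set.range fun u : faceExponents r a F => invMonomial u.1 u.2.1) =
      (facePrime r a F).asIdeal := by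
  apply le_antisymm
  · rw [Ideal.span_le]
    rintro _ ⟨u, rfl⟩
    exact invMonomial_mem_facePrime_iff.2 u.2.2
  · intro f hf
    refine mem_of_forall_invMonomial_mem _ f fun u hu hc => Ideal.subset_span ?_
    exact ⟨⟨u, hu, mem_facePrime_iff.1 hf u hc⟩, rfl⟩

/-- If every invariant monomial vanishing on `F` is, up to a unit at the generic point of the face,
in the ideal generated by some of them, then their restrictions to `F` generate all others. -/
lemma exists_sum_eq_of_mem_span (F : Finset (Fin d)) {κ : Type*} [Fintype κ]
    (e : κ → faceExponents r a F)
    (he : ∀ x ∈ (facePrime r a F).asIdeal, ∃ s ∉ (facePrime r a F).asIdeal,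
      x * s ∈ Ideal.span (Set.range fun k => invMonomial (e k).1 (e k).2.1))
    (u : Fin d →₀ ℕ) (hu : toInt u ∈ weightLattice r a) :
    ∃ c : κ → ℕ, ∀ i ∈ F, u i = ∑ k, c k * (e k).1 i := by
  classical
  induction hN : ∑ i ∈ F, u i using Nat.strong_induction_on generalizing u with
  | _ N ih =>
  by_cases h0 : ∃ i ∈ F, u i ≠ 0
  swap
  · push Not at h0
    exact ⟨0, fun i hi => by simp [h0 i hi]⟩
  obtain ⟨s, hs, hus⟩ := he (invMonomial u hu) (invMonomial_mem_facePrime_iff.2 h0)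
  -- The multiplier s has a monomial v free of the variables in F. Comparing coefficients at u + v
  -- shows that some generator divides that monomial, and the quotient has smaller degree in the
  -- variables of F.
  obtain ⟨v, hv, hvF⟩ : ∃ v, s.1.coeff v ≠ 0 ∧ ∀ i ∈ F, v i = 0 := by
    rw [mem_facePrime_iff] at hs
    push Not at hs
    exact hs
  rw [Ideal.mem_span_range_iff_exists_fun] at hus
  obtain ⟨c, hc⟩ := hus
  have hcoeff : (∑ k, c k * invMonomial (e k).1 (e k).2.1 : cyclicQuotient r a).1.coeff (u + v) ≠ 0 := by
    rw [hc, MulMemClass.coe_mul, coe_invMonomial, MvPolynomial.coeff_monomial_mul, one_mul]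
    exact hv
  rw [AddSubmonoidClass.coe_finsetSum, MvPolynomial.coeff_sum] at hcoeff
  obtain ⟨k, -, hk⟩ := Finset.exists_ne_zero_of_sum_ne_zero hcoeff
  rw [MulMemClass.coe_mul, coe_invMonomial, MvPolynomial.coeff_mul_monomial', mul_one] at hk
  have hle : (e k).1 ≤ u + v := by
    by_contra h
    rw [if_neg h] at hk
    exact hk rfl
  rw [if_pos hle] at hk
  have hmem := mem_cyclicQuotient_iff.1 (c k).2 _ hk
  have hval (i : Fin d) (hi : i ∈ F) : u i = (u + v - (e k).1) i + (e k).1 i := by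
    have h1 := hle i
    rw [Finsupp.add_apply, hvF i hi, add_zero] at h1
    rw [Finsupp.tsub_apply, Finsupp.add_apply, hvF i hi]
    omega
  obtain ⟨c', hc'⟩ := ih (∑ i ∈ F, (u + v - (e k).1) i) (by
    rw [← hN]
    obtain ⟨i, hi, hi0⟩ := (e k).2.2
    refine Finset.sum_lt_sum (fun j hj => ?_) ⟨i, hi, ?_⟩
    · have := hval j hj; omega
    · have := hval i hi; omega) _ hmem rfl
  refine ⟨fun j => c' j + if j = k then 1 else 0, fun i hi => ?_⟩
  rw [hval i hi, hc' i hi]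
  simp [add_mul, Finset.sum_add_distrib]

/-- The generic point of a face is singular as soon as some lattice vector lies in the interior of
the unit cube of that face. -/
theorem not_isRegularLocalRing_facePrime (F : Finset (Fin d)) (hF : F.Nonempty)
    (w : weightLattice r a →ₗ[ℤ] ℤ)
    (hw : ∀ i ∈ F, 0 < w (ray r a i) ∧ coordGen r a i * w (ray r a i) < r)
    (hw0 : ∀ i ∉ F, w (ray r a i) = 0) :
    ¬ IsRegularLocalRing (Localization.AtPrime (facePrime r a F).asIdeal) := by
  classical
  intro hreg
  obtain ⟨κ, hκ, e, hcard, he⟩ := exists_generators_of_isRegularLocalRing_atPrime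
    (facePrime r a F).asIdeal (height_facePrime_le F)
    (fun u : faceExponents r a F => invMonomial u.1 u.2.1) (span_faceExponents F)
  have hgen := exists_sum_eq_of_mem_span F e he
  -- Restricted to F, the exponent of xᵢ ^ r lies on the i-th axis. Exponents are nonnegative, so a
  -- generator occurring in it also lies there. This gives |F| distinct generators, one per axis,
  -- and regularity allows no others.
  have haxis (i : F) : ∃ k, ∀ j ∈ F, j ≠ i → (e k).1 j = 0 := by
    obtain ⟨c, hc⟩ := hgen _ (single_mem_weightLattice i.1)
    have h1 := hc i i.2
    rw [Finsupp.single_eq_same] at h1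
    obtain ⟨k, -, hk⟩ := Finset.exists_ne_zero_of_sum_ne_zero (h1 ▸ NeZero.ne r)
    refine ⟨k, fun j hj hji => ?_⟩
    have h2 := hc j hj
    rw [Finsupp.single_eq_of_ne hji] at h2
    have h3 := Finset.sum_eq_zero_iff.1 h2.symm k (Finset.mem_univ k)
    exact (Nat.mul_eq_zero.1 h3).resolve_left (left_ne_zero_of_mul hk)
  choose k hk using haxis
  have hpos (i : F) : (e (k i)).1 i ≠ 0 := by
    obtain ⟨j, hj, hj0⟩ := (e (k i)).2.2
    by_cases hji : j = i
    · rwa [← hji]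
    · exact absurd (hk i j hj hji) hj0
  have hinj : Function.Injective k := fun i j hij => by
    by_contra h
    refine hpos i ?_
    rw [hij]
    exact hk j i i.2 fun h' => h (Subtype.ext h')
  have hsurj : Function.Surjective k := by
    refine ((Fintype.bijective_iff_injective_and_card k).2 ⟨hinj, ?_⟩).2
    exact le_antisymm (Fintype.card_le_of_injective k hinj) (by simpa using hcard)
  obtain ⟨i, hi⟩ := hF
  obtain ⟨m, hm⟩ := primCoord_surjective (r := r) (a := a) i 1
  have hmi := coordGen_mul_primCoord i m
  rw [hm, mul_one] at hmi
  obtain ⟨u, v, hu, -, huv, hv0⟩ := exists_decomposition m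
  have hui : (u i : ℤ) = coordGen r a i := by
    have h1 := congrFun huv i
    rw [Pi.add_apply, toInt_apply, toInt_apply, hv0 i (hmi ▸ (coordGen_pos i).le), ← hmi] at h1
    simpa using h1.symm
  obtain ⟨c, hc⟩ := hgen u hu
  set q : weightLattice r a := ⟨toInt (e (k ⟨i, hi⟩)).1, (e (k ⟨i, hi⟩)).2.1⟩ with hq
  -- Some monomial has i-th exponent `coordGen`, and only the generator on axis i contributes to
  -- that exponent.
  have hdvd : ((e (k ⟨i, hi⟩)).1 i : ℤ) ∣ coordGen r a i := by
    rw [← hui, hc i hi]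
    push_cast
    refine Finset.dvd_sum fun l _ => ?_
    obtain ⟨j, rfl⟩ := hsurj l
    by_cases hji : j = ⟨i, hi⟩
    · rw [hji]; exact dvd_mul_left _ _
    · rw [hk j i hi fun h => hji (Subtype.ext h.symm)]
      simp
  have hqi : q.1 i = coordGen r a i := by
    have h1 := coordGen_mul_primCoord i q
    have h2 : coordGen r a i ∣ q.1 i := ⟨_, h1.symm⟩
    exact Int.dvd_antisymm (by simp [hq]) (coordGen_pos i).le hdvd h2
  -- Only the i-th ray contributes, so r w(q) = coordGen · w(ray i) lies strictly between 0 and r,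
  -- which is impossible for an integer w(q).
  have h1 := mul_apply_eq_sum w q
  rw [Finset.sum_eq_single i, hqi] at h1
  · have h2 := hw i hi
    have h3 := mul_pos (coordGen_pos (r := r) (a := a) i) h2.1
    have hr : (0 : ℤ) < r := by exact_mod_cast NeZero.pos r
    have h4 : 0 < w q := by
      by_contra! h
      nlinarith
    nlinarith
  · intro j _ hji
    by_cases hj : j ∈ F
    · have : q.1 j = 0 := by
        rw [hq]; simpa using hk ⟨i, hi⟩ j hj hji
      rw [this, zero_mul]
    · rw [hw0 j hj, mul_zero]
  · simp

end Nonregular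
-- Regularity away from the origin.
section Regular

/-- T and A agree after π is inverted, so the local rings at primes avoiding π agree too. -/
lemma isRegularLocalRing_of_injective {T A : Type*} [CommRing T] [CommRing A] [IsDomain A]
    [IsRegularRing T] (φ : T →+* A) (hφ : Function.Injective φ) (p : Ideal A) [p.IsPrime] (π : T)
    (hπ : φ π ∉ p) (h : ∀ f : A, ∃ (n : ℕ) (t : T), f * φ π ^ n = φ t) :
    IsRegularLocalRing (Localization.AtPrime p) := by
  let : Algebra T (Localization.AtPrime p) :=
    ((algebraMap A (Localization.AtPrime p)).comp φ).toAlgebra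
  have hmap (t : T) : algebraMap T (Localization.AtPrime p) t =
      algebraMap A (Localization.AtPrime p) (φ t) := rfl
  have hpow (n : ℕ) : φ π ^ n ∉ p := fun h => hπ (Ideal.IsPrime.mem_of_pow_mem ‹_› n h)
  have : IsLocalization.AtPrime (Localization.AtPrime p) (p.comap φ) :=
    { map_units := fun t => IsLocalization.map_units (Localization.AtPrime p)
        (⟨φ t, t.2⟩ : p.primeCompl)
      surj := fun z => by
        obtain ⟨⟨f, s⟩, hfs⟩ := IsLocalization.surj p.primeCompl z
        obtain ⟨n, t, ht⟩ := h f
        obtain ⟨m, t', ht'⟩ := h s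
        refine ⟨⟨t * π ^ m, ⟨t' * π ^ n, fun hmem => ?_⟩⟩, ?_⟩
        · have h1 : φ (t' * π ^ n) ∈ p := hmem
          rw [map_mul, ← ht', map_pow] at h1
          exact (Ideal.IsPrime.mem_or_mem ‹_› h1).elim (fun h2 =>
            (Ideal.IsPrime.mem_or_mem ‹_› h2).elim s.2 (hpow m)) (hpow n)
        · change z * algebraMap T _ (t' * π ^ n) = algebraMap T _ (t * π ^ m)
          change z * algebraMap A _ s = algebraMap A _ f at hfs
          rw [hmap, hmap, map_mul φ, map_mul φ, ← ht, ← ht']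
          simp only [map_mul, map_pow]
          rw [← hfs]
          ring
      exists_of_eq := fun {x y} hxy => ⟨1, by
        rw [hφ (IsLocalization.injective (Localization.AtPrime p)
          p.primeCompl_le_nonZeroDivisors hxy)]⟩ }
  exact IsRegularLocalRing.of_ringEquiv (IsLocalization.algEquiv (p.comap φ).primeCompl
    (Localization.AtPrime (p.comap φ)) (Localization.AtPrime p)).toRingEquiv

variable {d : ℕ} {r : ℕ} {a : Fin d → ℤ} [NeZero r]

lemma coe_aeval_invMonomial_monomial (v : Fin d → Fin d →₀ ℕ)
    (hv : ∀ j, toInt (v j) ∈ weightLattice r a) (α : Fin d →₀ ℕ) (c : ℂ) :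
    (MvPolynomial.aeval (fun j => invMonomial (v j) (hv j)) (MvPolynomial.monomial α c)).1 =
      MvPolynomial.monomial (∑ j, α j • v j) c := by
  rw [MvPolynomial.aeval_monomial, Finsupp.prod_fintype _ _ (by simp), MulMemClass.coe_mul,
    SubmonoidClass.coe_finsetProd]
  simp only [SubmonoidClass.coe_pow, coe_invMonomial, MvPolynomial.monomial_pow, one_pow]
  rw [← MvPolynomial.monomial_sum_one]
  change MvPolynomial.C c * _ = _
  rw [MvPolynomial.C_mul_monomial, mul_one]

lemma coeff_aeval_invMonomial (v : Fin d → Fin d →₀ ℕ) (hv : ∀ j, toInt (v j) ∈ weightLattice r a)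
    (hinj : Function.Injective fun α : Fin d →₀ ℕ => ∑ j, α j • v j) (f : MvPolynomial (Fin d) ℂ)
    (α : Fin d →₀ ℕ) :
    (MvPolynomial.aeval (fun j => invMonomial (v j) (hv j)) f).1.coeff (∑ j, α j • v j) =
      f.coeff α := by
  induction f using MvPolynomial.induction_on' with
  | monomial β c =>
    rw [coe_aeval_invMonomial_monomial, MvPolynomial.coeff_monomial, MvPolynomial.coeff_monomial]
    simp only [hinj.eq_iff (a := β) (b := α)]
  | add f g hf hg =>
    rw [map_add, AddMemClass.coe_add, MvPolynomial.coeff_add, hf, hg, MvPolynomial.coeff_add]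

/-- Once xᵢ ^ r is inverted, the invariants are generated by its powers and the elements xⱼ xᵢ ^ cⱼ,
with cⱼ solving aⱼ + aᵢ cⱼ ≡ 0 modulo r. These invariants are algebraically independent. -/
theorem isRegularLocalRing_of_powVar_notMem (i : Fin d) (hi : IsCoprime (a i) (r : ℤ))
    (p : PrimeSpectrum (cyclicQuotient r a)) (hp : powVar r a i ∉ p.asIdeal) :
    IsRegularLocalRing (Localization.AtPrime p.asIdeal) := by
  classical
  have hc (j : Fin d) : ∃ c : ℕ, (r : ℤ) ∣ a j + a i * c := by
    obtain ⟨s, t, hst⟩ := hi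
    have hr : (r : ℤ) ≠ 0 := by exact_mod_cast NeZero.ne r
    refine ⟨((-(s * a j)) % r).toNat, ?_⟩
    rw [Int.toNat_of_nonneg (Int.emod_nonneg _ hr)]
    have h1 := Int.emod_add_mul_ediv (-(s * a j)) r
    refine ⟨a j * t - a i * (-(s * a j) / r), ?_⟩
    linear_combination a i * h1 - a j * hst
  choose c hc using hc
  let v (j : Fin d) : Fin d →₀ ℕ := if j = i then Finsupp.single i r else
    Finsupp.single j 1 + Finsupp.single i (c j)
  have hvi : v i = Finsupp.single i r := if_pos rfl
  have hvj {j : Fin d} (h : j ≠ i) : v j = Finsupp.single j 1 + Finsupp.single i (c j) := if_neg h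
  have hv (j : Fin d) : toInt (v j) ∈ weightLattice r a := by
    by_cases h : j = i
    · subst h; rw [hvi]; exact single_mem_weightLattice j
    · rw [hvj h, mem_weightLattice]
      convert hc j using 1
      simp [Finsupp.single_apply, mul_add, Finset.sum_add_distrib]
  have hval (α : Fin d →₀ ℕ) {j : Fin d} (h : j ≠ i) : (∑ l, α l • v l) j = α j := by
    rw [Finsupp.finsetSum_apply, Finset.sum_eq_single j]
    · rw [Finsupp.smul_apply, hvj h]; simp [h]
    · intro l _ hl
      by_cases hli : l = i
      · rw [hli, hvi]; simp [h]
      · rw [hvj hli]; simp [h, Ne.symm hl]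
    · simp
  have hvali (α : Fin d →₀ ℕ) : (∑ l, α l • v l) i =
      α i * r + ∑ l ∈ Finset.univ.erase i, α l * c l := by
    rw [Finsupp.finsetSum_apply, ← Finset.add_sum_erase _ _ (Finset.mem_univ i)]
    congr 1
    · rw [hvi]; simp
    · refine Finset.sum_congr rfl fun l hl => ?_
      have hli := Finset.ne_of_mem_erase hl
      rw [hvj hli]; simp [hli]
  have hinj : Function.Injective fun α : Fin d →₀ ℕ => ∑ j, α j • v j := fun α β hαβ => by
    change ∑ l, α l • v l = ∑ l, β l • v l at hαβ
    have h1 (j : Fin d) (h : j ≠ i) : α j = β j := by rw [← hval α h, hαβ, hval β h]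
    ext j
    by_cases h : j = i
    · subst h
      have h2 := hvali α
      have h3 : ∑ l ∈ Finset.univ.erase j, α l * c l = ∑ l ∈ Finset.univ.erase j, β l * c l :=
        Finset.sum_congr rfl fun l hl => by rw [h1 l (Finset.ne_of_mem_erase hl)]
      rw [hαβ, hvali β, h3] at h2
      exact Nat.eq_of_mul_eq_mul_right (NeZero.pos r) (Nat.add_right_cancel h2.symm)
    · exact h1 j h
  let φ := MvPolynomial.aeval (R := ℂ) fun j => invMonomial (v j) (hv j)
  have hφX : φ (MvPolynomial.X i) = powVar r a i := by
    rw [MvPolynomial.aeval_X, powVar]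
    exact invMonomial_congr hvi _
  refine isRegularLocalRing_of_injective φ.toRingHom ?_ p.asIdeal (MvPolynomial.X i) ?_ ?_
  · refine (injective_iff_map_eq_zero _).2 fun f hf => ?_
    ext α
    rw [← coeff_aeval_invMonomial v hv hinj f α]
    change (φ f).1.coeff _ = _
    change φ f = 0 at hf
    rw [hf]; simp
  · change φ _ ∉ _
    rwa [hφX]
  · change ∀ f, ∃ (n : ℕ) (t : MvPolynomial (Fin d) ℂ), f * φ (MvPolynomial.X i) ^ n = φ t
    intro f
    induction f using cyclicQuotient_induction with
    | hmon u hu e =>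
      set N : ℕ := ∑ l ∈ Finset.univ.erase i, u l * c l with hN
      have hdvd : (r : ℤ) ∣ u i - N := by
        refine hi.symm.dvd_of_dvd_mul_left ?_
        have h1 : (r : ℤ) ∣ ∑ l ∈ Finset.univ.erase i, (a l + a i * c l) * u l :=
          Finset.dvd_sum fun l _ => (hc l).mul_right _
        have h2 := dvd_sub (mem_weightLattice.1 hu) h1
        rw [← Finset.add_sum_erase _ _ (Finset.mem_univ i), add_sub_assoc,
          ← Finset.sum_sub_distrib] at h2
        convert h2 using 1
        rw [mul_sub, sub_eq_add_neg, hN]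
        push_cast
        rw [Finset.mul_sum, ← Finset.sum_neg_distrib]
        congr 1
        refine Finset.sum_congr rfl fun l _ => ?_
        rw [toInt_apply]; ring
      have hr : 1 ≤ r := NeZero.pos r
      -- N is the power of xᵢ used up by the factors xₗ xᵢ ^ cₗ. Multiplying by the N-th power of xᵢ
      -- ^ r keeps the remaining exponent k of xᵢ ^ r nonnegative.
      obtain ⟨k, hk⟩ : ∃ k : ℕ, u i + N * r = k * r + N := by
        obtain ⟨k, hk⟩ := hdvd
        have h1 : (0 : ℤ) < r := by exact_mod_cast hr
        have h2 : 0 ≤ k + N := by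
          by_contra! h
          nlinarith
        refine ⟨(k + N).toNat, ?_⟩
        zify
        rw [Int.toNat_of_nonneg h2]
        linear_combination hk
      refine ⟨N, MvPolynomial.monomial (u.update i k) e, Subtype.ext ?_⟩
      rw [hφX]
      change (_ : MvPolynomial (Fin d) ℂ) = (MvPolynomial.aeval _ _ : cyclicQuotient r a).1
      rw [coe_aeval_invMonomial_monomial v hv, MulMemClass.coe_mul, SubmonoidClass.coe_pow, coe_powVar,
        ← pow_mul, MvPolynomial.X_pow_eq_monomial]
      change e • MvPolynomial.monomial u 1 * _ = _
      rw [MvPolynomial.smul_monomial, MvPolynomial.monomial_mul, smul_eq_mul, mul_one, mul_one]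
      refine congrArg (fun w => MvPolynomial.monomial w e) (Finsupp.ext fun j => ?_)
      by_cases h : j = i
      · subst h
        rw [hvali, Finsupp.add_apply, Finsupp.single_eq_same, mul_comm r, hk,
          Finset.sum_congr rfl fun l hl => by
            rw [Finsupp.coe_update, Function.update_of_ne (Finset.ne_of_mem_erase hl)]]
        simp [hN]
      · rw [hval _ h]
        simp [h]
    | hadd f g hf hg =>
      obtain ⟨n, t, ht⟩ := hf
      obtain ⟨m, s, hs⟩ := hg
      refine ⟨n + m, t * MvPolynomial.X i ^ m + s * MvPolynomial.X i ^ n, ?_⟩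
      rw [map_add, map_mul, map_mul, ← ht, ← hs, map_pow, map_pow]
      ring

end Regular
-- The finite search over floor sums.
section FloorSums

/-- The boxes `∏ [max lᵢ (nᵢ q), min hᵢ ((nᵢ + 1) q))` in the box `∏ [lᵢ, hᵢ)`, for the monotone
sequences `m ≤ n₁ ≤ n₂ ≤ ⋯` of sum `S`. -/
def refineBox (q : ℕ) : List (ℕ × ℕ) → ℕ → ℕ → List (List (ℕ × ℕ))
  | [], _, S => if S = 0 then [[]] else []
  | I :: t, m, S => ((List.range (min ((I.2 - 1) / q) S + 1)).filter
      fun n => m ≤ n ∧ I.1 / q ≤ n).flatMap fun n =>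
        (refineBox q t n (S - n)).map ((max I.1 (n * q), min I.2 ((n + 1) * q)) :: ·)

/-- The point `x` lies in the interval `[l, h)`. -/
def InInterval (x : ℚ) (I : ℕ × ℕ) : Prop := (I.1 : ℚ) ≤ x ∧ x < I.2

lemma exists_mem_refineBox {q : ℕ} (hq : 0 < q) {B : List (ℕ × ℕ)} {x : List ℚ}
    (hB : List.Forall₂ InInterval x B) (hx : x.SortedLE) {m : ℕ}
    (hm : ∀ y ∈ x, m ≤ ⌊y / q⌋₊) :
    ∃ B' ∈ refineBox q B m (x.map fun y : ℚ => ⌊y / q⌋₊).sum, List.Forall₂ InInterval x B' := by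
  induction hB generalizing m with
  | nil => exact ⟨[], by simp [refineBox], List.Forall₂.nil⟩
  | @cons y I x B hI _ ih =>
    rw [List.sortedLE_iff_pairwise, List.pairwise_cons] at hx
    have hq' : (0 : ℚ) < q := by exact_mod_cast hq
    have hy : 0 ≤ y := le_trans (by positivity) hI.1
    have hfl := Nat.floor_le (div_nonneg hy hq'.le)
    have hlt := Nat.lt_floor_add_one (y / q)
    set n := ⌊y / q⌋₊ with hn
    rw [le_div_iff₀ hq'] at hfl
    rw [div_lt_iff₀ hq'] at hlt
    obtain ⟨B', hB', hxB'⟩ := ih (List.sortedLE_iff_pairwise.2 hx.2) (m := n) fun z hz =>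
      Nat.floor_mono (div_le_div_of_nonneg_right (hx.1 z hz) hq'.le)
    refine ⟨(max I.1 (n * q), min I.2 ((n + 1) * q)) :: B', ?_, List.Forall₂.cons ?_ hxB'⟩
    · rw [refineBox, List.mem_flatMap]
      refine ⟨n, ?_, List.mem_map_of_mem ?_⟩
      · rw [List.mem_filter, List.mem_range, decide_eq_true_eq, Nat.lt_add_one_iff, le_min_iff]
        refine ⟨⟨(Nat.le_div_iff_mul_le hq).2 (Nat.le_sub_one_of_lt ?_), ?_⟩,
          hm y List.mem_cons_self, ?_⟩
        · exact_mod_cast hfl.trans_lt hI.2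
        · rw [List.map_cons, List.sum_cons]
          exact Nat.le_add_right _ _
        · rw [← Nat.lt_add_one_iff, Nat.div_lt_iff_lt_mul hq]
          exact_mod_cast hI.1.trans_lt hlt
      · rw [List.map_cons, List.sum_cons, Nat.add_sub_cancel_left]
        exact hB'
    · constructor
      · push_cast
        exact max_le hI.1 hfl
      · push_cast
        exact lt_min hI.2 hlt

/-- The boxes of sorted sequences with values in `[0, N)` and with sum in `(37 / 19 * N, 2 * N)` that
are left after the floors of `j / N` times the entries have been prescribed to have sum `2 * j - 3` for
`2 ≤ j ≤ k + 1`. -/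
def boxes (N : ℕ) : ℕ → List (List (ℕ × ℕ))
  | 0 => [List.replicate 5 (0, N)]
  -- Stage k + 1 treats the multiplier j = k + 2, whose cells have width N / j. The filter drops
  -- boxes that miss the window for the sum.
  | k + 1 => ((boxes N k).flatMap fun B => refineBox (N / (k + 2)) B 0 (2 * (k + 2) - 3)).filter
      fun B => (B.map Prod.fst).sum < 2 * N ∧ 37 * N < 19 * (B.map Prod.snd).sum

/-- 12252240 is the least common multiple of 1, …, 18, so all cell boundaries are integers.
Seventeen stages treat j = 2, …, 18. -/
lemma boxes_eq_nil : boxes 12252240 17 = [] := by decide +kernel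

lemma InInterval.sum_le {x : List ℚ} {B : List (ℕ × ℕ)} (h : List.Forall₂ InInterval x B) :
    ((B.map Prod.fst).sum : ℚ) ≤ x.sum ∧ x.sum ≤ ((B.map Prod.snd).sum : ℚ) := by
  induction h with
  | nil => simp
  | cons h1 _ ih =>
    simp only [List.map_cons, List.sum_cons, Nat.cast_add]
    exact ⟨add_le_add h1.1 ih.1, add_le_add h1.2.le ih.2⟩

lemma exists_mem_boxes {N : ℕ} (hN : 0 < N) {x : List ℚ} (hx : x.SortedLE) (hlen : x.length = 5)
    (h0 : ∀ y ∈ x, 0 ≤ y ∧ y < N) (h1 : x.sum < 2 * N) (h2 : 37 * N < 19 * x.sum) (k : ℕ)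
    (hdvd : ∀ j, 2 ≤ j → j ≤ k + 1 → j ∣ N)
    (h : ∀ j : ℕ, 2 ≤ j → j ≤ k + 1 → (x.map fun y : ℚ => ⌊y * j / N⌋₊).sum = 2 * j - 3) :
    ∃ B ∈ boxes N k, List.Forall₂ InInterval x B := by
  induction k with
  | zero =>
    refine ⟨_, List.mem_singleton_self _, ?_⟩
    rw [List.forall₂_iff_get]
    refine ⟨by simp [hlen], fun i hi _ => ?_⟩
    rw [List.get_eq_getElem, List.get_eq_getElem, List.getElem_replicate, InInterval, Nat.cast_zero]
    exact h0 _ (List.getElem_mem hi)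
  | succ k ih =>
    obtain ⟨B, hB, hxB⟩ := ih (fun j hj hjk => hdvd j hj (by omega)) fun j hj hjk => h j hj (by omega)
    obtain ⟨q, hq⟩ := hdvd (k + 2) (by omega) (by omega)
    have hdiv : N / (k + 2) = q := by rw [hq, Nat.mul_div_cancel_left _ (by omega)]
    have hq0 : 0 < q := Nat.pos_of_ne_zero (by rintro rfl; omega)
    obtain ⟨B', hB', hxB'⟩ := exists_mem_refineBox hq0 hxB hx (m := 0) (by simp)
    refine ⟨B', ?_, hxB'⟩
    have h3 : (x.map fun y : ℚ => ⌊y / q⌋₊).sum = 2 * (k + 2) - 3 := by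
      rw [← h (k + 2) (by omega) (by omega)]
      congr 2
      ext y
      have hk : ((k + 2 : ℕ) : ℚ) ≠ 0 := by positivity
      rw [hq, Nat.cast_mul, mul_comm y, mul_div_mul_left _ _ hk]
    rw [boxes, hdiv, List.mem_filter, List.mem_flatMap, decide_eq_true_eq]
    refine ⟨⟨B, hB, h3 ▸ hB'⟩, ?_, ?_⟩
    · exact_mod_cast (InInterval.sum_le hxB').1.trans_lt h1
    · have := (InInterval.sum_le hxB').2
      have h4 : (37 : ℚ) * N < 19 * ((B'.map Prod.snd).sum : ℚ) := by linarith
      exact_mod_cast h4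

/-- Five numbers in `[0, 1)` with sum in `(37 / 19, 2)` do not satisfy `∑ ⌊j cᵢ⌋ = 2 * j - 3` for
all `2 ≤ j ≤ 18`. -/
theorem exists_sum_floor_ne {c : Fin 5 → ℚ} (hc : ∀ i, 0 ≤ c i ∧ c i < 1) (h1 : ∑ i, c i < 2)
    (h2 : 37 / 19 < ∑ i, c i) : ∃ j : ℕ, 2 ≤ j ∧ j ≤ 18 ∧ ∑ i, ⌊j * c i⌋ ≠ 2 * j - 3 := by
  by_contra! h
  let N : ℕ := 12252240
  have hN : (0 : ℚ) < N := by norm_num [N]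
  -- The conditions are symmetric in the five numbers, so sorting costs nothing and keeps the search
  -- small.
  let x : List ℚ := List.insertionSort (· ≤ ·) (List.ofFn fun i => N * c i)
  have hperm : x.Perm (List.ofFn fun i => N * c i) := List.perm_insertionSort _ _
  have hsum : x.sum = N * ∑ i, c i := by
    rw [hperm.sum_eq, List.sum_ofFn, Finset.mul_sum]
  obtain ⟨B, hB, -⟩ := exists_mem_boxes (N := N) (x := x) (by norm_num [N])
    (List.sortedLE_insertionSort) (by rw [hperm.length_eq, List.length_ofFn])
    (fun y hy => by
      rw [hperm.mem_iff, List.mem_ofFn] at hy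
      obtain ⟨i, rfl⟩ := hy
      exact ⟨mul_nonneg hN.le (hc i).1, by nlinarith [(hc i).2]⟩)
    (by rw [hsum]; nlinarith) (by rw [hsum]; nlinarith) 17
    (fun j hj hj' => by interval_cases j <;> norm_num [N]) (fun j hj hj' => by
      rw [(hperm.map _).sum_eq, List.map_ofFn, List.sum_ofFn]
      have h3 := h j hj hj'
      zify [show 3 ≤ 2 * j by omega]
      rw [← h3]
      refine Finset.sum_congr rfl fun i _ => ?_
      rw [Function.comp_apply, show N * c i * j / N = j * c i by field_simp]
      exact Int.natCast_floor_eq_floor (mul_nonneg (by positivity) (hc i).1))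
  rw [boxes_eq_nil] at hB
  exact List.not_mem_nil hB

end FloorSums
-- The gap below 2 for isolated singularities.
section Bound

variable {d : ℕ} {r : ℕ} {a : Fin d → ℤ} [NeZero r]

variable (r a) in
/-- The coordinates of a lattice vector with respect to the primitive vectors on the rays. -/
noncomputable def cubeCoord : (weightLattice r a →ₗ[ℤ] ℤ) →ₗ[ℤ] (Fin d → ℚ) where
  toFun w i := coordGen r a i * w (ray r a i) / r
  map_add' v w := by
    ext i
    simp only [LinearMap.add_apply, Pi.add_apply]
    push_cast
    ring
  map_smul' n w := by
    ext i
    simp only [LinearMap.smul_apply, Pi.smul_apply, smul_eq_mul, zsmul_eq_mul, RingHom.id_apply]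
    push_cast
    ring

lemma cubeCoord_apply (w : weightLattice r a →ₗ[ℤ] ℤ) (i : Fin d) :
    cubeCoord r a w i = coordGen r a i * w (ray r a i) / r := rfl

lemma toricDiscrepancy_eq_sum (w : weightLattice r a →ₗ[ℤ] ℤ) :
    toricDiscrepancy r a w = ∑ i, cubeCoord r a w i := by
  rw [toricDiscrepancy, canonicalExponent, map_sum]
  simp only [cubeCoord_apply, map_smul, smul_eq_mul]
  push_cast
  rw [Finset.sum_div]

lemma cubeCoord_pos {w : weightLattice r a →ₗ[ℤ] ℤ} {i : Fin d} :
    0 < cubeCoord r a w i ↔ 0 < w (ray r a i) := by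
  have hr : (0 : ℚ) < r := by exact_mod_cast NeZero.pos r
  have hg : (0 : ℚ) < coordGen r a i := by exact_mod_cast coordGen_pos i
  rw [cubeCoord_apply, div_pos_iff_of_pos_right hr, mul_pos_iff_of_pos_left hg, Int.cast_pos]

lemma cubeCoord_primCoord (i j : Fin d) :
    cubeCoord r a (primCoord r a i) j = if j = i then 1 else 0 := by
  have hr : (r : ℚ) ≠ 0 := by exact_mod_cast NeZero.ne r
  have h := coordGen_mul_primCoord i (ray r a j)
  rw [ray_apply] at h
  rw [cubeCoord_apply]
  split_ifs at h ⊢ with hij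
  · subst hij
    rw [div_eq_one_iff_eq hr]
    exact_mod_cast h
  · rw [(mul_eq_zero.1 h).resolve_left (coordGen_pos i).ne']
    simp

lemma cubeCoord_add_sum_primCoord (w : weightLattice r a →ₗ[ℤ] ℤ) (z : Fin d → ℤ) (i : Fin d) :
    cubeCoord r a (w + ∑ j, z j • primCoord r a j) i = cubeCoord r a w i + z i := by
  rw [map_add, map_sum, Pi.add_apply, Finset.sum_apply]
  simp [cubeCoord_primCoord]

/-- The translate of a lattice vector into the unit cube. -/
lemma exists_cubeCoord_eq_fract (w : weightLattice r a →ₗ[ℤ] ℤ) :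
    ∃ v, ∀ i, cubeCoord r a v i = Int.fract (cubeCoord r a w i) := by
  refine ⟨w + ∑ j, (-⌊cubeCoord r a w j⌋) • primCoord r a j, fun i => ?_⟩
  rw [cubeCoord_add_sum_primCoord, Int.fract]
  push_cast
  ring

-- The values are nonnegative integers divided by r, and the sum of the primitive vectors is an
-- interior point; well-ordering does the rest.
variable (r a) in
lemma exists_isLeast_toricDiscrepancy :
    ∃ μ, IsLeast {q : ℚ | ∃ w : weightLattice r a →ₗ[ℤ] ℤ, (∀ i, 0 < w (ray r a i)) ∧
      toricDiscrepancy r a w = q} μ := by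
  have hr : (0 : ℚ) < r := by exact_mod_cast NeZero.pos r
  have hnonneg {w : weightLattice r a →ₗ[ℤ] ℤ} (hw : ∀ i, 0 < w (ray r a i)) :
      0 ≤ w (canonicalExponent r a) := by
    rw [canonicalExponent, map_sum]
    refine Finset.sum_nonneg fun i _ => ?_
    rw [map_smul, smul_eq_mul]
    exact mul_nonneg (coordGen_pos i).le (hw i).le
  let S : Set ℕ := {n : ℕ | ∃ w : weightLattice r a →ₗ[ℤ] ℤ, (∀ i, 0 < w (ray r a i)) ∧
    w (canonicalExponent r a) = n}
  have hne : S.Nonempty := by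
    have hpos (i : Fin d) : 0 < (0 + ∑ j, (1 : ℤ) • primCoord r a j) (ray r a i) := by
      rw [← cubeCoord_pos, cubeCoord_add_sum_primCoord]
      simp
    exact ⟨_, _, hpos, (Int.toNat_of_nonneg (hnonneg hpos)).symm⟩
  obtain ⟨w, hw, hwn⟩ := Nat.sInf_mem hne
  refine ⟨_, ⟨w, hw, rfl⟩, ?_⟩
  rintro _ ⟨v, hv, rfl⟩
  have h1 := Nat.sInf_le (show (v (canonicalExponent r a)).toNat ∈ S from
    ⟨v, hv, (Int.toNat_of_nonneg (hnonneg hv)).symm⟩)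
  refine div_le_div_of_nonneg_right ?_ hr.le
  have := hnonneg hv
  exact_mod_cast (by omega : w (canonicalExponent r a) ≤ v (canonicalExponent r a))

/-- On an isolated singularity, a lattice vector with one integral coordinate is integral. -/
lemma IsIsolatedSingularity.fract_cubeCoord_eq_zero (h : IsIsolatedSingularity (origin r a))
    (w : weightLattice r a →ₗ[ℤ] ℤ) {i : Fin d} (hi : Int.fract (cubeCoord r a w i) = 0)
    (j : Fin d) : Int.fract (cubeCoord r a w j) = 0 := by
  classical
  by_contra hj
  obtain ⟨v, hv⟩ := exists_cubeCoord_eq_fract w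
  have hr : (0 : ℚ) < r := by exact_mod_cast NeZero.pos r
  -- The fractional parts of w lie in the open unit cube of the face F. Since i ∉ F, the generic
  -- point of that face is a proper generalization of the origin, hence regular, a contradiction.
  let F : Finset (Fin d) := Finset.univ.filter fun l => Int.fract (cubeCoord r a w l) ≠ 0
  have hF {l : Fin d} : l ∈ F ↔ Int.fract (cubeCoord r a w l) ≠ 0 := by simp [F]
  refine not_isRegularLocalRing_facePrime F ⟨j, hF.2 hj⟩ v (fun l hl => ?_) (fun l hl => ?_)
    (h.2 _ (lt_of_le_of_ne ?_ fun heq => ?_))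
  · refine ⟨cubeCoord_pos.1 ?_, ?_⟩
    · rw [hv]
      exact lt_of_le_of_ne (Int.fract_nonneg _) (hF.1 hl).symm
    · have h1 := Int.fract_lt_one (cubeCoord r a w l)
      rw [← hv, cubeCoord_apply, div_lt_one hr] at h1
      exact_mod_cast h1
  · have h1 := hv l
    rw [not_not.1 (mt hF.2 hl), cubeCoord_apply, div_eq_zero_iff] at h1
    have h2 := (mul_eq_zero.1 (h1.resolve_right hr.ne')).resolve_left
      (by exact_mod_cast (coordGen_pos l).ne')
    exact_mod_cast h2
  · refine facePrime_le fun l _ => ?_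
    rw [← facePrime_univ, powVar_mem_facePrime_iff]
    trivial
  · have h1 : powVar r a i ∈ (facePrime r a F).asIdeal := by
      rw [heq, ← facePrime_univ, powVar_mem_facePrime_iff]
      trivial
    exact hF.1 (powVar_mem_facePrime_iff.1 h1) hi

/-- A vanishing fractional part would make all coordinates of w integral, and hence their sum. So
the fractional parts form an interior lattice vector, to which minimality applies. -/
lemma IsIsolatedSingularity.le_sum_fract (h : IsIsolatedSingularity (origin r a)) {μ : ℚ}
    (hμ : ∀ w : weightLattice r a →ₗ[ℤ] ℤ, (∀ i, 0 < w (ray r a i)) → μ ≤ toricDiscrepancy r a w)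
    (w : weightLattice r a →ₗ[ℤ] ℤ) (hw : ∀ n : ℤ, toricDiscrepancy r a w ≠ n) :
    μ ≤ ∑ i, Int.fract (cubeCoord r a w i) := by
  obtain ⟨v, hv⟩ := exists_cubeCoord_eq_fract w
  rw [← Finset.sum_congr rfl fun i _ => hv i, ← toricDiscrepancy_eq_sum]
  refine hμ v fun i => cubeCoord_pos.1 ?_
  rw [hv]
  refine lt_of_le_of_ne (Int.fract_nonneg _) fun hi => ?_
  refine hw (∑ j, ⌊cubeCoord r a w j⌋) ?_
  rw [toricDiscrepancy_eq_sum]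
  push_cast
  refine Finset.sum_congr rfl fun j _ => ?_
  have := h.fract_cubeCoord_eq_zero w hi.symm j
  rw [Int.fract] at this
  linarith

theorem IsIsolatedSingularity.le_of_isLeast {a : Fin 5 → ℤ}
    (h : IsIsolatedSingularity (origin r a)) {μ : ℚ}
    (hμ : IsLeast {q : ℚ | ∃ w : weightLattice r a →ₗ[ℤ] ℤ, (∀ i, 0 < w (ray r a i)) ∧
      toricDiscrepancy r a w = q} μ) (h2 : μ < 2) : μ ≤ 2 - 1 / 19 := by
  by_contra! hlt
  obtain ⟨⟨w, hw, hwμ⟩, hmin⟩ := hμ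
  have hmin' (v : weightLattice r a →ₗ[ℤ] ℤ) (hv : ∀ i, 0 < v (ray r a i)) :
      μ ≤ toricDiscrepancy r a v := hmin ⟨v, hv, rfl⟩
  have hsum : ∑ i, cubeCoord r a w i = μ := by rw [← toricDiscrepancy_eq_sum, hwμ]
  have hmul (n : ℤ) : toricDiscrepancy r a (n • w) = n * μ := by
    rw [toricDiscrepancy_eq_sum, map_smul, ← hsum, Finset.mul_sum]
    simp
  -- From 0 < 2 - μ < 1/19 it follows that 2j - 1 < jμ < 2j for j ≤ 18.
  have hne (j : ℤ) (hj : 0 < j) (hj' : j ≤ 18) (n : ℤ) : j * μ ≠ n := fun hn => by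
    have hj1 : (0 : ℚ) < j := by exact_mod_cast hj
    have hj2 : (j : ℚ) ≤ 18 := by exact_mod_cast hj'
    have h3 : n < 2 * j := by
      have : (n : ℚ) < 2 * j := by rw [← hn]; nlinarith
      exact_mod_cast this
    have h4 : 2 * j - 1 < n := by
      have : (2 * j - 1 : ℚ) < n := by rw [← hn]; nlinarith
      exact_mod_cast this
    omega
  have hfract (j : ℤ) (hj : 0 < j) (hj' : j ≤ 18) :
      μ ≤ j * μ - ∑ i, (⌊j * cubeCoord r a w i⌋ : ℚ) := by
    have h3 := h.le_sum_fract hmin' (j • w) fun n => by rw [hmul]; exact hne j hj hj' n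
    simp only [map_smul, Pi.smul_apply, zsmul_eq_mul, Int.fract] at h3
    rwa [Finset.sum_sub_distrib, ← Finset.mul_sum, hsum] at h3
  -- The same bound for -j w, where the fractional part of -y is at most 1 - y + ⌊y⌋.
  have hfract' (j : ℤ) (hj : 0 < j) (hj' : j ≤ 18) :
      μ ≤ 5 - j * μ + ∑ i, (⌊j * cubeCoord r a w i⌋ : ℚ) := by
    have h3 := h.le_sum_fract hmin' ((-j) • w) fun n hn => by
      rw [hmul] at hn
      refine hne j hj hj' (-n) ?_
      push_cast at hn ⊢
      linarith
    refine h3.trans ?_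
    simp only [map_smul, Pi.smul_apply, zsmul_eq_mul, Int.fract]
    rw [← hsum, Finset.mul_sum, show (5 : ℚ) = ∑ i : Fin 5, 1 by simp, ← Finset.sum_sub_distrib,
      ← Finset.sum_add_distrib]
    refine Finset.sum_le_sum fun i _ => ?_
    push_cast
    rw [neg_mul, Int.floor_neg]
    have h4 : (⌈j * cubeCoord r a w i⌉ : ℚ) ≤ ⌊j * cubeCoord r a w i⌋ + 1 := by
      exact_mod_cast Int.ceil_le_floor_add_one _
    push_cast
    linarith
  have hpos (i : Fin 5) : 0 < cubeCoord r a w i := cubeCoord_pos.2 (hw i)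
  -- For j = 1 the bound forces the nonnegative integers ⌊cᵢ⌋ to have sum at most 0.
  have hlt1 (i : Fin 5) : cubeCoord r a w i < 1 := by
    have h3 := hfract 1 (by norm_num) (by norm_num)
    simp only [Int.cast_one, one_mul] at h3
    have h4 : ∑ i, ⌊cubeCoord r a w i⌋ ≤ 0 := by
      have : ∑ i, (⌊cubeCoord r a w i⌋ : ℚ) ≤ 0 := by linarith
      exact_mod_cast this
    have h5 (i : Fin 5) : 0 ≤ ⌊cubeCoord r a w i⌋ := Int.floor_nonneg.2 (hpos i).le
    have h6 := (Finset.single_le_sum (fun i _ => h5 i) (Finset.mem_univ i)).trans h4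
    have h7 : ⌊cubeCoord r a w i⌋ < 1 := by omega
    simpa using Int.floor_lt.1 h7
  obtain ⟨j, hj, hj', hne'⟩ := exists_sum_floor_ne (fun i => ⟨(hpos i).le, hlt1 i⟩)
    (hsum ▸ h2) (by rw [hsum]; linarith)
  apply hne'
  have h3 := hfract j (by omega) (by omega)
  have h4 := hfract' j (by omega) (by omega)
  have hj1 : (2 : ℚ) ≤ j := by exact_mod_cast hj
  have hj2 : (j : ℚ) ≤ 18 := by exact_mod_cast hj'
  simp only [Int.cast_natCast] at h3 h4
  -- The sum is at most (j - 1) μ, and μ < 2; strictness needs j ≥ 2.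
  have h5 : ∑ i, ⌊j * cubeCoord r a w i⌋ < 2 * j - 2 := by
    have : ∑ i, (⌊j * cubeCoord r a w i⌋ : ℚ) < 2 * j - 2 := by nlinarith
    exact_mod_cast this
  -- The sum is at least (j + 1) μ - 5 > 2j - 3 - (j + 1)/19, and j + 1 ≤ 19. This is where the
  -- constant 19 is used to the full.
  have h6 : (2 * j - 4 : ℤ) < ∑ i, ⌊j * cubeCoord r a w i⌋ := by
    have : (2 * j - 4 : ℚ) < ∑ i, (⌊j * cubeCoord r a w i⌋ : ℚ) := by nlinarith
    exact_mod_cast this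
  omega

end Bound

/-! ### The extremal example. -/

section Example

variable {d : ℕ} {r : ℕ} {a : Fin d → ℤ} [NeZero r]

variable (r a) in
/-- The vector `(1 / r) (a₁, …, a_d)` of the dual lattice. -/
def weightVector : weightLattice r a →ₗ[ℤ] ℤ where
  toFun m := (∑ i, a i * m.1 i) / r
  map_add' m n := by
    rw [← Int.add_ediv_of_dvd_left m.2, ← Finset.sum_add_distrib]
    simp only [Submodule.coe_add, Pi.add_apply, mul_add]
  map_smul' k m := by
    rw [RingHom.id_apply, smul_eq_mul, ← Int.mul_ediv_assoc _ m.2, Finset.mul_sum]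
    congr 1
    refine Finset.sum_congr rfl fun i _ => ?_
    rw [Submodule.coe_smul, Pi.smul_apply, smul_eq_mul]
    ring

lemma weightVector_ray (i : Fin d) : weightVector r a (ray r a i) = a i := by
  have hr : (r : ℤ) ≠ 0 := by exact_mod_cast NeZero.ne r
  change (∑ j, a j * (ray r a i).1 j) / r = a i
  simp only [ray_apply, mul_ite, mul_zero, Finset.sum_ite_eq, Finset.mem_univ, if_true]
  exact Int.mul_ediv_cancel _ hr

/-- One invariant Laurent monomial with i-th exponent 1 rules out quasi-reflections in xᵢ. -/
lemma coordGen_eq_one {i : Fin d} {m : Fin d → ℤ} (hm : m ∈ weightLattice r a) (hi : m i = 1) :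
    coordGen r a i = 1 := by
  have h : coordGen r a i ∣ 1 := hi ▸ ⟨_, (coordGen_mul_primCoord i ⟨m, hm⟩).symm⟩
  exact Int.eq_one_of_dvd_one (coordGen_pos i).le h

lemma exists_powVar_notMem_of_lt_origin {p : PrimeSpectrum (cyclicQuotient r a)}
    (hp : p < origin r a) : ∃ i, powVar r a i ∉ p.asIdeal := by
  by_contra! h
  refine hp.not_ge ?_
  rw [← facePrime_univ]
  exact facePrime_le fun i _ => h i

/-- If `μ_r` acts freely outside the origin and the weights define a vector in the interior of the
unit cube, then the quotient has an isolated singularity. -/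
lemma isIsolatedSingularity_origin (hd : 0 < d) (ha : ∀ i, IsCoprime (a i) (r : ℤ))
    (hpos : ∀ i, 0 < a i ∧ coordGen r a i * a i < r) : IsIsolatedSingularity (origin r a) := by
  constructor
  · have h := not_isRegularLocalRing_facePrime (r := r) (a := a) Finset.univ
      ⟨⟨0, hd⟩, Finset.mem_univ _⟩ (weightVector r a) (fun i _ => by rw [weightVector_ray]; exact hpos i) (by simp)
    rw [Finset.coe_univ, facePrime_univ] at h
    exact h
  · intro p hp
    obtain ⟨i, hi⟩ := exists_powVar_notMem_of_lt_origin hp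
    exact isRegularLocalRing_of_powVar_notMem i (ha i) p hi

/-- The monomials are xᵢ x₄ ^ aᵢ for i < 4, of weight 19 aᵢ because the last weight is 18, and x₀ ^
13 x₄, of weight 57. They show that every `coordGen` is 1 and give congruences between the values on
rays. -/
lemma single_add_mem_weightLattice (i : Fin 5) :
    (fun j => (if j = i then 1 else 0) + if j = 4 then ![3, 4, 5, 7, 0] i else
      if j = 0 then ![0, 0, 0, 0, 13] i else 0) ∈ weightLattice 19 ![3, 4, 5, 7, 18] := by
  rw [mem_weightLattice, Fin.sum_univ_five]
  fin_cases i <;> simp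

lemma coordGen_example (i : Fin 5) : coordGen 19 ![3, 4, 5, 7, 18] i = 1 :=
  coordGen_eq_one (single_add_mem_weightLattice i) (by fin_cases i <;> simp)

lemma isLeast_toricDiscrepancy_example :
    IsLeast {q : ℚ | ∃ w : weightLattice 19 ![3, 4, 5, 7, 18] →ₗ[ℤ] ℤ,
      (∀ i, 0 < w (ray 19 ![3, 4, 5, 7, 18] i)) ∧ toricDiscrepancy 19 ![3, 4, 5, 7, 18] w = q}
      (2 - 1 / 19) := by
  constructor
  · refine ⟨weightVector 19 ![3, 4, 5, 7, 18], fun i => ?_, ?_⟩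
    · rw [weightVector_ray]
      fin_cases i <;> simp
    · rw [toricDiscrepancy_eq_sum]
      simp only [cubeCoord_apply, coordGen_example, weightVector_ray, Fin.sum_univ_five]
      simp only [Matrix.cons_val]
      norm_num
  · rintro _ ⟨w, hw, rfl⟩
    rw [toricDiscrepancy_eq_sum]
    simp only [cubeCoord_apply, coordGen_example, Fin.sum_univ_five]
    -- Integrality of w on these monomials says kᵢ + aᵢ k₄ ≡ 0 modulo 19 for i < 4.
    have h (i : Fin 5) := mul_apply_eq_sum w ⟨_, single_add_mem_weightLattice i⟩
    have h0 := h 0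
    have h1 := h 1
    have h2 := h 2
    have h3 := h 3
    simp [Fin.sum_univ_five] at h0 h1 h2 h3
    have p0 := hw 0
    have p1 := hw 1
    have p2 := hw 2
    have p3 := hw 3
    have p4 := hw 4
    generalize w (ray 19 ![3, 4, 5, 7, 18] 0) = k₀ at *
    generalize w (ray 19 ![3, 4, 5, 7, 18] 1) = k₁ at *
    generalize w (ray 19 ![3, 4, 5, 7, 18] 2) = k₂ at *
    generalize w (ray 19 ![3, 4, 5, 7, 18] 3) = k₃ at *
    generalize w (ray 19 ![3, 4, 5, 7, 18] 4) = k₄ at *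
    have hsum : 37 ≤ k₀ + k₁ + k₂ + k₃ + k₄ := by
      by_contra! hlt
      -- All kᵢ are positive, so k₄ takes finitely many values, and for each of them the congruences
      -- bound the other kᵢ below by their least positive residues.
      have : k₄ < 37 := by omega
      interval_cases k₄ <;> omega
    have hsum' : (37 : ℚ) ≤ k₀ + k₁ + k₂ + k₃ + k₄ := by exact_mod_cast hsum
    push_cast
    linarith

end Example

end MldGap

theorem theorem1p5 :
    (∀ (r : ℕ) (_ : 0 < r) (a : Fin 5 → ℤ),
      MldGap.IsIsolatedSingularity (MldGap.origin r a) →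
      ∃ μ : ℚ,
        MldGap.IsMld (FractionRing (MldGap.cyclicQuotient r a)) 5 (MldGap.origin r a) μ ∧
        (μ < 2 → μ ≤ 2 - 1 / 19)) ∧
    MldGap.IsIsolatedSingularity (MldGap.origin 19 ![3, 4, 5, 7, 18]) ∧
    MldGap.IsMld (FractionRing (MldGap.cyclicQuotient 19 ![3, 4, 5, 7, 18])) 5
      (MldGap.origin 19 ![3, 4, 5, 7, 18]) (2 - 1 / 19) := by
  refine ⟨fun r hr a h => ?_, ?_, ?_⟩
  · have : NeZero r := ⟨hr.ne'⟩
    obtain ⟨μ, hμ⟩ := MldGap.exists_isLeast_toricDiscrepancy r a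
    exact ⟨μ, MldGap.isMld_of_isLeast _ 0 hμ, h.le_of_isLeast hμ⟩
  · refine MldGap.isIsolatedSingularity_origin (by norm_num) (fun i => ?_) fun i => ?_
    · rw [Int.isCoprime_iff_gcd_eq_one]
      fin_cases i <;> rfl
    · rw [MldGap.coordGen_example]
      fin_cases i <;> simp
  · exact MldGap.isMld_of_isLeast _ 0 MldGap.isLeast_toricDiscrepancy_example
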